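/- **Setting.** Let $N\ge 1$, $p=p_F:=1+\frac2N$, $0<\epsilon<\frac N2$, and on $\mathbf R^N$ let $$f_\epsilon(x):=|x|^{-N}\,\bigl|\log|x|\bigr|^{-\frac N2-1+\epsilon}\,\chi_{B(0,1/e)}(x).$$ For $0<\alpha<1$ and a nonnegative Radon measure $\mu$ on $\mathbf R^N$ consider the time-fractional problem (with the Caputo derivative) $\partial_t^\alpha u-\Delta u=u^p$, $u(0)=\mu$, in the following sense. Let $G(t,x)=(4\pi t)^{-N/2}e^{-|x|^2/(4t)}$, $e^{t\Delta}\mu(x)=\int_{\mathbf R^N}G(t,x-y)\,d\mu(y)$, and let $h_\alpha>0$ be the probability density on $(0,\infty)$ characterized by $\int_0^\infty h_\alpha(\theta)e^{z\theta}\,d\theta=\sum_{k\ge0}\frac{z^k}{\Gamma(\alpha k+1)}$ for all $z\in\mathbf C$. Put $$P_\alpha(t)\mu=\int_0^\infty h_\alpha(\theta)\,e^{t^\alpha\theta\Delta}\mu\,d\theta,\qquad S_\alpha(t)\mu=\int_0^\infty\theta h_\alpha(\theta)\,e^{t^\alpha\theta\Delta}\mu\,d\theta .$$ For $0<T<\infty$,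 a nonnegative measurable function $u$ on $(0,T]\times\mathbf R^N$ is a solution in $[0,T]\times\mathbf R^N$ if $$\infty>u(t,x)=[P_\alpha(t)\mu](x)+\alpha\int_0^t(t-s)^{\alpha-1}[S_\alpha(t-s)u(s)^p](x)\,ds$$ for almost all $t\in(0,T]$ and $x\in\mathbf R^N$; it is minimal if $u\le v$ almost everywhere for every solution $v$ in $[0,T]\times\mathbf R^N$. The life span is $$T_\alpha[\mu]:=\sup\{T'>0:\ \text{a minimal solution exists in }[0,T']\times\mathbf R^N\}\in[0,\infty].$$ A locally integrable function $\phi\ge 0$ is identified with the measure $\phi\,dx$. **Theorem 4.2.** There are constants $0<c<C$, depending only on $N$ and $\epsilon$, such that for each $\kappa>0$ there exists $\alpha(\kappa,\epsilon)\in(0,1)$ with $$-C\,\kappa^{\frac{2}{N-2\epsilon}}(1-\alpha)^{-\frac{N}{N-2\epsilon}}\ \le\ \log T_\alpha[\kappa f_\epsilon]\ \le\ -c\,\kappa^{\frac{2}{N-2\epsilon}}(1-\alpha)^{-\frac{N}{N-2\epsilon}}$$ for all $\alpha(\kappa,\epsilon)<\alpha<1$. In particular, $\lim_{\alpha\to1-0}T_\alpha[\kappa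 f_\epsilon]=0$ for all $\kappa>0$. -/

import Mathlib

open Real Set MeasureTheory Filter Topology
open scoped ENNReal

namespace TimeFracHeat

/-! ### The probability density `h_α` -/

/-- The kernel `A_α(u) = (sin(αu)^α sin((1-α)u)^(1-α) / sin u)^(1/(1-α))`, `0 < u < π`. -/
noncomputable def stableKernel (α u : ℝ) : ℝ :=
  (sin (α * u) ^ α * sin ((1 - α) * u) ^ (1 - α) / sin u) ^ (1 / (1 - α))

/-- The probability density `h_α` on `(0,∞)` (the M-Wright function), in the classical closed form
`h_α(θ) = θ^(α/(1-α)) / (π(1-α)) ∫_0^π A_α(u) exp(-A_α(u) θ^(1/(1-α))) du`.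
It is proved below, for `0 < α < 1`, that it is positive on `(0,∞)` (`subDensity_pos`) and that it
satisfies the identity which characterizes `h_α`, namely
`∫_0^∞ h_α(θ) exp(zθ) dθ = E_{α,1}(z)` for every `z ∈ ℂ` (`integral_subDensity_mul_exp`). -/
noncomputable def subDensity (α θ : ℝ) : ℝ :=
  1 / (π * (1 - α)) * θ ^ (α / (1 - α)) *
    ∫ u in Ioo 0 π, stableKernel α u * exp (-stableKernel α u * θ ^ (1 / (1 - α)))

/-- The Mittag-Leffler function `E_{α,β}(z) = ∑ z^k / Γ(αk+β)`. -/
noncomputable def mittagLeffler (α β z : ℂ) : ℂ :=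
  ∑' k : ℕ, z ^ k / Complex.Gamma (α * k + β)

/-! ### The equation -/

/-- `ℝ^N` with the Euclidean norm. -/
abbrev Space (N : ℕ) : Type := EuclideanSpace ℝ (Fin N)

/-- The Fujita exponent `p_F = 1 + 2/N`. -/
noncomputable def fujitaExponent (N : ℕ) : ℝ := 1 + 2 / N

/-- The Gauss kernel `G(t,x) = (4πt)^(-N/2) exp(-|x|²/(4t))`. -/
noncomputable def heatKernel {N : ℕ} (t : ℝ) (x : Space N) : ℝ :=
  1 / (4 * π * t) ^ ((N : ℝ) / 2) * exp (-‖x‖ ^ 2 / (4 * t))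

/-- `(e^{tΔ} μ)(x) = ∫ G(t,x-y) dμ(y)` for a nonnegative measure `μ`, with values in `[0,∞]`. -/
noncomputable def heatSemigroup {N : ℕ} (t : ℝ) (μ : Measure (Space N)) (x : Space N) : ℝ≥0∞ :=
  ∫⁻ y, ENNReal.ofReal (heatKernel t (x - y)) ∂μ

/-- `P_α(t) μ = ∫_0^∞ h_α(θ) e^{t^α θ Δ} μ dθ`. -/
noncomputable def opP {N : ℕ} (α t : ℝ) (μ : Measure (Space N)) (x : Space N) : ℝ≥0∞ :=
  ∫⁻ θ in Ioi (0 : ℝ), ENNReal.ofReal (subDensity α θ) * heatSemigroup (t ^ α * θ) μ x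

/-- `S_α(t) μ = ∫_0^∞ θ h_α(θ) e^{t^α θ Δ} μ dθ`. -/
noncomputable def opS {N : ℕ} (α t : ℝ) (μ : Measure (Space N)) (x : Space N) : ℝ≥0∞ :=
  ∫⁻ θ in Ioi (0 : ℝ), ENNReal.ofReal (θ * subDensity α θ) * heatSemigroup (t ^ α * θ) μ x

/-- The right-hand side of the integral equation,
`[P_α(t) μ](x) + α ∫_0^t (t-s)^(α-1) [S_α(t-s) u(s)^p](x) ds`, with values in `[0,∞]`;
the function `u(s)^p` is identified with the measure `u(s)^p dx`. -/
noncomputable def mildRHS {N : ℕ} (α p : ℝ) (μ : Measure (Space N)) (u : ℝ → Space N → ℝ≥0∞)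
    (t : ℝ) (x : Space N) : ℝ≥0∞ :=
  opP α t μ x + ENNReal.ofReal α * ∫⁻ s in Ioo 0 t, ENNReal.ofReal ((t - s) ^ (α - 1)) *
    opS α (t - s) (volume.withDensity fun y => u s y ^ p) x

/-- `u` is a (nonnegative) solution in `[0,T] × ℝ^N` of `∂_t^α u - Δu = u^p`, `u(0) = μ`. Only the
values of `u` on `(0,T] × ℝ^N` matter. -/
def IsSolution {N : ℕ} (α p : ℝ) (μ : Measure (Space N)) (T : ℝ)
    (u : ℝ → Space N → ℝ≥0∞) : Prop :=
  AEMeasurable (Function.uncurry u) ((volume.restrict (Ioc 0 T)).prod volume) ∧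
    ∀ᵐ t ∂(volume.restrict (Ioc 0 T)), ∀ᵐ x ∂(volume : Measure (Space N)),
      u t x < ∞ ∧ u t x = mildRHS α p μ u t x

/-- `u` is a solution in `[0,T] × ℝ^N` lying below every solution in `[0,T] × ℝ^N`. -/
def IsMinimalSolution {N : ℕ} (α p : ℝ) (μ : Measure (Space N)) (T : ℝ)
    (u : ℝ → Space N → ℝ≥0∞) : Prop :=
  IsSolution α p μ T u ∧ ∀ v, IsSolution α p μ T v →
    ∀ᵐ t ∂(volume.restrict (Ioc 0 T)), ∀ᵐ x ∂(volume : Measure (Space N)), u t x ≤ v t x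

/-- The life span `T_α[μ] ∈ [0,∞]`: the supremum of the `T' > 0` such that the minimal solution
exists in `[0,T'] × ℝ^N`. -/
noncomputable def lifeSpan {N : ℕ} (α p : ℝ) (μ : Measure (Space N)) : ℝ≥0∞ :=
  sSup (ENNReal.ofReal '' {T' : ℝ | 0 < T' ∧ ∃ u, IsMinimalSolution α p μ T' u})

/-! ### The initial data -/

/-- `f_ε(x) = |x|^(-N) |log|x||^(-N/2-1+ε)` on the ball `B(0,1/e)`, and `0` elsewhere. -/
noncomputable def fData (N : ℕ) (ε : ℝ) (x : Space N) : ℝ :=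
  (Metric.ball (0 : Space N) (1 / exp 1)).indicator
    (fun x => ‖x‖ ^ (-(N : ℝ)) * |log ‖x‖| ^ (-(N : ℝ) / 2 - 1 + ε)) x

/-- A nonnegative function `φ` regarded as the measure `φ dx`. -/
noncomputable def toMeasure {N : ℕ} (φ : Space N → ℝ) : Measure (Space N) :=
  volume.withDensity fun x => ENNReal.ofReal (φ x)

/-! ### Verification that `subDensity` is the density `h_α` -/

theorem inv_Gamma_eq (x : ℝ) : (Gamma x)⁻¹ = x * (Gamma (x + 1))⁻¹ := by
  rcases eq_or_ne x 0 with rfl | h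
  · simp
  · rw [Real.Gamma_add_one h, mul_inv, ← mul_assoc, mul_inv_cancel₀ h, one_mul]

theorem exists_primitive (k : ℕ) : ∀ x : ℝ, ∃ Φ : ℂ → ℂ,
    (∀ w, HasDerivAt Φ ((1 + Complex.exp w) ^ k * Complex.exp (-(x * w))) w) ∧
    (∀ r : ℝ, (Φ r).im = 0) ∧
    (Φ (π * Complex.I)).im = π * (k.factorial * (Gamma (1 + x))⁻¹ * (Gamma (1 + k - x))⁻¹) := by
  induction k with
  | zero =>
    intro x
    rcases eq_or_ne x 0 with rfl | hx
    · refine ⟨fun w => w, fun w => ?_, by simp, by simp⟩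
      simpa using hasDerivAt_id' w
    · have hx' : (x : ℂ) ≠ 0 := by exact_mod_cast hx
      refine ⟨fun w => Complex.exp (-(x * w)) / (-x), fun w => ?_, fun r => ?_, ?_⟩
      · have h1 : HasDerivAt (fun w : ℂ => -((x : ℂ) * w)) (-x) w := by
          convert! ((hasDerivAt_id' w).const_mul (x : ℂ)).neg using 1
          rw [mul_one]
        have h2 := (h1.cexp).div_const (-(x : ℂ))
        convert! h2 using 1
        field_simp
        try ring
      · have : Complex.exp (-(x * (r : ℂ))) / (-x) = ((exp (-(x * r)) / (-x) : ℝ) : ℂ) := by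
          push_cast; rfl
        beta_reduce
        rw [this, Complex.ofReal_im]
      · have e : Complex.exp (-(x * (π * Complex.I))) = Complex.exp ((-(x * π) : ℝ) * Complex.I) := by
          congr 1; push_cast; ring
        have e2 : (-(x : ℂ)) = ((-x : ℝ) : ℂ) := by push_cast; rfl
        beta_reduce
        rw [e, e2, Complex.div_ofReal_im, Complex.exp_ofReal_mul_I_im]
        have g := Real.Gamma_mul_Gamma_one_sub x
        have g2 : (Gamma (1 + x))⁻¹ * (Gamma (1 - x))⁻¹ = (x * (π / sin (π * x)))⁻¹ := by
          rw [← g, add_comm, Real.Gamma_add_one hx, ← mul_inv, mul_assoc]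
        simp only [Nat.factorial_zero, Nat.cast_one, one_mul, Nat.cast_zero, add_zero]
        rw [g2, mul_inv, inv_div, Real.sin_neg, mul_comm x π]
        field_simp
  | succ k ih =>
    intro x
    obtain ⟨Φ, h1, h2, h3⟩ := ih x
    obtain ⟨Ψ, h1', h2', h3'⟩ := ih (x - 1)
    refine ⟨fun w => Φ w + Ψ w, fun w => ?_, fun r => by simp [h2, h2'], ?_⟩
    · convert! (h1 w).add (h1' w) using 1
      have : Complex.exp (-(((x - 1 : ℝ) : ℂ) * w)) = Complex.exp w * Complex.exp (-(x * w)) := by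
        rw [← Complex.exp_add]; congr 1; push_cast; ring
      rw [this]; ring
    · rw [Complex.add_im, h3, h3']
      have a1 := inv_Gamma_eq (1 + k - x)
      have a2 := inv_Gamma_eq x
      have e1 : 1 + (k : ℝ) - x + 1 = 1 + ((k + 1 : ℕ) : ℝ) - x := by push_cast; ring
      have e2 : 1 + (k : ℝ) - (x - 1) = 1 + ((k + 1 : ℕ) : ℝ) - x := by push_cast; ring
      have e3 : 1 + (x - 1) = x := by ring
      rw [e2, e3, a1, a2, e1, Nat.factorial_succ, add_comm x 1]
      push_cast; ring

section
variable {α u : ℝ}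

theorem sin_pos1 (h0 : 0 < α) (h1 : α < 1) (hu : u ∈ Ioo 0 π) : 0 < sin (α * u) :=
  sin_pos_of_pos_of_lt_pi (mul_pos h0 hu.1) (by nlinarith [hu.1, hu.2])

theorem sin_pos2 (h0 : 0 < α) (h1 : α < 1) (hu : u ∈ Ioo 0 π) : 0 < sin ((1 - α) * u) :=
  sin_pos1 (by linarith) (by linarith) hu

theorem sin_ge (h0 : 0 < α) (h1 : α < 1) (hu : u ∈ Ioo 0 π) : α * sin u ≤ sin (α * u) := by
  have := strictConcaveOn_sin_Icc.concaveOn.2 (x := u) (y := 0) ⟨hu.1.le, hu.2.le⟩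
    ⟨le_rfl, pi_pos.le⟩ h0.le (sub_nonneg.2 h1.le) (by ring)
  simpa using this

/-- the reciprocal kernel -/
noncomputable def W (α u : ℝ) : ℝ := sin u / (sin (α * u) ^ α * sin ((1 - α) * u) ^ (1 - α))

theorem W_pos (h0 : 0 < α) (h1 : α < 1) (hu : u ∈ Ioo 0 π) : 0 < W α u := by
  have := sin_pos1 h0 h1 hu
  have := sin_pos2 h0 h1 hu
  have := sin_pos_of_pos_of_lt_pi hu.1 hu.2
  unfold W; positivity

theorem stableKernel_eq (h0 : 0 < α) (h1 : α < 1) (hu : u ∈ Ioo 0 π) :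
    stableKernel α u = W α u ^ (-(1 / (1 - α))) := by
  rw [rpow_neg (W_pos h0 h1 hu).le, ← inv_rpow (W_pos h0 h1 hu).le, W, inv_div, stableKernel]

theorem stableKernel_pos (h0 : 0 < α) (h1 : α < 1) (hu : u ∈ Ioo 0 π) : 0 < stableKernel α u := by
  rw [stableKernel_eq h0 h1 hu]; exact rpow_pos_of_pos (W_pos h0 h1 hu) _

theorem W_le (h0 : 0 < α) (h1 : α < 1) (hu : u ∈ Ioo 0 π) :
    W α u ≤ (α ^ α * (1 - α) ^ (1 - α))⁻¹ := by
  have hs := sin_pos_of_pos_of_lt_pi hu.1 hu.2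
  have h1' : 0 < 1 - α := by linarith
  have a := rpow_le_rpow (by positivity) (sin_ge h0 h1 hu) h0.le
  have b := rpow_le_rpow (by positivity) (sin_ge h1' (by linarith) hu) h1'.le
  rw [mul_rpow h0.le hs.le] at a
  rw [mul_rpow h1'.le hs.le] at b
  have c : sin u ^ α * sin u ^ (1 - α) = sin u := by
    rw [← rpow_add hs]; simp
  have p1 := rpow_pos_of_pos h0 α
  have p2 := rpow_pos_of_pos h1' (1 - α)
  have q1 := rpow_pos_of_pos (sin_pos1 h0 h1 hu) α
  have q2 := rpow_pos_of_pos (sin_pos2 h0 h1 hu) (1 - α)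
  have d := mul_le_mul a b (by positivity) q1.le
  rw [W, div_le_iff₀ (by positivity), inv_mul_eq_div, le_div_iff₀ (by positivity)]
  calc _ = α ^ α * sin u ^ α * ((1 - α) ^ (1 - α) * sin u ^ (1 - α)) := by
        nth_rw 1 [← c]; ring
    _ ≤ _ := d

theorem measurable_W (α : ℝ) : Measurable (W α) := by unfold W; fun_prop

theorem measurable_stableKernel (α : ℝ) : Measurable (stableKernel α) := by unfold stableKernel; fun_prop

theorem integrableOn_W_pow (h0 : 0 < α) (h1 : α < 1) (k : ℕ) :
    IntegrableOn (fun u => W α u ^ k) (Ioo 0 π) := by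
  refine Measure.integrableOn_of_bounded (M := ((α ^ α * (1 - α) ^ (1 - α))⁻¹) ^ k)
    (by simp) ((measurable_W α).pow_const k).aestronglyMeasurable ?_
  refine (ae_restrict_iff' measurableSet_Ioo).2 (.of_forall fun u hu => ?_)
  rw [norm_pow, norm_of_nonneg (W_pos h0 h1 hu).le]
  exact pow_le_pow_left₀ (W_pos h0 h1 hu).le (W_le h0 h1 hu) k

theorem integral_W_pow (h0 : 0 < α) (h1 : α < 1) (k : ℕ) :
    ∫ u in Ioo 0 π, W α u ^ k =
      π * (k.factorial * (Gamma (1 + α * k))⁻¹ * (Gamma (1 + (1 - α) * k))⁻¹) := by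
  obtain ⟨Φ, hΦ, hr, hpi⟩ := exists_primitive k (α * k)
  have h1' : 0 < 1 - α := by linarith
  set ℓ : ℝ → ℝ := fun u => log (sin (α * u) / sin ((1 - α) * u)) with hℓ
  set γ : ℝ → ℂ := fun u => (ℓ u : ℂ) + u * Complex.I with hγ
  have key : ∀ u ∈ Ioo 0 π, (1 + Complex.exp (γ u)) ^ k * Complex.exp (-(((α * k : ℝ) : ℂ) * γ u))
      = ((W α u ^ k : ℝ) : ℂ) := by
    intro u hu
    have p1 := sin_pos1 h0 h1 hu
    have p2 := sin_pos2 h0 h1 hu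
    have p3 := sin_pos_of_pos_of_lt_pi hu.1 hu.2
    have e1 : Complex.exp (γ u) = ((sin (α * u) / sin ((1 - α) * u) : ℝ) : ℂ)
        * Complex.exp (u * Complex.I) := by
      rw [hγ]; beta_reduce
      rw [Complex.exp_add, ← Complex.ofReal_exp, hℓ]; beta_reduce
      rw [exp_log (by positivity)]
    have hu' : u = α * u + (1 - α) * u := by ring
    have e2 : 1 + Complex.exp (γ u) = ((sin u / sin ((1 - α) * u) : ℝ) : ℂ)
        * Complex.exp ((α * u : ℝ) * Complex.I) := by
      rw [e1]
      have s1 : sin u = sin (α * u) * cos ((1 - α) * u) + cos (α * u) * sin ((1 - α) * u) := by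
        rw [← sin_add]; congr 1
      have c1 : cos u = cos (α * u) * cos ((1 - α) * u) - sin (α * u) * sin ((1 - α) * u) := by
        rw [← cos_add]; congr 1
      have t1 := sin_sq_add_cos_sq (α * u)
      apply Complex.ext
      · simp only [Complex.add_re, Complex.one_re, Complex.re_ofReal_mul,
          Complex.exp_ofReal_mul_I_re]
        rw [div_mul_eq_mul_div, div_mul_eq_mul_div, eq_div_iff p2.ne', add_mul,
          div_mul_cancel₀ _ p2.ne', s1, c1]
        linear_combination (-sin ((1 - α) * u)) * t1
      · simp only [Complex.add_im, Complex.one_im, Complex.im_ofReal_mul,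
          Complex.exp_ofReal_mul_I_im]
        rw [div_mul_eq_mul_div, div_mul_eq_mul_div, zero_add]
        congr 1; ring
    have e3 : Complex.exp (-(((α * k : ℝ) : ℂ) * γ u)) =
        (((sin (α * u) / sin ((1 - α) * u)) ^ (-α) : ℝ) : ℂ) ^ k
        * Complex.exp (-((α * u : ℝ) * Complex.I)) ^ k := by
      have : -(((α * k : ℝ) : ℂ) * γ u) = k * (((ℓ u * (-α) : ℝ) : ℂ))
          + k * (-((α * u : ℝ) * Complex.I)) := by
        rw [hγ]; push_cast; ring
      rw [this, Complex.exp_add, Complex.exp_nat_mul, Complex.exp_nat_mul, ← Complex.ofReal_exp,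
        rpow_def_of_pos (by positivity)]
    have e4 : Complex.exp ((α * u : ℝ) * Complex.I) * Complex.exp (-((α * u : ℝ) * Complex.I)) = 1 := by
      rw [← Complex.exp_add]; simp
    have e5 : W α u = sin u / sin ((1 - α) * u) * (sin (α * u) / sin ((1 - α) * u)) ^ (-α) := by
      rw [W, rpow_neg (by positivity), div_rpow p1.le p2.le, rpow_sub p2, rpow_one]
      have := rpow_pos_of_pos p1 α
      have := rpow_pos_of_pos p2 α
      field_simp
    rw [e2, e3, e5]
    rw [← mul_pow, ← mul_pow, Complex.ofReal_pow,
      Complex.ofReal_mul (sin u / sin ((1 - α) * u))]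
    congr 1
    linear_combination (((sin u / sin ((1 - α) * u) : ℝ) : ℂ) *
      (((sin (α * u) / sin ((1 - α) * u)) ^ (-α) : ℝ) : ℂ)) * e4
  have hderiv : ∀ u ∈ Ioo 0 π, HasDerivAt (fun u => (Φ (γ u)).im) (W α u ^ k) u := by
    intro u hu
    have p1 := sin_pos1 h0 h1 hu
    have p2 := sin_pos2 h0 h1 hu
    have d1 : DifferentiableAt ℝ ℓ u := by
      have q1 : DifferentiableAt ℝ (fun u => sin (α * u)) u := by fun_prop
      have q2 : DifferentiableAt ℝ (fun u => sin ((1 - α) * u)) u := by fun_prop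
      exact (q1.div q2 p2.ne').log (div_pos p1 p2).ne'
    have d2 : HasDerivAt γ ((deriv ℓ u : ℝ) + Complex.I) u := by
      have a := d1.hasDerivAt.ofReal_comp
      have b := ((hasDerivAt_id' u).ofReal_comp).mul_const Complex.I
      convert! a.add b using 1
      simp
    have d3 := (hΦ (γ u)).comp u d2
    rw [key u hu] at d3
    have d4 := Complex.imCLM.hasFDerivAt.comp_hasDerivAt u d3
    convert! d4 using 1
    rw [Complex.imCLM_apply, Complex.im_ofReal_mul]
    simp
  have hcont : Continuous Φ := continuous_iff_continuousAt.2 fun w => (hΦ w).continuousAt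
  have lim : ∀ a : ℝ, Tendsto (fun u => sin (a * u) / u) (𝓝[>] 0) (𝓝 a) := by
    intro a
    have q : HasDerivAt (fun u => sin (a * u)) a 0 := by
      simpa using ((hasDerivAt_id' (0 : ℝ)).const_mul a).sin
    have := q.tendsto_slope_zero_right
    refine this.congr fun t => ?_
    simp [div_eq_inv_mul]
  have lim0 : Tendsto (fun u => (Φ (γ u)).im) (𝓝[>] 0) (𝓝 0) := by
    have l1 : Tendsto ℓ (𝓝[>] 0) (𝓝 (log (α / (1 - α)))) := by
      refine Tendsto.log ?_ (by positivity)
      refine ((lim α).div (lim (1 - α)) h1'.ne').congr' ?_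
      filter_upwards [self_mem_nhdsWithin] with u hu
      have : u ≠ 0 := (ne_of_gt hu)
      rw [Pi.div_apply, div_div_div_cancel_right₀ this]
    have l2 : Tendsto γ (𝓝[>] 0) (𝓝 ((log (α / (1 - α)) : ℝ) : ℂ)) := by
      have a := (Complex.continuous_ofReal.tendsto _).comp l1
      have b : Tendsto (fun u : ℝ => (u : ℂ) * Complex.I) (𝓝[>] 0) (𝓝 0) := by
        have : Continuous (fun u : ℝ => (u : ℂ) * Complex.I) := by fun_prop
        simpa using (this.tendsto 0).mono_left nhdsWithin_le_nhds
      simpa using! a.add b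
    have := ((Complex.continuous_im.comp hcont).tendsto _).comp l2
    simpa [Function.comp_def, hr] using this
  have limpi : Tendsto (fun u => (Φ (γ u)).im) (𝓝[<] π) (𝓝 (Φ (π * Complex.I)).im) := by
    have p1 : 0 < sin (α * π) := sin_pos_of_pos_of_lt_pi (by positivity) (by nlinarith [pi_pos])
    have p2 : sin ((1 - α) * π) = sin (α * π) := by
      rw [show (1 - α) * π = π - α * π by ring, sin_pi_sub]
    have c1 : ContinuousAt ℓ π := by
      refine ContinuousAt.log (ContinuousAt.div (by fun_prop) (by fun_prop) ?_) ?_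
      · rw [p2]; exact p1.ne'
      · rw [p2]; exact (div_pos p1 p1).ne'
    have c2 : ContinuousAt γ π :=
      (Complex.continuous_ofReal.continuousAt.comp c1).add (by fun_prop)
    have e : γ π = π * Complex.I := by
      simp only [hγ, hℓ]
      rw [p2, div_self p1.ne', log_one]; simp
    have c3 : ContinuousAt (fun u => (Φ (γ u)).im) π :=
      (Complex.continuous_im.comp hcont).continuousAt.comp c2
    have := c3.tendsto.mono_left (nhdsWithin_le_nhds (s := Iio π))
    rwa [e] at this
  have hint : IntervalIntegrable (fun u => W α u ^ k) volume 0 π := by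
    rw [intervalIntegrable_iff_integrableOn_Ioo_of_le pi_pos.le]
    exact integrableOn_W_pow h0 h1 k
  have := intervalIntegral.integral_eq_sub_of_hasDerivAt_of_tendsto pi_pos hderiv hint lim0 limpi
  rw [intervalIntegral.integral_of_le pi_pos.le, integral_Ioc_eq_integral_Ioo, sub_zero, hpi] at this
  rw [this]
  congr 4
  ring

theorem inner_integrable {θ : ℝ} (hθ : 0 < θ) (h0 : 0 < α) (h1 : α < 1) :
    IntegrableOn (fun u => stableKernel α u * exp (-stableKernel α u * θ ^ (1 / (1 - α)))) (Ioo 0 π) := by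
  have hp := rpow_pos_of_pos hθ (1 / (1 - α))
  have hm := measurable_stableKernel α
  refine Measure.integrableOn_of_bounded (M := (θ ^ (1 / (1 - α)))⁻¹)
    (by simp) (by fun_prop) ?_
  refine (ae_restrict_iff' measurableSet_Ioo).2 (.of_forall fun u hu => ?_)
  have hA := stableKernel_pos h0 h1 hu
  rw [norm_of_nonneg (by positivity), neg_mul, exp_neg, ← div_eq_mul_inv, inv_eq_one_div,
    div_le_div_iff₀ (exp_pos _) hp, one_mul]
  linarith [add_one_le_exp (stableKernel α u * θ ^ (1 / (1 - α)))]

theorem subDensity_pos {θ : ℝ} (h0 : 0 < α) (h1 : α < 1) (hθ : 0 < θ) : 0 < subDensity α θ := by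
  have h1' : 0 < 1 - α := by linarith
  have hp := rpow_pos_of_pos hθ (α / (1 - α))
  have : 0 < ∫ u in Ioo 0 π, stableKernel α u * exp (-stableKernel α u * θ ^ (1 / (1 - α))) := by
    rw [setIntegral_pos_iff_support_of_nonneg_ae _ (inner_integrable hθ h0 h1)]
    · have : Function.support (fun u => stableKernel α u * exp (-stableKernel α u * θ ^ (1 / (1 - α)))) ∩ Ioo 0 π
          = Ioo 0 π := by
        refine inter_eq_right.2 fun u hu => ?_
        have hA := stableKernel_pos h0 h1 hu
        exact (mul_pos hA (exp_pos _)).ne'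
      rw [this]; simp [pi_pos]
    · refine (ae_restrict_iff' measurableSet_Ioo).2 (.of_forall fun u hu => ?_)
      have hA := stableKernel_pos h0 h1 hu
      exact (mul_pos hA (exp_pos _)).le
  unfold subDensity; positivity

theorem measurable_subDensity (α : ℝ) : Measurable (subDensity α) := by
  have hm := measurable_stableKernel α
  have : StronglyMeasurable (fun θ : ℝ =>
      ∫ u in Ioo 0 π, stableKernel α u * exp (-stableKernel α u * θ ^ (1 / (1 - α)))) := by
    refine StronglyMeasurable.integral_prod_right' (f := fun q : ℝ × ℝ =>
      stableKernel α q.2 * exp (-stableKernel α q.2 * q.1 ^ (1 / (1 - α)))) ?_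
    exact Measurable.stronglyMeasurable (by fun_prop)
  unfold subDensity
  exact (by fun_prop : Measurable fun θ : ℝ => 1 / (π * (1 - α)) * θ ^ (α / (1 - α))).mul
    this.measurable

theorem lintegral_moment (h0 : 0 < α) (h1 : α < 1) (k : ℕ) :
    ∫⁻ θ in Ioi 0, ENNReal.ofReal (θ ^ k * subDensity α θ) =
      ENNReal.ofReal (k.factorial / Gamma (1 + α * k)) := by
  have h1' : 0 < 1 - α := by linarith
  have hm := measurable_stableKernel α
  set F : ℝ → ℝ → ℝ := fun θ u => 1 / (π * (1 - α)) * stableKernel α u *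
    (θ ^ (k + α / (1 - α)) * exp (-stableKernel α u * θ ^ (1 / (1 - α)))) with hF
  have s1 : ∀ θ ∈ Ioi (0 : ℝ), ENNReal.ofReal (θ ^ k * subDensity α θ) =
      ∫⁻ u in Ioo 0 π, ENNReal.ofReal (F θ u) := by
    intro θ hθ
    have hθ' : 0 < θ := hθ
    have e : θ ^ k * subDensity α θ = ∫ u in Ioo 0 π, F θ u := by
      rw [subDensity, ← mul_assoc, ← integral_const_mul]
      congr 1 with u
      simp only [hF]
      rw [rpow_add hθ', rpow_natCast]; ring
    have i : IntegrableOn (F θ) (Ioo 0 π) := by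
      refine ((inner_integrable hθ' h0 h1).const_mul
        (1 / (π * (1 - α)) * θ ^ (k + α / (1 - α)))).congr (.of_forall fun u => ?_)
      simp only [hF]; ring
    rw [e, ofReal_integral_eq_lintegral_ofReal i]
    refine (ae_restrict_iff' measurableSet_Ioo).2 (.of_forall fun u hu => ?_)
    have hA := stableKernel_pos h0 h1 hu
    simp only [hF, Pi.zero_apply]; positivity
  have s2 : ∀ u ∈ Ioo 0 π, ∫⁻ θ in Ioi 0, ENNReal.ofReal (F θ u) =
      ENNReal.ofReal (Gamma (1 + (1 - α) * k) / π * W α u ^ k) := by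
    intro u hu
    have hA := stableKernel_pos h0 h1 hu
    have hW := W_pos h0 h1 hu
    have hq : -1 < (k : ℝ) + α / (1 - α) := by
      have : 0 ≤ (k : ℝ) + α / (1 - α) := by positivity
      linarith
    have i := integrableOn_rpow_mul_exp_neg_mul_rpow hq (by positivity : 0 < 1 / (1 - α)) hA
    have v := integral_rpow_mul_exp_neg_mul_rpow (by positivity : 0 < 1 / (1 - α)) hq hA
    rw [← ofReal_integral_eq_lintegral_ofReal (i.const_mul _)]
    · rw [integral_const_mul, v]
      congr 1
      have e1 : ((k : ℝ) + α / (1 - α) + 1) / (1 / (1 - α)) = 1 + (1 - α) * k := by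
        field_simp; ring
      have e2 : -((k : ℝ) + α / (1 - α) + 1) / (1 / (1 - α)) = -(1 + (1 - α) * k) := by
        rw [neg_div, e1]
      have e3 : stableKernel α u ^ (-(1 + (1 - α) * k)) = (stableKernel α u)⁻¹ * W α u ^ k := by
        rw [neg_add, rpow_add hA, rpow_neg_one]
        congr 1
        rw [stableKernel_eq h0 h1 hu, ← rpow_mul hW.le, ← rpow_natCast]
        congr 1; field_simp
      rw [e1, e2, e3]
      field_simp
    · refine (ae_restrict_iff' measurableSet_Ioi).2 (.of_forall fun θ hθ => ?_)
      have hθ' : 0 < θ := hθ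
      simp only [Pi.zero_apply]; positivity
  rw [setLIntegral_congr_fun measurableSet_Ioi s1, lintegral_lintegral_swap
    (Measurable.aemeasurable (by simp only [hF, Function.uncurry_def]; fun_prop)),
    setLIntegral_congr_fun measurableSet_Ioo s2,
    ← ofReal_integral_eq_lintegral_ofReal ((integrableOn_W_pow h0 h1 k).const_mul _)]
  · rw [integral_const_mul, integral_W_pow h0 h1 k]
    congr 1
    have : 0 < Gamma (1 + (1 - α) * k) := Gamma_pos_of_pos (by positivity)
    field_simp
  · refine (ae_restrict_iff' measurableSet_Ioo).2 (.of_forall fun u hu => ?_)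
    have hW := W_pos h0 h1 hu
    have : 0 < Gamma (1 + (1 - α) * k) := Gamma_pos_of_pos (by positivity)
    simp only [Pi.zero_apply]; positivity

theorem integrable_moment (h0 : 0 < α) (h1 : α < 1) (k : ℕ) :
    IntegrableOn (fun θ => θ ^ k * subDensity α θ) (Ioi 0) := by
  have hd := measurable_subDensity α
  refine ⟨by fun_prop, ?_⟩
  rw [hasFiniteIntegral_iff_ofReal]
  · rw [lintegral_moment h0 h1]; exact ENNReal.ofReal_lt_top
  · refine (ae_restrict_iff' measurableSet_Ioi).2 (.of_forall fun θ hθ => ?_)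
    have hθ' : 0 < θ := hθ
    have := subDensity_pos h0 h1 hθ'
    simp only [Pi.zero_apply]; positivity

theorem integral_moment (h0 : 0 < α) (h1 : α < 1) (k : ℕ) :
    ∫ θ in Ioi 0, θ ^ k * subDensity α θ = k.factorial / Gamma (1 + α * k) := by
  have : 0 < Gamma (1 + α * k) := Gamma_pos_of_pos (by positivity)
  rw [integral_eq_lintegral_of_nonneg_ae _ (integrable_moment h0 h1 k).aestronglyMeasurable,
    lintegral_moment h0 h1, ENNReal.toReal_ofReal (by positivity)]
  refine (ae_restrict_iff' measurableSet_Ioi).2 (.of_forall fun θ hθ => ?_)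
  have hθ' : 0 < θ := hθ
  have := subDensity_pos h0 h1 hθ'
  simp only [Pi.zero_apply]; positivity

theorem summable_pow_div_Gamma (h0 : 0 < α) (h1 : α < 1) (r : ℝ) (hr : 0 < r) :
    Summable fun k : ℕ => r ^ k / Gamma (1 + α * k) := by
  have h1' : 0 < 1 - α := by linarith
  have G : ∀ k : ℕ, 0 < Gamma (1 + α * k) := fun k => Gamma_pos_of_pos (by positivity)
  refine summable_of_ratio_test_tendsto_lt_one zero_lt_one
    (.of_forall fun k => (div_pos (pow_pos hr k) (G k)).ne') ?_
  have bound : ∀ k : ℕ, ‖r ^ (k + 1) / Gamma (1 + α * (k + 1 : ℕ))‖ / ‖r ^ k / Gamma (1 + α * k)‖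
      ≤ r * (2 * (1 + α * k) ^ (-α)) := by
    intro k
    set x : ℝ := 1 + α * k with hx
    have hx1 : 1 ≤ x := by rw [hx]; linarith [show 0 ≤ α * (k : ℝ) by positivity]
    have hx0 : 0 < x := by linarith
    have e : 1 + α * ((k + 1 : ℕ) : ℝ) = x + α := by rw [hx]; push_cast; ring
    have gx : 0 < Gamma x := Gamma_pos_of_pos hx0
    have gy : 0 < Gamma (x + α) := Gamma_pos_of_pos (by linarith)
    have H := Gamma_mul_add_mul_le_rpow_Gamma_mul_rpow_Gamma (s := x + α) (t := x + α + 1)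
      (by linarith) (by linarith) h0 h1' (by ring)
    have e2 : α * (x + α) + (1 - α) * (x + α + 1) = x + 1 := by ring
    rw [e2, Gamma_add_one hx0.ne', Gamma_add_one (by linarith), mul_rpow (by linarith) gy.le,
      mul_left_comm, ← rpow_add gy, add_sub_cancel, rpow_one] at H
    have H2 : (x + α) ^ (1 - α) ≤ 2 * x ^ (1 - α) := by
      calc (x + α) ^ (1 - α) ≤ (2 * x) ^ (1 - α) :=
            rpow_le_rpow (by linarith) (by linarith) h1'.le
        _ = 2 ^ (1 - α) * x ^ (1 - α) := mul_rpow (by norm_num) hx0.le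
        _ ≤ _ := by
            gcongr
            calc (2 : ℝ) ^ (1 - α) ≤ 2 ^ (1 : ℝ) :=
                  rpow_le_rpow_of_exponent_le (by norm_num) (by linarith)
              _ = 2 := rpow_one _
    rw [e, norm_of_nonneg (by positivity), norm_of_nonneg (by positivity)]
    have H3 : Gamma x / Gamma (x + α) ≤ 2 * x ^ (-α) := by
      rw [div_le_iff₀ gy]
      have : x ^ (-α) = x ^ (1 - α) / x := by
        rw [show -α = (1 - α) - 1 by ring, rpow_sub_one hx0.ne']
      rw [this]
      have : x * Gamma x ≤ 2 * x ^ (1 - α) * Gamma (x + α) :=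
        H.trans (by gcongr)
      calc Gamma x = (x * Gamma x) / x := by field_simp
        _ ≤ (2 * x ^ (1 - α) * Gamma (x + α)) / x := by gcongr
        _ = _ := by ring
    calc r ^ (k + 1) / Gamma (x + α) / (r ^ k / Gamma x) = r * (Gamma x / Gamma (x + α)) := by
          field_simp
          ring
      _ ≤ _ := by gcongr
  refine squeeze_zero (fun k => by positivity) bound ?_
  have t : Tendsto (fun k : ℕ => 1 + α * (k : ℝ)) atTop atTop :=
    tendsto_atTop_add_const_left _ _ (tendsto_natCast_atTop_atTop.const_mul_atTop h0)
  simpa using (((tendsto_rpow_neg_atTop h0).comp t).const_mul 2).const_mul r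

theorem integral_subDensity_exp (h0 : 0 < α) (h1 : α < 1) (z : ℂ) :
    HasSum (fun k : ℕ => z ^ k / Complex.Gamma (α * k + 1))
      (∫ θ in Ioi (0 : ℝ), (subDensity α θ : ℂ) * Complex.exp (z * θ)) := by
  have hd := measurable_subDensity α
  set F : ℕ → ℝ → ℂ := fun k θ => (z ^ k / k.factorial) * ((θ ^ k * subDensity α θ : ℝ) : ℂ) with hF
  have G : ∀ k : ℕ, 0 < Gamma (1 + α * k) := fun k => Gamma_pos_of_pos (by positivity)
  have i : ∀ k, Integrable (F k) (volume.restrict (Ioi 0)) := fun k =>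
    ((integrable_moment h0 h1 k).ofReal).const_mul _
  have n : ∀ k, ∫ θ in Ioi 0, ‖F k θ‖ = ‖z‖ ^ k / Gamma (1 + α * k) := by
    intro k
    have : ∀ θ ∈ Ioi (0 : ℝ), ‖F k θ‖ = ‖z‖ ^ k / k.factorial * (θ ^ k * subDensity α θ) := by
      intro θ hθ
      have hθ' : 0 < θ := hθ
      have := subDensity_pos h0 h1 hθ'
      simp only [hF]
      rw [norm_mul, norm_div, norm_pow, Complex.norm_natCast, Complex.norm_real,
        norm_of_nonneg (by positivity)]
    rw [setIntegral_congr_fun measurableSet_Ioi this, integral_const_mul, integral_moment h0 h1]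
    have := G k
    field_simp
  have S : Summable fun k => ∫ θ in Ioi 0, ‖F k θ‖ := by
    simp_rw [n]
    refine (summable_pow_div_Gamma h0 h1 (‖z‖ + 1) (by positivity)).of_nonneg_of_le
      (fun k => div_nonneg (by positivity) (G k).le) fun k => ?_
    have := G k
    gcongr
    linarith
  have H := hasSum_integral_of_summable_integral_norm i S
  convert! H using 1
  · ext k
    simp only [hF]
    rw [integral_const_mul, integral_complex_ofReal, integral_moment h0 h1]
    have : Complex.Gamma (α * k + 1) = ((Gamma (1 + α * k) : ℝ) : ℂ) := by
      rw [← Complex.Gamma_ofReal]; congr 1; push_cast; ring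
    rw [this]
    have := (G k).ne'
    have f : (k.factorial : ℂ) ≠ 0 := by exact_mod_cast k.factorial_ne_zero
    push_cast
    field_simp
  · refine setIntegral_congr_fun measurableSet_Ioi fun θ _ => ?_
    have := (NormedSpace.expSeries_div_hasSum_exp (z * θ)).mul_left (subDensity α θ : ℂ)
    rw [← Complex.exp_eq_exp_ℂ] at this
    rw [← this.tsum_eq]
    congr 1 with k
    simp only [hF]
    push_cast
    ring

/-- `∫_0^∞ h_α(θ) exp(zθ) dθ = E_{α,1}(z)`. -/
theorem integral_subDensity_mul_exp (h0 : 0 < α) (h1 : α < 1) (z : ℂ) :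
    ∫ θ in Ioi (0 : ℝ), (subDensity α θ : ℂ) * Complex.exp (z * θ) = mittagLeffler α 1 z :=
  (integral_subDensity_exp h0 h1 z).tsum_eq.symm

end

end TimeFracHeat

/-!
Both bounds rest on the fact that at the Fujita exponent the nonlinear term is scale invariant, so
that for `α = 1` its time integral diverges logarithmically; for `α < 1` the divergence is cut off
and leaves a factor `1/(1-α)`.

*Upper bound.* If `u` solves the equation up to time `T`, let `U(t)` be the mass of `u(t)` and
`V(t)` that of `u(t)^p` in the ball of radius `t^(α/2)` about `a`. The Gauss kernel keeps a fixed
fraction of the mass in these balls, so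
`U(t) ≥ c μ(B(a, t₀^(α/2))) + c ∫_{t₀}^t (t-s)^(α-1) V(s) ds`, while Hölder's inequality (as a
Young inequality with a free parameter `d`) bounds `U` by `V`. Testing against
`t^(-α) log(S/t)^(N/2)` on `(t₀, S)` absorbs `V`; with `t₀ = S exp(-1/(1-α))` what remains is
`μ(B(a, t₀^(α/2))) ≤ C (1-α)^(N/2)`. For `μ = κ f_ε` the mass of a ball of radius `σ` about `0`
equals `c κ (-log σ)^(-(N/2-ε))`, which gives a lower bound for `-log T`.

*Lower bound.* If `e^{T^αΔ} μ ≤ A`, the norm of `e^{tΔ} μ` in `L^p` with respect to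
`G(T^α, z - x) dx` is at most `A (T^α/t)^(1/p)` for `t ≤ T^α`, for all `z`. The Picard iterates
therefore stay bounded in these norms, with weight `t^(α/p)`, as soon as
`A^(2/N) T^α ∫_0^1 (1-s)^(α(1-1/p)-1) s^(-α) ds` is small. The integral is of order `1/(1-α)`, so
`B A^(2/N) T^α ≤ 1-α` suffices, and for `κ f_ε` one may take
`A = C κ (-log T)^(-(N/2-ε)) T^(-αN/2)`.
-/

namespace TimeFracHeat

section InnerProductSpace
variable {V : Type*} [NormedAddCommGroup V] [InnerProductSpace ℝ V]

theorem norm_sub_sq_div_add_norm_sub_sq_div {s t : ℝ} (hs : 0 < s) (ht : 0 < t) (x y z : V) :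
    ‖z - x‖ ^ 2 / s + ‖x - y‖ ^ 2 / t =
      (s + t) / (s * t) * ‖x - AffineMap.lineMap z y (s / (s + t))‖ ^ 2 +
        ‖z - y‖ ^ 2 / (s + t) := by
  have hzy : z - y = (z - x) + (x - y) := by abel
  have hcentre : x - AffineMap.lineMap z y (s / (s + t)) =
      (s / (s + t)) • (x - y) - (t / (s + t)) • (z - x) := by
    rw [AffineMap.lineMap_apply_module', show t / (s + t) = 1 - s / (s + t) by field_simp; ring]
    module
  rw [hcentre, hzy, norm_add_sq_real, norm_sub_sq_real ((s / (s + t)) • (x - y)), norm_smul,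
    norm_smul, inner_smul_left, inner_smul_right, real_inner_comm (z - x),
    norm_of_nonneg (by positivity : 0 ≤ s / (s + t)),
    norm_of_nonneg (by positivity : 0 ≤ t / (s + t)), conj_trivial]
  field_simp
  ring

theorem lintegral_exp_neg_mul_sq_norm_sub [FiniteDimensional ℝ V] [MeasurableSpace V]
    [BorelSpace V] {b : ℝ} (hb : 0 < b) (w : V) :
    ∫⁻ x : V, ENNReal.ofReal (exp (-b * ‖x - w‖ ^ 2)) =
      ENNReal.ofReal ((π / b) ^ (Module.finrank ℝ V / 2 : ℝ)) := by
  have h := GaussianFourier.integral_rexp_neg_mul_sq_norm (V := V) hb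
  have hfi : Integrable fun x : V => exp (-b * ‖x‖ ^ 2) :=
    .of_integral_ne_zero (by rw [h]; positivity)
  rw [lintegral_sub_right_eq_self (fun x : V => ENNReal.ofReal (exp (-b * ‖x‖ ^ 2))) w, ← h,
    ofReal_integral_eq_lintegral_ofReal hfi (.of_forall fun x => (exp_pos _).le)]

end InnerProductSpace

section HeatKernel
variable {N : ℕ} {s t : ℝ}

theorem heatKernel_nonneg (ht : 0 ≤ t) (x : Space N) : 0 ≤ heatKernel t x := by
  unfold heatKernel
  positivity

@[fun_prop]
theorem measurable_heatKernel {X : Type*} [MeasurableSpace X] {τ : X → ℝ} {f : X → Space N}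
    (hτ : Measurable τ) (hf : Measurable f) : Measurable fun a => heatKernel (τ a) (f a) := by
  unfold heatKernel
  fun_prop

theorem heatKernel_sub_comm (t : ℝ) (x y : Space N) :
    heatKernel t (x - y) = heatKernel t (y - x) := by
  rw [heatKernel, heatKernel, norm_sub_rev]

theorem lintegral_heatKernel (ht : 0 < t) (y : Space N) :
    ∫⁻ x : Space N, ENNReal.ofReal (heatKernel t (x - y)) = 1 := by
  have hgauss (x : Space N) : ENNReal.ofReal (heatKernel t (x - y)) =
      ENNReal.ofReal (1 / (4 * π * t) ^ ((N : ℝ) / 2)) *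
        ENNReal.ofReal (exp (-(1 / (4 * t)) * ‖x - y‖ ^ 2)) := by
    rw [← ENNReal.ofReal_mul (by positivity), heatKernel]
    congr 3
    ring
  simp_rw [hgauss]
  rw [lintegral_const_mul _ (by fun_prop), lintegral_exp_neg_mul_sq_norm_sub (by positivity),
    ← ENNReal.ofReal_mul (by positivity), finrank_euclideanSpace_fin,
    show π / (1 / (4 * t)) = 4 * π * t by field_simp, one_div, inv_mul_cancel₀ (by positivity),
    ENNReal.ofReal_one]

theorem heatKernel_mul_heatKernel (hs : 0 < s) (ht : 0 < t) (x y z : Space N) :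
    heatKernel s (z - x) * heatKernel t (x - y) =
      (1 / (π / ((s + t) / (4 * s * t))) ^ ((N : ℝ) / 2) * heatKernel (s + t) (z - y)) *
        exp (-((s + t) / (4 * s * t)) * ‖x - AffineMap.lineMap z y (s / (s + t))‖ ^ 2) := by
  have hexp := norm_sub_sq_div_add_norm_sub_sq_div hs ht x y z
  have hconst : (4 * π * s) ^ ((N : ℝ) / 2) * (4 * π * t) ^ ((N : ℝ) / 2) =
      (π / ((s + t) / (4 * s * t))) ^ ((N : ℝ) / 2) * (4 * π * (s + t)) ^ ((N : ℝ) / 2) := by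
    rw [← mul_rpow (by positivity) (by positivity), ← mul_rpow (by positivity) (by positivity)]
    congr 1
    field_simp
  simp only [heatKernel]
  rw [mul_mul_mul_comm, ← exp_add, ← mul_assoc (1 / (π / _) ^ _), mul_assoc _ (exp _) (exp _),
    ← exp_add, one_div_mul_one_div, one_div_mul_one_div, hconst]
  congr 2
  rw [div_mul_eq_div_div (-‖z - y‖ ^ 2)]
  linear_combination (-1 / 4) * hexp

theorem lintegral_heatKernel_mul_heatKernel (hs : 0 < s) (ht : 0 < t) (z y : Space N) :
    ∫⁻ x : Space N, ENNReal.ofReal (heatKernel s (z - x)) * ENNReal.ofReal (heatKernel t (x - y)) =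
      ENNReal.ofReal (heatKernel (s + t) (z - y)) := by
  have hG : 0 ≤ heatKernel (s + t) (z - y) := heatKernel_nonneg (by positivity) _
  simp_rw [← ENNReal.ofReal_mul (heatKernel_nonneg hs.le _), heatKernel_mul_heatKernel hs ht,
    ENNReal.ofReal_mul (mul_nonneg (by positivity :
      0 ≤ 1 / (π / ((s + t) / (4 * s * t))) ^ ((N : ℝ) / 2)) hG)]
  rw [lintegral_const_mul _ (by fun_prop), lintegral_exp_neg_mul_sq_norm_sub (by positivity),
    ← ENNReal.ofReal_mul (by positivity), finrank_euclideanSpace_fin]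
  congr 1
  field_simp

theorem heatKernel_le_rpow_mul_heatKernel (hs : 0 < s) (hst : s ≤ t) (x : Space N) :
    heatKernel s x ≤ (t / s) ^ ((N : ℝ) / 2) * heatKernel t x := by
  have ht : 0 < t := hs.trans_le hst
  have hconst : (t / s) ^ ((N : ℝ) / 2) * (1 / (4 * π * t) ^ ((N : ℝ) / 2)) =
      1 / (4 * π * s) ^ ((N : ℝ) / 2) := by
    rw [one_div, one_div, ← inv_rpow (by positivity), ← inv_rpow (by positivity),
      ← mul_rpow (by positivity) (by positivity)]
    congr 1
    field_simp
  rw [heatKernel, heatKernel, ← mul_assoc, hconst]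
  gcongr 1 / (4 * π * s) ^ ((N : ℝ) / 2) * ?_
  rw [exp_le_exp, neg_div, neg_div, neg_le_neg_iff]
  gcongr

end HeatKernel

theorem lintegral_inv_Ioo {a b : ℝ} (ha : 0 < a) (hab : a ≤ b) :
    ∫⁻ t in Ioo a b, ENNReal.ofReal t⁻¹ = ENNReal.ofReal (log (b / a)) := by
  have hfi : IntervalIntegrable (fun t : ℝ => t⁻¹) volume a b :=
    intervalIntegral.intervalIntegrable_inv (fun x hx => by
      rw [uIcc_of_le hab] at hx; exact (ha.trans_le hx.1).ne') continuousOn_id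
  rw [← integral_inv_of_pos ha (ha.trans_le hab), intervalIntegral.integral_of_le hab,
    integral_Ioc_eq_integral_Ioo, ofReal_integral_eq_lintegral_ofReal
      ((intervalIntegrable_iff_integrableOn_Ioo_of_le hab).1 hfi)]
  exact (ae_restrict_iff' measurableSet_Ioo).2
    (.of_forall fun t ht => (inv_pos.2 (ha.trans ht.1)).le)

theorem lintegral_fun_norm_addHaar {E : Type*} [NormedAddCommGroup E] [NormedSpace ℝ E]
    [FiniteDimensional ℝ E] [Nontrivial E] [MeasurableSpace E] [BorelSpace E] (μ : Measure E)
    [μ.IsAddHaarMeasure] {f : ℝ → ℝ≥0∞} (hf : Measurable f) :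
    ∫⁻ x, f ‖x‖ ∂μ = Module.finrank ℝ E * μ (Metric.ball 0 1) *
      ∫⁻ r in Ioi (0 : ℝ), ENNReal.ofReal (r ^ (Module.finrank ℝ E - 1)) * f r := by
  calc
    ∫⁻ x, f ‖x‖ ∂μ = ∫⁻ x : ({(0)}ᶜ : Set E), f ‖x.1‖ ∂(μ.comap (↑)) := by
      rw [lintegral_subtype_comap (measurableSet_singleton _).compl fun x => f ‖x‖,
        restrict_compl_singleton]
    _ = ∫⁻ x, f x.2 ∂μ.toSphere.prod (.volumeIoiPow (Module.finrank ℝ E - 1)) := by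
      simpa using μ.measurePreserving_homeomorphUnitSphereProd.lintegral_comp_emb
        (Homeomorph.measurableEmbedding _) (f ∘ Subtype.val ∘ Prod.snd)
    _ = μ.toSphere univ * ∫⁻ x : Ioi (0 : ℝ), f x ∂.volumeIoiPow (Module.finrank ℝ E - 1) := by
      rw [lintegral_prod _ (by fun_prop)]
      simp only [lintegral_const]
      rw [mul_comm]
    _ = _ := by
      rw [μ.toSphere_apply_univ, Measure.volumeIoiPow,
        lintegral_withDensity_eq_lintegral_mul _ (by fun_prop) (by fun_prop)]
      congr 1
      exact lintegral_subtype_comap measurableSet_Ioi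
        fun r : ℝ => ENNReal.ofReal (r ^ (Module.finrank ℝ E - 1)) * f r

/-! ### Minkowski's integral inequality -/

section Minkowski
variable {Ω X : Type*} [MeasurableSpace Ω] [MeasurableSpace X] {ν : Measure Ω} {γ : Measure X}
  {p : ℝ}

theorem lintegral_rpow_le_mul_lintegral_rpow_mul (hp : 1 < p) {b g : Ω → ℝ≥0∞}
    (hb : AEMeasurable b ν) (hg : AEMeasurable g ν) (hbt : ∀ᵐ ω ∂ν, b ω ≠ ∞)
    (hb0 : ∀ᵐ ω ∂ν, b ω = 0 → g ω = 0) :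
    (∫⁻ ω, g ω ∂ν) ^ p ≤ (∫⁻ ω, b ω ∂ν) ^ (p - 1) * ∫⁻ ω, b ω ^ (1 - p) * g ω ^ p ∂ν := by
  have hpq : p.HolderConjugate (p / (p - 1)) := .conjExponent hp
  set q := p / (p - 1) with hq
  have hp0 : 0 < p := hpq.pos
  have hq0 : 0 < q := hpq.symm.pos
  have hpq' : 1 / q * p = p - 1 := by
    rw [hq, one_div_div, div_mul_cancel₀ _ hp0.ne']
  have hsplit : ∫⁻ ω, g ω ∂ν = ∫⁻ ω, (b ω ^ (-(1 / q)) * g ω) * b ω ^ (1 / q) ∂ν := by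
    refine lintegral_congr_ae ?_
    filter_upwards [hb0, hbt] with ω h0 ht
    rcases eq_or_ne (b ω) 0 with h | h
    · simp [h0 h]
    · rw [mul_right_comm, ← ENNReal.rpow_add _ _ h ht, neg_add_cancel, ENNReal.rpow_zero, one_mul]
  have hholder := ENNReal.lintegral_mul_le_Lp_mul_Lq ν hpq
    (f := fun ω => b ω ^ (-(1 / q)) * g ω) (g := fun ω => b ω ^ (1 / q)) (by fun_prop) (by fun_prop)
  simp only [Pi.mul_apply] at hholder
  rw [← hsplit] at hholder
  calc (∫⁻ ω, g ω ∂ν) ^ p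
      ≤ ((∫⁻ ω, (b ω ^ (-(1 / q)) * g ω) ^ p ∂ν) ^ (1 / p) *
          (∫⁻ ω, (b ω ^ (1 / q)) ^ q ∂ν) ^ (1 / q)) ^ p := by gcongr
    _ = (∫⁻ ω, b ω ∂ν) ^ (p - 1) * ∫⁻ ω, b ω ^ (1 - p) * g ω ^ p ∂ν := by
      simp_rw [ENNReal.mul_rpow_of_nonneg _ _ hp0.le, ← ENNReal.rpow_mul,
        one_div_mul_cancel hp0.ne', one_div_mul_cancel hq0.ne', ENNReal.rpow_one, neg_mul, hpq',
        neg_sub, mul_comm]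

theorem ae_ae_eq_zero_of_lintegral_rpow_eq_zero [SFinite ν] [SFinite γ] (hp : 0 < p)
    {E : Ω → X → ℝ≥0∞} (hE : Measurable (Function.uncurry E)) :
    ∀ᵐ x ∂γ, ∀ᵐ ω ∂ν, ∫⁻ x, E ω x ^ p ∂γ = 0 → E ω x = 0 := by
  have hmeas : Measurable fun ω => ∫⁻ x, E ω x ^ p ∂γ :=
    Measurable.lintegral_prod_right' (f := fun z : Ω × X => E z.1 z.2 ^ p) (hE.pow_const p)
  refine (Measure.ae_ae_comm ?_).1 (.of_forall fun ω => ?_)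
  · exact (measurableSet_eq_fun (hmeas.comp measurable_fst) measurable_const).imp
      (measurableSet_eq_fun hE measurable_const)
  · by_cases h : ∫⁻ x, E ω x ^ p ∂γ = 0
    · rw [lintegral_eq_zero_iff (by fun_prop)] at h
      filter_upwards [h] with x hx _
      simpa [hp.not_gt, hp] using hx
    · exact .of_forall fun x h' => absurd h' h

/-- Use Hölder's inequality with the weight `‖E ω‖_p`. -/
theorem lintegral_lintegral_rpow_le [SFinite ν] [SFinite γ] (hp : 1 ≤ p)
    {E : Ω → X → ℝ≥0∞} (hE : Measurable (Function.uncurry E)) :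
    ∫⁻ x, (∫⁻ ω, E ω x ∂ν) ^ p ∂γ ≤ (∫⁻ ω, (∫⁻ x, E ω x ^ p ∂γ) ^ (1 / p) ∂ν) ^ p := by
  have hswap : Measurable (Function.uncurry fun (x : X) (ω : Ω) => E ω x) := hE.comp measurable_swap
  rcases hp.eq_or_lt with rfl | hp
  · simpa using (lintegral_lintegral_swap hswap.aemeasurable).le
  have hp0 : 0 < p := zero_lt_one.trans hp
  set b : Ω → ℝ≥0∞ := fun ω => (∫⁻ x, E ω x ^ p ∂γ) ^ (1 / p) with hb
  have hbp (ω : Ω) : ∫⁻ x, E ω x ^ p ∂γ = b ω ^ p := by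
    rw [hb, ← ENNReal.rpow_mul, one_div_mul_cancel hp0.ne', ENNReal.rpow_one]
  have hbm : Measurable b :=
    (Measurable.lintegral_prod_right' (f := fun z : Ω × X => E z.1 z.2 ^ p)
      (hE.pow_const p)).pow_const _
  rcases eq_or_ne (∫⁻ ω, b ω ∂ν) ∞ with htop | hfin
  · rw [htop, ENNReal.top_rpow_of_pos hp0]
    exact le_top
  have hbt : ∀ᵐ ω ∂ν, b ω ≠ ∞ := (ae_lt_top hbm hfin).mono fun ω h => h.ne
  have hzero : ∀ᵐ x ∂γ, ∀ᵐ ω ∂ν, b ω = 0 → E ω x = 0 := by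
    filter_upwards [ae_ae_eq_zero_of_lintegral_rpow_eq_zero (ν := ν) hp0 hE] with x hx
    filter_upwards [hx] with ω hω h
    exact hω (by rw [hbp, h, ENNReal.zero_rpow_of_pos hp0])
  calc ∫⁻ x, (∫⁻ ω, E ω x ∂ν) ^ p ∂γ
      ≤ ∫⁻ x, (∫⁻ ω, b ω ∂ν) ^ (p - 1) * ∫⁻ ω, b ω ^ (1 - p) * E ω x ^ p ∂ν ∂γ := by
        refine lintegral_mono_ae (hzero.mono fun x hx => ?_)
        exact lintegral_rpow_le_mul_lintegral_rpow_mul hp hbm.aemeasurable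
          hE.of_uncurry_right.aemeasurable hbt hx
    _ = (∫⁻ ω, b ω ∂ν) ^ (p - 1) * ∫⁻ ω, ∫⁻ x, b ω ^ (1 - p) * E ω x ^ p ∂γ ∂ν := by
        have hm : Measurable (Function.uncurry fun (x : X) (ω : Ω) =>
            b ω ^ (1 - p) * E ω x ^ p) := by
          simp only [Function.uncurry_def] at hswap ⊢
          fun_prop
        rw [lintegral_const_mul _ (f := fun x => ∫⁻ ω, b ω ^ (1 - p) * E ω x ^ p ∂ν)
          hm.lintegral_prod_right', lintegral_lintegral_swap hm.aemeasurable]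
    _ ≤ (∫⁻ ω, b ω ∂ν) ^ (p - 1) * ∫⁻ ω, b ω ∂ν := by
        gcongr 1
        refine lintegral_mono_ae (hbt.mono fun ω ht => ?_)
        rw [lintegral_const_mul _ (hE.of_uncurry_left.pow_const p), hbp]
        rcases eq_or_ne (b ω) 0 with h0 | h0
        · simp [h0, hp0]
        · rw [← ENNReal.rpow_add _ _ h0 ht, sub_add_cancel, ENNReal.rpow_one]
    _ = (∫⁻ ω, b ω ∂ν) ^ p := by
        nth_rw 2 [← ENNReal.rpow_one (∫⁻ ω, b ω ∂ν)]
        rw [← ENNReal.rpow_add_of_nonneg _ _ (sub_pos.2 hp).le zero_le_one, sub_add_cancel]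

theorem lintegral_add_rpow_le (hp : 1 ≤ p) {f g : X → ℝ≥0∞} (hf : AEMeasurable f γ)
    (hg : AEMeasurable g γ) {a b : ℝ≥0∞}
    (hfa : ∫⁻ x, f x ^ p ∂γ ≤ a ^ p) (hgb : ∫⁻ x, g x ^ p ∂γ ≤ b ^ p) :
    ∫⁻ x, (f x + g x) ^ p ∂γ ≤ (a + b) ^ p := by
  have hp0 : 0 < p := one_pos.trans_le hp
  rw [← ENNReal.rpow_inv_le_iff hp0] at hfa hgb ⊢
  simp only [← one_div] at hfa hgb ⊢
  exact (ENNReal.lintegral_Lp_add_le hf hg hp).trans (add_le_add hfa hgb)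

end Minkowski

section Gamma
variable {x : ℝ}

theorem half_le_Gamma (hx : 3 / 2 ≤ x) : 1 / 2 ≤ Gamma x := by
  rcases le_or_gt 2 x with h | h
  · have := Gamma_strictMonoOn_Ici.monotoneOn self_mem_Ici h h
    rw [Gamma_two] at this
    linarith
  · -- convexity on `[x, 3] ∋ 2`, where `Γ(2) = 1` and `Γ(3) = 2`
    have hΓ3 : Gamma 3 = 2 := by
      rw [show (3 : ℝ) = 2 + 1 by norm_num, Gamma_add_one two_ne_zero, Gamma_two, mul_one]
    have hx3 : 0 < 3 - x := by linarith
    have hconv := convexOn_Gamma.2 (show x ∈ Ioi 0 from mem_Ioi.2 (by linarith))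
      (show (3 : ℝ) ∈ Ioi 0 from mem_Ioi.2 (by norm_num)) (show 0 ≤ 1 / (3 - x) by positivity)
      (show 0 ≤ (2 - x) / (3 - x) from div_nonneg (by linarith) hx3.le) (by field_simp; ring)
    simp only [smul_eq_mul] at hconv
    rw [show 1 / (3 - x) * x + (2 - x) / (3 - x) * 3 = 2 by field_simp; ring, Gamma_two, hΓ3,
      div_mul_eq_mul_div, div_mul_eq_mul_div, ← add_div, le_div_iff₀ hx3] at hconv
    linarith

theorem Gamma_le_one (h1 : 1 ≤ x) (h2 : x ≤ 2) : Gamma x ≤ 1 := by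
  have hconv := convexOn_Gamma.2 (show (1 : ℝ) ∈ Ioi 0 from mem_Ioi.2 one_pos)
    (show (2 : ℝ) ∈ Ioi 0 from mem_Ioi.2 two_pos) (show 0 ≤ 2 - x by linarith)
    (show 0 ≤ x - 1 by linarith) (by ring)
  simp only [smul_eq_mul, Gamma_one, Gamma_two] at hconv
  rw [show (2 - x) * 1 + (x - 1) * 2 = x by ring] at hconv
  linarith

end Gamma

theorem lintegral_Ioi_le_lintegral_Ioo_add {w : ℝ → ℝ≥0∞} {R : ℝ} (hR : 0 < R) :
    ∫⁻ θ in Ioi 0, w θ ≤ (∫⁻ θ in Ioo 0 R, w θ) +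
      (∫⁻ θ in Ioi 0, ENNReal.ofReal θ * w θ) / ENNReal.ofReal R := by
  have htail : ENNReal.ofReal R * ∫⁻ θ in Ici R, w θ ≤ ∫⁻ θ in Ioi 0, ENNReal.ofReal θ * w θ := by
    rw [← lintegral_const_mul' _ _ ENNReal.ofReal_ne_top]
    refine (setLIntegral_mono' measurableSet_Ici fun θ hθ => ?_).trans
      (lintegral_mono_set (Ici_subset_Ioi.2 hR))
    gcongr
    exact hθ
  rw [← Ioo_union_Ici_eq_Ioi hR]
  refine (lintegral_union_le _ _ _).trans (add_le_add_right ?_ _)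
  rw [Ioo_union_Ici_eq_Ioi hR, ENNReal.le_div_iff_mul_le (.inl (by simpa)) (.inl (by simp)),
    mul_comm]
  exact htail

theorem half_le_lintegral_Ioo_nine {w : ℝ → ℝ≥0∞} (h1 : 1 ≤ ∫⁻ θ in Ioi 0, w θ)
    (h4 : ∫⁻ θ in Ioi 0, ENNReal.ofReal θ * w θ ≤ 4) : 1 / 2 ≤ ∫⁻ θ in Ioo 0 9, w θ := by
  have hmarkov := h1.trans (lintegral_Ioi_le_lintegral_Ioo_add (w := w) (R := 9) (by norm_num))
  have htail : (∫⁻ θ in Ioi 0, ENNReal.ofReal θ * w θ) / ENNReal.ofReal 9 ≤ 1 / 2 :=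
    ENNReal.div_le_of_le_mul (h4.trans ((ENNReal.toReal_le_toReal (by finiteness)
      (by finiteness)).1 (by norm_num)))
  have hhalf : (1 / 2 : ℝ≥0∞) + 1 / 2 ≤ (∫⁻ θ in Ioo 0 9, w θ) + 1 / 2 := by
    rw [ENNReal.add_halves]
    exact hmarkov.trans (by gcongr)
  exact (ENNReal.add_le_add_iff_right (by finiteness)).1 hhalf

/-! ### Moments of `h_α` -/

section Density
variable {α : ℝ}

theorem lintegral_subDensity (h0 : 0 < α) (h1 : α < 1) :
    ∫⁻ θ in Ioi 0, ENNReal.ofReal (subDensity α θ) = 1 := by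
  simpa using lintegral_moment h0 h1 0

theorem lintegral_mul_subDensity (h0 : 0 < α) (h1 : α < 1) :
    ∫⁻ θ in Ioi 0, ENNReal.ofReal (θ * subDensity α θ) = ENNReal.ofReal (1 / Gamma (1 + α)) := by
  simpa using lintegral_moment h0 h1 1

theorem lintegral_mul_subDensity_le (h0 : 1 / 2 ≤ α) (h1 : α < 1) :
    ∫⁻ θ in Ioi 0, ENNReal.ofReal (θ * subDensity α θ) ≤ 2 := by
  have hΓ : 1 / 2 ≤ Gamma (1 + α) := half_le_Gamma (by linarith)
  rw [lintegral_mul_subDensity (by linarith) h1, ← ENNReal.ofReal_ofNat]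
  refine ENNReal.ofReal_le_ofReal ?_
  rw [div_le_iff₀ (by linarith)]
  linarith

theorem one_le_lintegral_mul_subDensity (h0 : 0 < α) (h1 : α < 1) :
    1 ≤ ∫⁻ θ in Ioi 0, ENNReal.ofReal (θ * subDensity α θ) := by
  rw [lintegral_mul_subDensity h0 h1, ENNReal.one_le_ofReal,
    one_le_div (Gamma_pos_of_pos (by linarith))]
  exact Gamma_le_one (by linarith) (by linarith)

theorem lintegral_sq_mul_subDensity_le (h0 : 1 / 2 ≤ α) (h1 : α < 1) :
    ∫⁻ θ in Ioi 0, ENNReal.ofReal (θ ^ 2 * subDensity α θ) ≤ 4 := by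
  have hΓ : 1 / 2 ≤ Gamma (1 + α * 2) := half_le_Gamma (by linarith)
  rw [lintegral_moment (by linarith) h1 2, ← ENNReal.ofReal_ofNat]
  refine ENNReal.ofReal_le_ofReal ?_
  rw [Nat.cast_ofNat, Nat.factorial_two, Nat.cast_ofNat, div_le_iff₀ (by linarith)]
  linarith

theorem half_le_lintegral_subDensity (h0 : 1 / 2 ≤ α) (h1 : α < 1) :
    1 / 2 ≤ ∫⁻ θ in Ioo 0 9, ENNReal.ofReal (subDensity α θ) := by
  refine half_le_lintegral_Ioo_nine (lintegral_subDensity (by linarith) h1).ge ?_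
  calc ∫⁻ θ in Ioi 0, ENNReal.ofReal θ * ENNReal.ofReal (subDensity α θ)
      = ∫⁻ θ in Ioi 0, ENNReal.ofReal (θ * subDensity α θ) :=
        setLIntegral_congr_fun measurableSet_Ioi fun θ hθ => (ENNReal.ofReal_mul (le_of_lt hθ)).symm
    _ ≤ 4 := (lintegral_mul_subDensity_le h0 h1).trans (by norm_num)

theorem half_le_lintegral_mul_subDensity (h0 : 1 / 2 ≤ α) (h1 : α < 1) :
    1 / 2 ≤ ∫⁻ θ in Ioo 0 9, ENNReal.ofReal (θ * subDensity α θ) := by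
  refine half_le_lintegral_Ioo_nine (one_le_lintegral_mul_subDensity (by linarith) h1) ?_
  calc ∫⁻ θ in Ioi 0, ENNReal.ofReal θ * ENNReal.ofReal (θ * subDensity α θ)
      = ∫⁻ θ in Ioi 0, ENNReal.ofReal (θ ^ 2 * subDensity α θ) :=
        setLIntegral_congr_fun measurableSet_Ioi fun θ hθ => by
          rw [← ENNReal.ofReal_mul (le_of_lt hθ), ← mul_assoc, ← sq]
    _ ≤ 4 := lintegral_sq_mul_subDensity_le h0 h1

theorem sin_le_W {u : ℝ} (h0 : 0 < α) (h1 : α < 1) (hu : u ∈ Ioo 0 π) : sin u ≤ W α u := by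
  have hsinα := sin_pos1 h0 h1 hu
  have hsinβ := sin_pos2 h0 h1 hu
  have hα : sin (α * u) ^ α ≤ 1 := rpow_le_one hsinα.le (sin_le_one _) h0.le
  have hβ : sin ((1 - α) * u) ^ (1 - α) ≤ 1 :=
    rpow_le_one hsinβ.le (sin_le_one _) (sub_pos.2 h1).le
  rw [W, le_div_iff₀ (by positivity)]
  exact mul_le_of_le_one_right (sin_pos_of_pos_of_lt_pi hu.1 hu.2).le
    (mul_le_one₀ hα (by positivity) hβ)

theorem sin_rpow_le {s u : ℝ} (hs : s ≤ 0) (hu : u ∈ Ioo 0 π) :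
    sin u ^ s ≤ (2 / π) ^ s * u ^ s + (2 / π) ^ s * (π - u) ^ s := by
  have hu0 : 0 < u := hu.1
  have hu1 : 0 < π - u := sub_pos.2 hu.2
  -- Jordan's inequality at the endpoint nearer to `v`
  have hjordan {v : ℝ} (hv0 : 0 < v) (hv : v ≤ π / 2) : sin v ^ s ≤ (2 / π) ^ s * v ^ s := by
    rw [← mul_rpow (by positivity) hv0.le]
    exact rpow_le_rpow_of_nonpos (by positivity) (mul_le_sin hv0.le hv) hs
  rcases le_total u (π / 2) with h | h
  · exact (hjordan hu0 h).trans (le_add_of_nonneg_right (by positivity))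
  · rw [← sin_pi_sub]
    exact (hjordan hu1 (by linarith)).trans (le_add_of_nonneg_left (by positivity))

theorem lintegral_sin_rpow_lt_top {s : ℝ} (hs : -1 < s) (hs0 : s ≤ 0) :
    ∫⁻ u in Ioo 0 π, ENNReal.ofReal (sin u ^ s) < ∞ := by
  have hleft : IntegrableOn (fun u : ℝ => u ^ s) (Ioo 0 π) :=
    (intervalIntegrable_iff_integrableOn_Ioo_of_le pi_pos.le).1
      (intervalIntegral.intervalIntegrable_rpow' hs)
  have hright : IntegrableOn (fun u : ℝ => (π - u) ^ s) (Ioo 0 π) := by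
    have h := (intervalIntegral.intervalIntegrable_rpow' (a := 0) (b := π) hs).comp_sub_left π
    rw [sub_zero, sub_self] at h
    exact (intervalIntegrable_iff_integrableOn_Ioo_of_le pi_pos.le).1 h.symm
  have hsum : IntegrableOn
      (fun u : ℝ => (2 / π) ^ s * u ^ s + (2 / π) ^ s * (π - u) ^ s) (Ioo 0 π) :=
    (hleft.const_mul _).add (hright.const_mul _)
  exact (setLIntegral_mono' measurableSet_Ioo fun u hu =>
    ENNReal.ofReal_le_ofReal (sin_rpow_le hs0 hu)).trans_lt hsum.lintegral_lt_top

theorem ofReal_rpow_mul_subDensity (h0 : 0 < α) (h1 : α < 1) {s θ : ℝ} (hθ : 0 < θ) :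
    ENNReal.ofReal (θ ^ s * subDensity α θ) = ∫⁻ u in Ioo 0 π, ENNReal.ofReal
      (1 / (π * (1 - α)) * stableKernel α u *
        (θ ^ (s + α / (1 - α)) * exp (-stableKernel α u * θ ^ (1 / (1 - α))))) := by
  have : 0 < 1 - α := sub_pos.2 h1
  have hcomm (u : ℝ) : 1 / (π * (1 - α)) * θ ^ (s + α / (1 - α)) *
      (stableKernel α u * exp (-stableKernel α u * θ ^ (1 / (1 - α)))) =
      1 / (π * (1 - α)) * stableKernel α u *
        (θ ^ (s + α / (1 - α)) * exp (-stableKernel α u * θ ^ (1 / (1 - α)))) := by ring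
  have hfi := (inner_integrable hθ h0 h1).const_mul (1 / (π * (1 - α)) * θ ^ (s + α / (1 - α)))
  simp_rw [hcomm] at hfi
  rw [← ofReal_integral_eq_lintegral_ofReal hfi]
  · simp_rw [← hcomm]
    rw [integral_const_mul, subDensity, rpow_add hθ]
    congr 1
    ring
  · refine (ae_restrict_iff' measurableSet_Ioo).2 (.of_forall fun u hu => ?_)
    have := stableKernel_pos h0 h1 hu
    simp only [Pi.zero_apply]
    positivity

theorem lintegral_stableKernel_mul_rpow_mul_exp (h0 : 0 < α) (h1 : α < 1) {s u : ℝ} (hs : -1 < s)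
    (hu : u ∈ Ioo 0 π) :
    ∫⁻ θ in Ioi 0, ENNReal.ofReal (1 / (π * (1 - α)) * stableKernel α u *
        (θ ^ (s + α / (1 - α)) * exp (-stableKernel α u * θ ^ (1 / (1 - α))))) =
      ENNReal.ofReal (Gamma (1 + (1 - α) * s) / π * W α u ^ s) := by
  have h1' : 0 < 1 - α := sub_pos.2 h1
  have hA := stableKernel_pos h0 h1 hu
  have hW := W_pos h0 h1 hu
  have hexp : 0 < 1 / (1 - α) := by positivity
  have hq : -1 < s + α / (1 - α) := by linarith [show 0 ≤ α / (1 - α) by positivity]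
  have hAW : stableKernel α u ^ (-(1 + (1 - α) * s)) = (stableKernel α u)⁻¹ * W α u ^ s := by
    rw [neg_add, rpow_add hA, rpow_neg_one, stableKernel_eq h0 h1 hu, ← rpow_mul hW.le]
    congr 2
    field_simp
  rw [← ofReal_integral_eq_lintegral_ofReal
    ((integrableOn_rpow_mul_exp_neg_mul_rpow hq hexp hA).const_mul _)]
  · rw [integral_const_mul, integral_rpow_mul_exp_neg_mul_rpow hexp hq hA, neg_div,
      show (s + α / (1 - α) + 1) / (1 / (1 - α)) = 1 + (1 - α) * s by field_simp; ring, hAW]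
    congr 1
    field_simp
  · refine (ae_restrict_iff' measurableSet_Ioi).2 (.of_forall fun θ (hθ : 0 < θ) => ?_)
    simp only [Pi.zero_apply]
    positivity

theorem lintegral_rpow_mul_subDensity (h0 : 0 < α) (h1 : α < 1) {s : ℝ} (hs : -1 < s) :
    ∫⁻ θ in Ioi 0, ENNReal.ofReal (θ ^ s * subDensity α θ) =
      ∫⁻ u in Ioo 0 π, ENNReal.ofReal (Gamma (1 + (1 - α) * s) / π * W α u ^ s) := by
  have hm := measurable_stableKernel α
  rw [setLIntegral_congr_fun measurableSet_Ioi fun θ hθ => ofReal_rpow_mul_subDensity h0 h1 hθ,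
    lintegral_lintegral_swap
      (Measurable.aemeasurable (by simp only [Function.uncurry_def]; fun_prop))]
  exact setLIntegral_congr_fun measurableSet_Ioo fun u hu =>
    lintegral_stableKernel_mul_rpow_mul_exp h0 h1 hs hu

theorem lintegral_rpow_mul_subDensity_le (h0 : 0 < α) (h1 : α < 1) {s : ℝ} (hs : -1 < s)
    (hs0 : s ≤ 0) :
    ∫⁻ θ in Ioi 0, ENNReal.ofReal (θ ^ s * subDensity α θ) ≤
      ENNReal.ofReal (Gamma (1 + s) / π) * ∫⁻ u in Ioo 0 π, ENNReal.ofReal (sin u ^ s) := by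
  have hsα : -1 < (1 - α) * s := by nlinarith
  have hΓ : Gamma (1 + (1 - α) * s) ≤ Gamma (1 + s) :=
    Gamma_strictAntiOn_Ioc.antitoneOn ⟨by linarith, by linarith⟩
      ⟨by linarith, by nlinarith⟩ (by nlinarith)
  have hΓ0 : 0 < Gamma (1 + (1 - α) * s) := Gamma_pos_of_pos (by linarith)
  rw [lintegral_rpow_mul_subDensity h0 h1 hs, ← lintegral_const_mul _ (by fun_prop)]
  refine setLIntegral_mono' measurableSet_Ioo fun u hu => ?_
  have hsin := sin_pos_of_pos_of_lt_pi hu.1 hu.2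
  have hWs : W α u ^ s ≤ sin u ^ s := rpow_le_rpow_of_nonpos hsin (sin_le_W h0 h1 hu) hs0
  have hW := W_pos h0 h1 hu
  rw [← ENNReal.ofReal_mul (div_nonneg (hΓ0.le.trans hΓ) pi_pos.le)]
  gcongr
  exact div_nonneg (hΓ0.le.trans hΓ) pi_pos.le

end Density

section SubordinatedHeat
variable {N : ℕ} {α p : ℝ} {X : Type*} [MeasurableSpace X]

/-- The superposition `∫_0^∞ w(θ) e^{τθΔ} μ dθ` of heat semigroups. With `τ = t^α`, the weights
`h_α(θ)` and `θ h_α(θ)` give `opP α t μ` and `opS α t μ` by definition. -/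
noncomputable def subordinatedHeat (w : ℝ → ℝ≥0∞) (τ : ℝ) (μ : Measure (Space N)) (x : Space N) :
    ℝ≥0∞ :=
  ∫⁻ θ in Ioi (0 : ℝ), w θ * heatSemigroup (τ * θ) μ x

theorem measurable_ofReal_subDensity (α : ℝ) :
    Measurable fun θ => ENNReal.ofReal (subDensity α θ) :=
  (measurable_subDensity α).ennreal_ofReal

theorem measurable_ofReal_mul_subDensity (α : ℝ) :
    Measurable fun θ => ENNReal.ofReal (θ * subDensity α θ) :=
  (measurable_id.mul (measurable_subDensity α)).ennreal_ofReal

theorem heatSemigroup_withDensity (t : ℝ) {g : Space N → ℝ≥0∞} (hg : Measurable g) (x : Space N) :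
    heatSemigroup t (volume.withDensity g) x =
      ∫⁻ y, g y * ENNReal.ofReal (heatKernel t (x - y)) :=
  lintegral_withDensity_eq_lintegral_mul _ hg (by fun_prop)

@[fun_prop]
theorem measurable_heatSemigroup (μ : Measure (Space N)) [SFinite μ] {τ : X → ℝ}
    {f : X → Space N} (hτ : Measurable τ) (hf : Measurable f) :
    Measurable fun a => heatSemigroup (τ a) μ (f a) :=
  Measurable.lintegral_prod_right'
    (f := fun q : X × Space N => ENNReal.ofReal (heatKernel (τ q.1) (f q.1 - q.2))) (by fun_prop)

theorem measurable_heatSemigroup_withDensity {g : X → Space N → ℝ≥0∞}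
    (hg : Measurable (Function.uncurry g)) {τ : X → ℝ} {f : X → Space N} (hτ : Measurable τ)
    (hf : Measurable f) :
    Measurable fun a => heatSemigroup (τ a) (volume.withDensity (g a)) (f a) := by
  simp_rw [fun a => heatSemigroup_withDensity (τ a) (hg.of_uncurry_left (x := a)) (f a)]
  exact Measurable.lintegral_prod_right'
    (f := fun q : X × Space N => g q.1 q.2 * ENNReal.ofReal (heatKernel (τ q.1) (f q.1 - q.2)))
    (hg.mul (by fun_prop))

theorem measurable_subordinatedHeat {w : ℝ → ℝ≥0∞} (hw : Measurable w) (μ : Measure (Space N))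
    [SFinite μ] {τ : X → ℝ} {f : X → Space N} (hτ : Measurable τ) (hf : Measurable f) :
    Measurable fun a => subordinatedHeat w (τ a) μ (f a) :=
  Measurable.lintegral_prod_right'
    (f := fun q : X × ℝ => w q.2 * heatSemigroup (τ q.1 * q.2) μ (f q.1)) (by fun_prop)

theorem measurable_subordinatedHeat_withDensity {w : ℝ → ℝ≥0∞} (hw : Measurable w)
    {g : X → Space N → ℝ≥0∞} (hg : Measurable (Function.uncurry g)) {τ : X → ℝ}
    {f : X → Space N} (hτ : Measurable τ) (hf : Measurable f) :
    Measurable fun a => subordinatedHeat w (τ a) (volume.withDensity (g a)) (f a) := by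
  refine Measurable.lintegral_prod_right' (f := fun q : X × ℝ =>
    w q.2 * heatSemigroup (τ q.1 * q.2) (volume.withDensity (g q.1)) (f q.1)) ?_
  have hg' : Measurable (Function.uncurry fun q : X × ℝ => g q.1) :=
    hg.comp (measurable_fst.prodMap measurable_id)
  exact (hw.comp measurable_snd).mul
    (measurable_heatSemigroup_withDensity hg' (by fun_prop) (by fun_prop))

theorem subordinatedHeat_mono {μ ν : Measure (Space N)} (h : μ ≤ ν) (w : ℝ → ℝ≥0∞) (τ : ℝ)
    (x : Space N) : subordinatedHeat w τ μ x ≤ subordinatedHeat w τ ν x :=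
  lintegral_mono fun _ => mul_le_mul_right (lintegral_mono' h le_rfl) _

theorem measurable_mildRHS (μ : Measure (Space N)) [SFinite μ] {u : ℝ → Space N → ℝ≥0∞}
    (hu : Measurable (Function.uncurry u)) :
    Measurable (Function.uncurry (mildRHS α p μ u)) := by
  have hP : Measurable fun q : ℝ × Space N => opP α q.1 μ q.2 :=
    measurable_subordinatedHeat (measurable_ofReal_subDensity α) μ (by fun_prop) (by fun_prop)
  have hup : Measurable (Function.uncurry fun (q : (ℝ × Space N) × ℝ) y => u q.2 y ^ p) :=
    (hu.comp (measurable_snd.prodMap measurable_id)).pow_const p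
  have hS : Measurable fun q : (ℝ × Space N) × ℝ =>
      opS α (q.1.1 - q.2) (volume.withDensity fun y => u q.2 y ^ p) q.1.2 :=
    measurable_subordinatedHeat_withDensity (measurable_ofReal_mul_subDensity α) hup
      (by fun_prop) (by fun_prop)
  have hIoo : MeasurableSet {q : (ℝ × Space N) × ℝ | q.2 ∈ Ioo 0 q.1.1} :=
    (measurableSet_lt measurable_const measurable_snd).inter
      (measurableSet_lt measurable_snd measurable_fst.fst)
  refine hP.add (Measurable.const_mul ?_ _)
  simp_rw [← lintegral_indicator measurableSet_Ioo]
  exact Measurable.lintegral_prod_right' (.indicator (f := fun q : (ℝ × Space N) × ℝ =>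
    ENNReal.ofReal ((q.1.1 - q.2) ^ (α - 1)) *
      opS α (q.1.1 - q.2) (volume.withDensity fun y => u q.2 y ^ p) q.1.2)
    (.mul (by fun_prop) hS) hIoo)

theorem mildRHS_mono (hp : 0 ≤ p) (μ : Measure (Space N)) {t T : ℝ} {u v : ℝ → Space N → ℝ≥0∞}
    (h : ∀ᵐ s ∂(volume.restrict (Ioc 0 T)), ∀ᵐ x ∂(volume : Measure (Space N)), u s x ≤ v s x)
    (ht : t ≤ T) (x : Space N) : mildRHS α p μ u t x ≤ mildRHS α p μ v t x := by
  unfold mildRHS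
  gcongr 1
  gcongr 1
  refine lintegral_mono_ae ?_
  have hsub : Ioo 0 t ⊆ Ioc 0 T := fun s hs => ⟨hs.1, hs.2.le.trans ht⟩
  filter_upwards [ae_restrict_of_ae_restrict_of_subset hsub h] with s hs
  gcongr 1
  exact subordinatedHeat_mono
    (withDensity_mono (hs.mono fun y hy => ENNReal.rpow_le_rpow hy hp)) _ _ x

theorem IsSolution.exists_measurable (hp : 0 ≤ p) {μ : Measure (Space N)} {T : ℝ}
    {u : ℝ → Space N → ℝ≥0∞} (hu : IsSolution α p μ T u) :
    ∃ v : ℝ → Space N → ℝ≥0∞, Measurable (Function.uncurry v) ∧ IsSolution α p μ T v := by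
  obtain ⟨hm, hs⟩ := hu
  set v : ℝ → Space N → ℝ≥0∞ := fun t x => hm.mk _ (t, x)
  have huv : ∀ᵐ t ∂(volume.restrict (Ioc 0 T)), ∀ᵐ x ∂(volume : Measure (Space N)),
      u t x = v t x :=
    Measure.ae_ae_of_ae_prod hm.ae_eq_mk
  refine ⟨v, hm.measurable_mk, hm.measurable_mk.aemeasurable, ?_⟩
  filter_upwards [hs, huv, ae_restrict_mem measurableSet_Ioc] with t hst huvt htT
  have hRHS (x : Space N) : mildRHS α p μ u t x = mildRHS α p μ v t x :=
    (mildRHS_mono hp μ (huv.mono fun _ h => h.mono fun _ => le_of_eq) htT.2 x).antisymm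
      (mildRHS_mono hp μ (huv.mono fun _ h => h.mono fun _ => ge_of_eq) htT.2 x)
  filter_upwards [hst, huvt] with x hx hux
  rwa [← hux, ← hRHS]

theorem IsSolution.mono {μ : Measure (Space N)} {T T' : ℝ} (h : T' ≤ T)
    {u : ℝ → Space N → ℝ≥0∞} (hu : IsSolution α p μ T u) : IsSolution α p μ T' u := by
  have hsub : Ioc 0 T' ⊆ Ioc 0 T := Ioc_subset_Ioc_right h
  exact ⟨hu.1.mono_measure (Measure.prod_mono (Measure.restrict_mono hsub le_rfl) le_rfl),
    ae_restrict_of_ae_restrict_of_subset hsub hu.2⟩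

end SubordinatedHeat

/-! ### Mass of balls under the heat semigroup -/

section BallMass
variable {N : ℕ} {r τ : ℝ}

/-- A lower bound for the mass which the Gauss kernel `G(τ, · - y)` leaves in a ball of radius `r`
containing `y`, as long as `τ ≤ 9 r²`: on a ball of radius `√τ / 3` contained in that ball and
having `y` in its closure, the exponent of the kernel is at least `-1/9`. -/
noncomputable def ballMass (N : ℕ) : ℝ≥0∞ :=
  ENNReal.ofReal (1 / (36 * π) ^ ((N : ℝ) / 2) * exp (-1 / 9)) *
    volume (Metric.ball (0 : Space N) 1)

theorem ballMass_pos (N : ℕ) : 0 < ballMass N :=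
  ENNReal.mul_pos (ENNReal.ofReal_pos.2 (by positivity)).ne'
    (Metric.measure_ball_pos _ _ one_pos).ne'

theorem ballMass_ne_top (N : ℕ) : ballMass N ≠ ∞ :=
  ENNReal.mul_ne_top ENNReal.ofReal_ne_top measure_ball_lt_top.ne

theorem volume_ball_eq (x : Space N) (hr : 0 < r) :
    volume (Metric.ball x r) =
      ENNReal.ofReal (r ^ (N : ℝ)) * volume (Metric.ball (0 : Space N) 1) := by
  rw [Measure.addHaar_ball_of_pos _ _ hr, finrank_euclideanSpace_fin, rpow_natCast]

theorem exists_ball_subset_ball_dist_le {E : Type*} [SeminormedAddCommGroup E] [NormedSpace ℝ E]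
    {a y : E} {ρ : ℝ} (hρ : 0 ≤ ρ) (hρr : ρ ≤ r) (hy : y ∈ Metric.ball a r) :
    ∃ z, Metric.ball z ρ ⊆ Metric.ball a r ∧ dist z y ≤ ρ := by
  have hyr : dist y a < r := hy
  have hr : 0 < r := dist_nonneg.trans_lt hyr
  have hq : ρ / r ≤ 1 := (div_le_one hr).2 hρr
  refine ⟨AffineMap.lineMap y a (ρ / r), Metric.ball_subset_ball' ?_, ?_⟩
  · calc
      ρ + dist (AffineMap.lineMap y a (ρ / r)) a = ρ + (1 - ρ / r) * dist y a := by
        rw [dist_lineMap_right, norm_of_nonneg (by linarith)]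
      _ ≤ ρ + (1 - ρ / r) * r := by gcongr
      _ = r := by
        rw [one_sub_mul, div_mul_cancel₀ _ hr.ne', add_sub_cancel]
  · calc
      dist (AffineMap.lineMap y a (ρ / r)) y = ρ / r * dist y a := by
        rw [dist_lineMap_left, norm_of_nonneg (by positivity)]
      _ ≤ ρ / r * r := by gcongr
      _ = ρ := by field_simp

theorem ballMass_le_lintegral_ball {ρ : ℝ} (hρ : 0 < ρ) {y z : Space N} (hzy : dist z y ≤ ρ) :
    ballMass N ≤ ∫⁻ x in Metric.ball z ρ, ENNReal.ofReal (heatKernel (9 * ρ ^ 2) (x - y)) := by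
  have hscale :
      (4 * π * (9 * ρ ^ 2)) ^ ((N : ℝ) / 2) = (36 * π) ^ ((N : ℝ) / 2) * ρ ^ (N : ℝ) := by
    rw [show 4 * π * (9 * ρ ^ 2) = 36 * π * ρ ^ 2 by ring,
      mul_rpow (by positivity) (by positivity), ← rpow_natCast ρ 2, ← rpow_mul hρ.le]
    congr 2
    push_cast
    ring
  have hkernel {x : Space N} (hx : x ∈ Metric.ball z ρ) :
      1 / (4 * π * (9 * ρ ^ 2)) ^ ((N : ℝ) / 2) * exp (-1 / 9) ≤
        heatKernel (9 * ρ ^ 2) (x - y) := by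
    have hxy : ‖x - y‖ ≤ 2 * ρ := by
      rw [← dist_eq_norm]
      linarith [dist_triangle x z y, Metric.mem_ball.1 hx]
    have hxy2 : ‖x - y‖ ^ 2 ≤ (2 * ρ) ^ 2 := by gcongr
    rw [heatKernel]
    gcongr 1 / (4 * π * (9 * ρ ^ 2)) ^ ((N : ℝ) / 2) * ?_
    rw [exp_le_exp, div_le_div_iff₀ (by norm_num) (by positivity)]
    linarith
  calc
    ballMass N = ∫⁻ _ in Metric.ball z ρ,
        ENNReal.ofReal (1 / (4 * π * (9 * ρ ^ 2)) ^ ((N : ℝ) / 2) * exp (-1 / 9)) := by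
      rw [setLIntegral_const, volume_ball_eq z hρ, ← mul_assoc, hscale, ballMass,
        ← ENNReal.ofReal_mul (by positivity)]
      congr 2
      field_simp
    _ ≤ _ := setLIntegral_mono' Metric.isOpen_ball.measurableSet fun x hx =>
      ENNReal.ofReal_le_ofReal (hkernel hx)

theorem ballMass_le_lintegral_heatKernel (hτ : 0 < τ) (hr : 0 < r) (h : τ ≤ 9 * r ^ 2)
    {a y : Space N} (hy : y ∈ Metric.ball a r) :
    ballMass N ≤ ∫⁻ x in Metric.ball a r, ENNReal.ofReal (heatKernel τ (x - y)) := by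
  have hτ9 : 9 * (√τ / 3) ^ 2 = τ := by
    rw [div_pow, sq_sqrt hτ.le]
    ring
  obtain ⟨z, hsub, hzy⟩ := exists_ball_subset_ball_dist_le (ρ := √τ / 3) (by positivity)
    (le_of_sq_le_sq (by linarith) hr.le) hy
  have hle := ballMass_le_lintegral_ball (by positivity) hzy
  rw [hτ9] at hle
  exact hle.trans (lintegral_mono_set hsub)

theorem ballMass_mul_le_heatSemigroup (hτ : 0 < τ) (hr : 0 < r) (h : τ ≤ 9 * r ^ 2)
    (μ : Measure (Space N)) [SFinite μ] (a : Space N) :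
    ballMass N * μ (Metric.ball a r) ≤ ∫⁻ x in Metric.ball a r, heatSemigroup τ μ x := by
  calc
    ballMass N * μ (Metric.ball a r) = ∫⁻ _ in Metric.ball a r, ballMass N ∂μ :=
      (setLIntegral_const _ _).symm
    _ ≤ ∫⁻ y in Metric.ball a r,
          ∫⁻ x in Metric.ball a r, ENNReal.ofReal (heatKernel τ (x - y)) ∂volume ∂μ :=
      setLIntegral_mono' Metric.isOpen_ball.measurableSet fun y hy =>
        ballMass_le_lintegral_heatKernel hτ hr h hy
    _ ≤ ∫⁻ y, ∫⁻ x in Metric.ball a r, ENNReal.ofReal (heatKernel τ (x - y)) ∂volume ∂μ :=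
      setLIntegral_le_lintegral _ _
    _ = ∫⁻ x in Metric.ball a r, heatSemigroup τ μ x :=
      (lintegral_lintegral_swap (Measurable.aemeasurable (by fun_prop))).symm

theorem ballMass_mul_le_subordinatedHeat (hτ : 0 < τ) (hr : 0 < r) (h : τ ≤ r ^ 2)
    (μ : Measure (Space N)) [SFinite μ] (a : Space N) {w : ℝ → ℝ≥0∞} (hw : Measurable w) :
    (∫⁻ θ in Ioo 0 9, w θ) * (ballMass N * μ (Metric.ball a r)) ≤
      ∫⁻ x in Metric.ball a r, subordinatedHeat w τ μ x := by
  calc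
    _ = ∫⁻ θ in Ioo 0 9, w θ * (ballMass N * μ (Metric.ball a r)) :=
      (lintegral_mul_const _ hw).symm
    _ ≤ ∫⁻ θ in Ioo 0 9, ∫⁻ x in Metric.ball a r, w θ * heatSemigroup (τ * θ) μ x := by
      refine setLIntegral_mono' measurableSet_Ioo fun θ hθ => ?_
      rw [lintegral_const_mul _ (by fun_prop)]
      gcongr
      exact ballMass_mul_le_heatSemigroup (mul_pos hτ hθ.1) hr (by nlinarith [hθ.1, hθ.2]) μ a
    _ ≤ ∫⁻ θ in Ioi 0, ∫⁻ x in Metric.ball a r, w θ * heatSemigroup (τ * θ) μ x :=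
      lintegral_mono_set Ioo_subset_Ioi_self
    _ = ∫⁻ x in Metric.ball a r, subordinatedHeat w τ μ x :=
      (lintegral_lintegral_swap (Measurable.aemeasurable (by fun_prop))).symm

end BallMass

section BallMassOperators
variable {N : ℕ} {α t r : ℝ}

theorem ballMass_mul_le_opP (h0 : 1 / 2 ≤ α) (h1 : α < 1) (ht : 0 < t) (hr : 0 < r)
    (h : t ^ α ≤ r ^ 2) (μ : Measure (Space N)) [SFinite μ] (a : Space N) :
    1 / 2 * (ballMass N * μ (Metric.ball a r)) ≤ ∫⁻ x in Metric.ball a r, opP α t μ x :=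
  (mul_le_mul_left (half_le_lintegral_subDensity h0 h1) _).trans
    (ballMass_mul_le_subordinatedHeat (rpow_pos_of_pos ht α) hr h μ a
      (measurable_ofReal_subDensity α))

theorem ballMass_mul_le_opS (h0 : 1 / 2 ≤ α) (h1 : α < 1) (ht : 0 < t) (hr : 0 < r)
    (h : t ^ α ≤ r ^ 2) (μ : Measure (Space N)) [SFinite μ] (a : Space N) :
    1 / 2 * (ballMass N * μ (Metric.ball a r)) ≤ ∫⁻ x in Metric.ball a r, opS α t μ x :=
  (mul_le_mul_left (half_le_lintegral_mul_subDensity h0 h1) _).trans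
    (ballMass_mul_le_subordinatedHeat (rpow_pos_of_pos ht α) hr h μ a
      (measurable_ofReal_mul_subDensity α))

end BallMassOperators

/-! ### The initial data `f_ε` -/

section InitialData
variable {N : ℕ} {ε κ σ : ℝ}

theorem toMeasure_const_mul (hκ : 0 ≤ κ) {φ : Space N → ℝ} (hφ : Measurable φ) :
    toMeasure (fun x => κ * φ x) = ENNReal.ofReal κ • toMeasure φ := by
  simp_rw [toMeasure, ENNReal.ofReal_mul hκ]
  exact withDensity_smul _ hφ.ennreal_ofReal

theorem measurable_fData (N : ℕ) (ε : ℝ) : Measurable (fData N ε) :=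
  Measurable.indicator (by fun_prop) Metric.isOpen_ball.measurableSet

theorem one_le_neg_log (h0 : 0 < σ) (h1 : σ ≤ 1 / exp 1) : 1 ≤ -log σ := by
  have h := log_le_log h0 h1
  rw [one_div, log_inv, log_exp] at h
  linarith

theorem image_exp_neg_Ioi (hσ : 0 < σ) : (fun y : ℝ => exp (-y)) '' Ioi (-log σ) = Ioo 0 σ := by
  ext r
  constructor
  · rintro ⟨y, hy, rfl⟩
    exact ⟨exp_pos _, (lt_log_iff_exp_lt hσ).1 (neg_lt.1 hy)⟩
  · rintro ⟨hr, hrσ⟩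
    exact ⟨-log r, neg_lt_neg (log_lt_log hr hrσ), by simp only [neg_neg, exp_log hr]⟩

theorem lintegral_inv_mul_neg_log_rpow {b : ℝ} (hb : 0 < b) (h0 : 0 < σ) (h1 : σ < 1) :
    ∫⁻ r in Ioo 0 σ, ENNReal.ofReal (r⁻¹ * (-log r) ^ (-b - 1)) =
      ENNReal.ofReal ((-log σ) ^ (-b) / b) := by
  have hl : 0 < -log σ := neg_pos.2 (log_neg h0 h1)
  have hpullback (y : ℝ) : ENNReal.ofReal |-exp (-y)| *
      ENNReal.ofReal ((exp (-y))⁻¹ * (-log (exp (-y))) ^ (-b - 1)) =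
      ENNReal.ofReal (y ^ (-b - 1)) := by
    rw [abs_neg, abs_of_pos (exp_pos _), ← ENNReal.ofReal_mul (exp_pos _).le, log_exp, neg_neg,
      mul_inv_cancel_left₀ (exp_pos _).ne']
  rw [← image_exp_neg_Ioi h0, lintegral_image_eq_lintegral_abs_deriv_mul
    (f' := fun y => -exp (-y)) measurableSet_Ioi
    (fun y _ => by simpa using ((hasDerivAt_id y).neg.exp).hasDerivWithinAt)
    (fun x _ y _ h => by simpa using h)]
  simp_rw [hpullback]
  rw [← ofReal_integral_eq_lintegral_ofReal (integrableOn_Ioi_rpow_of_lt (by linarith) hl),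
    integral_Ioi_rpow_of_lt (by linarith) hl, sub_add_cancel, neg_div_neg_eq]
  exact (ae_restrict_iff' measurableSet_Ioi).2
    (.of_forall fun y hy => rpow_nonneg (hl.le.trans (le_of_lt hy)) _)

theorem toMeasure_fData_ball (hN : 1 ≤ N) (h1 : σ ≤ 1 / exp 1) :
    toMeasure (fData N ε) (Metric.ball 0 σ) = N * volume (Metric.ball (0 : Space N) 1) *
      ∫⁻ r in Ioo 0 σ, ENNReal.ofReal (r⁻¹ * (-log r) ^ (-((N : ℝ) / 2 - ε) - 1)) := by
  have : Nonempty (Fin N) := Fin.pos_iff_nonempty.1 hN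
  set F : ℝ → ℝ≥0∞ := (Iio σ).indicator fun r =>
    ENNReal.ofReal (r ^ (-(N : ℝ)) * |log r| ^ (-(N : ℝ) / 2 - 1 + ε)) with hF
  have hradial : toMeasure (fData N ε) (Metric.ball 0 σ) = ∫⁻ x : Space N, F ‖x‖ := by
    rw [toMeasure, withDensity_apply _ Metric.isOpen_ball.measurableSet,
      ← lintegral_indicator Metric.isOpen_ball.measurableSet]
    refine lintegral_congr fun x => ?_
    by_cases hx : ‖x‖ < σ
    · rw [indicator_of_mem (by simpa using hx), hF, indicator_of_mem (by simpa using hx), fData,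
        indicator_of_mem (by simpa using hx.trans_le (by simpa using h1))]
    · rw [indicator_of_notMem (by simpa using hx), hF, indicator_of_notMem (by simpa using hx)]
  have hpolar (r : ℝ) (hr : r ∈ Ioo 0 σ) : ENNReal.ofReal (r ^ (N - 1)) *
        ENNReal.ofReal (r ^ (-(N : ℝ)) * |log r| ^ (-(N : ℝ) / 2 - 1 + ε)) =
      ENNReal.ofReal (r⁻¹ * (-log r) ^ (-((N : ℝ) / 2 - ε) - 1)) := by
    have hr0 : 0 < r := hr.1
    have hl : 1 ≤ -log r := one_le_neg_log hr0 (hr.2.le.trans h1)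
    have hpow : r ^ (N - 1) * r ^ (-(N : ℝ)) = r⁻¹ := by
      rw [← rpow_natCast, ← rpow_add hr0, Nat.cast_sub hN, ← rpow_neg_one]
      congr 1
      push_cast
      ring
    rw [← ENNReal.ofReal_mul (by positivity), ← mul_assoc, hpow, abs_of_neg (by linarith)]
    congr 3
    ring
  rw [hradial, lintegral_fun_norm_addHaar (f := F) _ (.indicator (by fun_prop) measurableSet_Iio),
    finrank_euclideanSpace_fin]
  simp_rw [hF, ← indicator_mul_right (Iio σ) fun r : ℝ => ENNReal.ofReal (r ^ (N - 1))]
  rw [setLIntegral_indicator measurableSet_Iio, Iio_inter_Ioi,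
    setLIntegral_congr_fun measurableSet_Ioo hpolar]

theorem exists_toMeasure_fData_ball_eq (hN : 1 ≤ N) (hε : ε < (N : ℝ) / 2) :
    ∃ C : ℝ, 0 < C ∧ ∀ κ : ℝ, 0 ≤ κ → ∀ σ : ℝ, 0 < σ → σ ≤ 1 / exp 1 →
      toMeasure (fun x => κ * fData N ε x) (Metric.ball 0 σ) =
        ENNReal.ofReal (C * κ * (-log σ) ^ (-((N : ℝ) / 2 - ε))) := by
  have hb : 0 < (N : ℝ) / 2 - ε := by linarith
  have hv : 0 < volume.real (Metric.ball (0 : Space N) 1) :=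
    ENNReal.toReal_pos (Metric.measure_ball_pos _ _ one_pos).ne' measure_ball_lt_top.ne
  have hN0 : (0 : ℝ) < N := by exact_mod_cast hN
  refine ⟨N * volume.real (Metric.ball (0 : Space N) 1) / ((N : ℝ) / 2 - ε), by positivity,
    fun κ hκ σ h0 h1 => ?_⟩
  have hσ : σ < 1 := h1.trans_lt ((div_lt_one (exp_pos _)).2 (one_lt_exp_iff.2 one_pos))
  rw [toMeasure_const_mul hκ (measurable_fData N ε), Measure.smul_apply, smul_eq_mul,
    toMeasure_fData_ball hN h1, lintegral_inv_mul_neg_log_rpow hb h0 hσ,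
    ← ofReal_measureReal measure_ball_lt_top.ne, ← ENNReal.ofReal_natCast,
    ← ENNReal.ofReal_mul hN0.le, ← ENNReal.ofReal_mul (by positivity), ← ENNReal.ofReal_mul hκ]
  congr 1
  ring

theorem neg_log_rpow_le {a b r : ℝ} (ha : 0 < a) (hb : 0 < b) (hσ : 0 < σ) (hσr : σ ≤ r)
    (hr : r ≤ 1 / exp 1) :
    (-log σ) ^ a ≤ (-log r) ^ a * ((1 + a / b) ^ a * (r / σ) ^ b) := by
  have hr0 : 0 < r := hσ.trans_le hσr
  have hlr : 1 ≤ -log r := one_le_neg_log hr0 hr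
  have hlr0 : 0 < -log r := by linarith
  have hlσ : 0 < -log σ := by linarith [log_le_log hσ hσr]
  have hy : 1 ≤ r / σ := (one_le_div hσ).2 hσr
  have hlog : log (r / σ) ≤ a / b * (r / σ) ^ (b / a) :=
    (log_le_rpow_div (ε := b / a) (by positivity) (by positivity)).trans_eq (by field_simp)
  have hone : 1 ≤ (r / σ) ^ (b / a) := one_le_rpow hy (by positivity)
  have hbase : -log σ ≤ -log r * ((1 + a / b) * (r / σ) ^ (b / a)) := by
    calc
      -log σ = -log r * 1 + 1 * log (r / σ) := by
        rw [log_div hr0.ne' hσ.ne']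
        ring
      _ ≤ -log r * (r / σ) ^ (b / a) + -log r * (a / b * (r / σ) ^ (b / a)) := by
        gcongr
        exact log_nonneg hy
      _ = -log r * ((1 + a / b) * (r / σ) ^ (b / a)) := by ring
  calc
    (-log σ) ^ a ≤ (-log r * ((1 + a / b) * (r / σ) ^ (b / a))) ^ a :=
      rpow_le_rpow hlσ.le hbase ha.le
    _ = (-log r) ^ a * ((1 + a / b) ^ a * (r / σ) ^ b) := by
      rw [mul_rpow hlr0.le (by positivity), mul_rpow (by positivity) (by positivity),
        ← rpow_mul (by positivity), div_mul_cancel₀ _ ha.ne']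

theorem exists_fData_le (hN : 1 ≤ N) (hε : ε < (N : ℝ) / 2) :
    ∃ C : ℝ, 0 < C ∧ ∀ σ : ℝ, 0 < σ → σ ≤ 1 / exp 1 → ∀ x : Space N, σ ≤ ‖x‖ →
      fData N ε x ≤ C * (σ ^ (-(N : ℝ)) * (-log σ) ^ (-((N : ℝ) / 2 - ε))) := by
  have hN0 : (0 : ℝ) < N := by exact_mod_cast hN
  set a := (N : ℝ) / 2 - ε + 1 with ha
  have ha0 : 0 < a := by linarith
  refine ⟨(1 + a / N) ^ a, by positivity, fun σ h0 h1 x hx => ?_⟩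
  have hlσ : 1 ≤ -log σ := one_le_neg_log h0 h1
  have hlσ0 : 0 < -log σ := by linarith
  by_cases hxe : x ∈ Metric.ball (0 : Space N) (1 / exp 1)
  swap
  · rw [fData, indicator_of_notMem hxe]
    positivity
  have hr0 : 0 < ‖x‖ := h0.trans_le hx
  have hr1 : ‖x‖ ≤ 1 / exp 1 := (mem_ball_zero_iff.1 hxe).le
  have hlr0 : 0 < -log ‖x‖ := by linarith [one_le_neg_log hr0 hr1]
  have hcmp : (‖x‖ ^ (N : ℝ))⁻¹ * ((-log ‖x‖) ^ a)⁻¹ ≤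
      (1 + a / N) ^ a * ((σ ^ (N : ℝ))⁻¹ * ((-log σ) ^ a)⁻¹) := by
    have hlog := neg_log_rpow_le ha0 hN0 h0 hx hr1
    rw [div_rpow hr0.le h0.le] at hlog
    rw [← mul_inv, ← mul_inv, ← div_eq_mul_inv, le_div_iff₀ (by positivity),
      inv_mul_le_iff₀ (by positivity)]
    calc
      σ ^ (N : ℝ) * (-log σ) ^ a ≤ σ ^ (N : ℝ) *
          ((-log ‖x‖) ^ a * ((1 + a / N) ^ a * (‖x‖ ^ (N : ℝ) / σ ^ (N : ℝ)))) := by gcongr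
      _ = _ := by field_simp
  calc
    fData N ε x = (‖x‖ ^ (N : ℝ))⁻¹ * ((-log ‖x‖) ^ a)⁻¹ := by
      rw [fData, indicator_of_mem hxe, abs_of_neg (by linarith), ← rpow_neg hr0.le,
        ← rpow_neg hlr0.le, ha]
      ring_nf
    _ ≤ (1 + a / N) ^ a * (σ ^ (-(N : ℝ)) * (-log σ) ^ (-a)) := by
      rwa [rpow_neg h0.le, rpow_neg hlσ0.le]
    _ ≤ (1 + a / N) ^ a * (σ ^ (-(N : ℝ)) * (-log σ) ^ (-((N : ℝ) / 2 - ε))) := by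
      gcongr ?_ * (?_ * ?_)
      exact rpow_le_rpow_of_exponent_le hlσ (by linarith)

end InitialData

section IntegralInequality
variable {α q S s : ℝ}

theorem le_ofReal_mul_rpow_add {p d : ℝ} (hp : 1 < p) (hpq : (p - 1) * q = 1) (hd : 0 < d)
    (y : ℝ≥0∞) : y ≤ ENNReal.ofReal d * y ^ p + ENNReal.ofReal (d ^ (-q)) := by
  rcases le_total y (ENNReal.ofReal (d ^ (-q))) with h | h
  · exact h.trans le_add_self
  calc
    y = ENNReal.ofReal d * ENNReal.ofReal (d ^ (-q)) ^ (p - 1) * y := by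
      rw [ENNReal.ofReal_rpow_of_nonneg (by positivity) (by linarith), ← rpow_mul hd.le, neg_mul,
        mul_comm q, hpq, rpow_neg_one, ← ENNReal.ofReal_mul hd.le, mul_inv_cancel₀ hd.ne',
        ENNReal.ofReal_one, one_mul]
    _ ≤ ENNReal.ofReal d * y ^ (p - 1) * y := by gcongr
    _ = ENNReal.ofReal d * y ^ p := by
      rw [mul_assoc, ← sub_add_cancel p 1, ENNReal.rpow_add_of_nonneg _ _ (by linarith) zero_le_one,
        ENNReal.rpow_one, sub_add_cancel]
    _ ≤ _ := le_self_add

theorem lintegral_lintegral_Ioo_swap {F : ℝ → ℝ → ℝ≥0∞} (hF : Measurable (Function.uncurry F))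
    (a b : ℝ) :
    ∫⁻ t in Ioo a b, ∫⁻ s in Ioo a t, F t s = ∫⁻ s in Ioo a b, ∫⁻ t in Ioo s b, F t s := by
  set G : ℝ × ℝ → ℝ≥0∞ := {w : ℝ × ℝ | w.2 < w.1}.indicator (Function.uncurry F)
  have hleft (t : ℝ) (ht : t ∈ Ioo a b) :
      ∫⁻ s in Ioo a t, F t s = ∫⁻ s in Ioo a b, G (t, s) := by
    rw [show (fun s => G (t, s)) = (Iio t).indicator (F t) from rfl,
      setLIntegral_indicator measurableSet_Iio, Set.inter_comm, Ioo_inter_Iio,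
      min_eq_right ht.2.le]
  have hright (s : ℝ) (hs : s ∈ Ioo a b) :
      ∫⁻ t in Ioo s b, F t s = ∫⁻ t in Ioo a b, G (t, s) := by
    rw [show (fun t => G (t, s)) = (Ioi s).indicator (fun t => F t s) from rfl,
      setLIntegral_indicator measurableSet_Ioi, Ioi_inter_Ioo, max_eq_left hs.1.le]
  rw [setLIntegral_congr_fun measurableSet_Ioo hleft,
    setLIntegral_congr_fun measurableSet_Ioo hright, lintegral_lintegral_swap]
  exact (hF.indicator (measurableSet_lt measurable_snd measurable_fst)).aemeasurable

theorem log_div_half_le_of_mem {t : ℝ} (hs : 0 < s) (hsS : s < S) (ht : t ∈ Ioo s √(s * S)) :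
    t < S ∧ log (S / s) / 2 ≤ log (S / t) := by
  have hS : 0 < S := hs.trans hsS
  have ht0 : 0 < t := hs.trans ht.1
  have hsq : t ^ 2 < s * S := (lt_sqrt ht0.le).1 ht.2
  have hlog := log_le_log (by positivity) hsq.le
  rw [log_pow, log_mul hs.ne' hS.ne', Nat.cast_ofNat] at hlog
  rw [log_div hS.ne' hs.ne', log_div hS.ne' ht0.ne']
  exact ⟨by nlinarith, by linarith⟩

theorem ofReal_mul_log_div_half_le_lintegral (hs : 0 < s) (hsS : s < S) {M : ℝ} (hM : 0 ≤ M)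
    {f : ℝ → ℝ≥0∞} (hf : ∀ t ∈ Ioo s √(s * S), ENNReal.ofReal (M * t⁻¹) ≤ f t) :
    ENNReal.ofReal (M * (log (S / s) / 2)) ≤ ∫⁻ t in Ioo s S, f t := by
  have hS : 0 < S := hs.trans hsS
  have hlog : log (√(s * S) / s) = log (S / s) / 2 := by
    rw [log_div (by positivity) hs.ne', log_sqrt (by positivity), log_mul hs.ne' hS.ne',
      log_div hS.ne' hs.ne']
    ring
  calc
    ENNReal.ofReal (M * (log (S / s) / 2))
        = ∫⁻ t in Ioo s √(s * S), ENNReal.ofReal M * ENNReal.ofReal t⁻¹ := by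
      rw [lintegral_const_mul _ (by fun_prop), lintegral_inv_Ioo hs
        (le_sqrt_of_sq_le (by nlinarith)), hlog, ENNReal.ofReal_mul hM]
    _ ≤ ∫⁻ t in Ioo s √(s * S), f t := by
      simp_rw [← ENNReal.ofReal_mul hM]
      exact setLIntegral_mono' measurableSet_Ioo hf
    _ ≤ ∫⁻ t in Ioo s S, f t := lintegral_mono_set fun t ht =>
      ⟨ht.1, (log_div_half_le_of_mem hs hsS ht).1⟩

theorem rpow_neg_eq_rpow_one_sub_mul_inv {t : ℝ} (ht : 0 < t) (α : ℝ) :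
    t ^ (-α) = t ^ (1 - α) * t⁻¹ := by
  rw [← rpow_neg_one t, ← rpow_add ht]
  congr 1
  ring

theorem lintegral_rpow_neg_Ioo_le (h1 : α ≤ 1) (hs : 0 < s) (hsS : s ≤ S) :
    ∫⁻ t in Ioo s S, ENNReal.ofReal (t ^ (-α)) ≤
      ENNReal.ofReal (S ^ (1 - α) * log (S / s)) := by
  have hS : 0 < S := hs.trans_le hsS
  rw [ENNReal.ofReal_mul (by positivity), ← lintegral_inv_Ioo hs hsS,
    ← lintegral_const_mul _ (by fun_prop)]
  refine setLIntegral_mono' measurableSet_Ioo fun t ht => ?_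
  have ht0 : 0 < t := hs.trans ht.1
  rw [← ENNReal.ofReal_mul (by positivity), rpow_neg_eq_rpow_one_sub_mul_inv ht0]
  gcongr
  exact ht.2.le

/-- The weight `t^(-α) log(S/t)^q` against which the averaged integral equation is tested on
`(t₀, S)`; for `α` near `1` its interaction with the kernel `(t - s)^(α - 1)` produces one more
logarithm. -/
noncomputable def testWeight (α q S t : ℝ) : ℝ≥0∞ :=
  ENNReal.ofReal (t ^ (-α) * log (S / t) ^ q)

@[fun_prop]
theorem measurable_testWeight (α q S : ℝ) : Measurable (testWeight α q S) := by
  unfold testWeight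
  fun_prop

theorem le_lintegral_testWeight (h1 : α ≤ 1) (hq : 0 ≤ q) (hs : 0 < s) (hsS : s < S) :
    ENNReal.ofReal (s ^ (1 - α) * (log (S / s) / 2) ^ (q + 1)) ≤
      ∫⁻ t in Ioo s S, testWeight α q S t := by
  have hL : 0 < log (S / s) := log_pos ((one_lt_div hs).2 hsS)
  rw [rpow_add_one (by positivity), ← mul_assoc]
  refine ofReal_mul_log_div_half_le_lintegral hs hsS (by positivity) fun t ht => ?_
  have ht0 : 0 < t := hs.trans ht.1
  rw [testWeight, rpow_neg_eq_rpow_one_sub_mul_inv ht0, mul_right_comm _ t⁻¹]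
  gcongr
  · exact ht.1.le
  · exact (log_div_half_le_of_mem hs hsS ht).2

theorem le_lintegral_testWeight_mul_rpow (h1 : α ≤ 1) (hq : 0 ≤ q) (hs : 0 < s) (hsS : s < S) :
    ENNReal.ofReal ((log (S / s) / 2) ^ (q + 1)) ≤
      ∫⁻ t in Ioo s S, testWeight α q S t * ENNReal.ofReal ((t - s) ^ (α - 1)) := by
  have hL : 0 < log (S / s) := log_pos ((one_lt_div hs).2 hsS)
  rw [rpow_add_one (by positivity)]
  refine ofReal_mul_log_div_half_le_lintegral hs hsS (by positivity) fun t ht => ?_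
  have ht0 : 0 < t := hs.trans ht.1
  obtain ⟨-, hlog⟩ := log_div_half_le_of_mem hs hsS ht
  have hlog0 : 0 ≤ log (S / t) := by linarith
  have hpow : t ^ (-α) * t ^ (α - 1) = t⁻¹ := by
    rw [← rpow_add ht0, ← rpow_neg_one]
    congr 1
    ring
  rw [testWeight, ← ENNReal.ofReal_mul (by positivity)]
  refine ENNReal.ofReal_le_ofReal ?_
  calc
    (log (S / s) / 2) ^ q * t⁻¹ ≤ log (S / t) ^ q * t⁻¹ := by gcongr
    _ = t ^ (-α) * log (S / t) ^ q * t ^ (α - 1) := by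
      rw [← hpow]
      ring
    _ ≤ t ^ (-α) * log (S / t) ^ q * (t - s) ^ (α - 1) := by
      gcongr ?_ * ?_
      exact rpow_le_rpow_of_nonpos (by linarith [ht.1]) (by linarith) (by linarith)

theorem lintegral_testWeight_mul_le {a ω t₀ : ℝ} {U V : ℝ → ℝ≥0∞} (ha : 0 < a) (ht₀ : 0 < t₀)
    (hV : Measurable V) (hup : ∀ t ∈ Ioo t₀ S, ∀ d : ℝ, 0 < d →
      U t ≤ ENNReal.ofReal d * V t + ENNReal.ofReal (d ^ (-q) * (ω * t ^ (α * q)))) :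
    ∫⁻ t in Ioo t₀ S, testWeight α q S t * U t ≤
      (∫⁻ s in Ioo t₀ S, ENNReal.ofReal (a * log (S / s) ^ (q + 1)) * V s) +
        ENNReal.ofReal (a ^ (-q) * ω) * ∫⁻ t in Ioo t₀ S, ENNReal.ofReal (t ^ (-α)) := by
  rw [← lintegral_const_mul _ (by fun_prop), ← lintegral_add_left (by fun_prop)]
  refine setLIntegral_mono' measurableSet_Ioo fun t ht => ?_
  have ht0 : 0 < t := ht₀.trans ht.1
  have hl : 0 < log (S / t) := log_pos ((one_lt_div ht0).2 ht.2)
  have hpow : t ^ (-α) * t ^ α = 1 := by rw [← rpow_add ht0, neg_add_cancel, rpow_zero]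
  have hpowq : t ^ (α * -q) * t ^ (α * q) = 1 := by
    rw [← rpow_add ht0, ← mul_add, neg_add_cancel, mul_zero, rpow_zero]
  have hlogq : log (S / t) ^ q * log (S / t) ^ (-q) = 1 := by
    rw [← rpow_add hl, add_neg_cancel, rpow_zero]
  -- this choice of `d` makes the last term independent of the logarithm
  refine (mul_le_mul_right (hup t ht (a * t ^ α * log (S / t)) (by positivity)) _).trans_eq ?_
  rw [testWeight, mul_add, ← mul_assoc, ← ENNReal.ofReal_mul (by positivity),
    ← ENNReal.ofReal_mul (by positivity), ← ENNReal.ofReal_mul' (by positivity)]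
  congr 2
  · congr 1
    rw [rpow_add_one hl.ne']
    linear_combination a * (log (S / t) ^ q * log (S / t)) * hpow
  · rw [mul_rpow (by positivity) hl.le, mul_rpow ha.le (by positivity), ← rpow_mul ht0.le]
    linear_combination (t ^ (-α) * (a ^ (-q) * ω)) *
      (log (S / t) ^ q * log (S / t) ^ (-q) * hpowq + hlogq)

theorem two_mul_le_lintegral_testWeight_mul {c : ℝ} (h0 : 1 / 2 ≤ α) (h1 : α ≤ 1) (hq : 0 ≤ q)
    (hc : 0 < c) (hs : 0 < s) (hsS : s < S) :
    2 * ENNReal.ofReal (c * 2 ^ (-q - 3) * log (S / s) ^ (q + 1)) ≤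
      ENNReal.ofReal α * ENNReal.ofReal c *
        ∫⁻ t in Ioo s S, testWeight α q S t * ENNReal.ofReal ((t - s) ^ (α - 1)) := by
  have hL : 0 < log (S / s) := log_pos ((one_lt_div hs).2 hsS)
  have hpow : (log (S / s) / 2) ^ (q + 1) = 4 * 2 ^ (-q - 3) * log (S / s) ^ (q + 1) := by
    rw [div_rpow hL.le zero_le_two, div_eq_inv_mul, ← rpow_neg zero_le_two,
      show (4 : ℝ) = 2 ^ (2 : ℝ) by norm_num, ← rpow_add two_pos]
    ring_nf
  calc
    2 * ENNReal.ofReal (c * 2 ^ (-q - 3) * log (S / s) ^ (q + 1))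
        = ENNReal.ofReal (2 * (c * 2 ^ (-q - 3) * log (S / s) ^ (q + 1))) := by
      rw [ENNReal.ofReal_mul zero_le_two, ENNReal.ofReal_ofNat]
    _ ≤ ENNReal.ofReal (α * c * (log (S / s) / 2) ^ (q + 1)) := by
      refine ENNReal.ofReal_le_ofReal ?_
      have : 0 < c * 2 ^ (-q - 3) * log (S / s) ^ (q + 1) := by positivity
      rw [hpow]
      nlinarith
    _ ≤ _ := by
      rw [ENNReal.ofReal_mul (by nlinarith), ENNReal.ofReal_mul (by linarith)]
      gcongr
      exact le_lintegral_testWeight_mul_rpow h1 hq hs hsS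

theorem le_lintegral_testWeight_mul {c t₀ : ℝ} {U V : ℝ → ℝ≥0∞} {m : ℝ≥0∞} (h0 : 1 / 2 ≤ α)
    (h1 : α ≤ 1) (hq : 0 ≤ q) (hc : 0 < c) (ht₀ : 0 < t₀) (hV : Measurable V)
    (hlow : ∀ᵐ t ∂(volume.restrict (Ioo t₀ S)), ENNReal.ofReal c * m + ENNReal.ofReal α *
      ∫⁻ s in Ioo t₀ t, ENNReal.ofReal ((t - s) ^ (α - 1)) * (ENNReal.ofReal c * V s) ≤ U t) :
    (∫⁻ t in Ioo t₀ S, testWeight α q S t) * (ENNReal.ofReal c * m) +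
        2 * (∫⁻ s in Ioo t₀ S,
          ENNReal.ofReal (c * 2 ^ (-q - 3) * log (S / s) ^ (q + 1)) * V s) ≤
      ∫⁻ t in Ioo t₀ S, testWeight α q S t * U t := by
  set F : ℝ → ℝ → ℝ≥0∞ := fun t s => testWeight α q S t * (ENNReal.ofReal α *
    (ENNReal.ofReal ((t - s) ^ (α - 1)) * (ENNReal.ofReal c * V s))) with hF
  have hgain : 2 * (∫⁻ s in Ioo t₀ S,
      ENNReal.ofReal (c * 2 ^ (-q - 3) * log (S / s) ^ (q + 1)) * V s) ≤
      ∫⁻ t in Ioo t₀ S, ∫⁻ s in Ioo t₀ t, F t s := by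
    rw [lintegral_lintegral_Ioo_swap (by simp only [hF, Function.uncurry_def]; fun_prop),
      ← lintegral_const_mul _ (by fun_prop)]
    refine setLIntegral_mono' measurableSet_Ioo fun s hs => ?_
    rw [← mul_assoc]
    refine (mul_le_mul_left (two_mul_le_lintegral_testWeight_mul h0 h1 hq hc (ht₀.trans hs.1)
      hs.2) _).trans_eq ?_
    rw [← lintegral_const_mul _ (by fun_prop), ← lintegral_mul_const _ (by fun_prop)]
    exact lintegral_congr fun t => by simp only [hF]; ring
  rw [← lintegral_mul_const _ (by fun_prop)]
  refine (add_le_add_right hgain _).trans ?_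
  rw [← lintegral_add_left (by fun_prop)]
  refine lintegral_mono_ae (hlow.mono fun t ht => le_of_eq_of_le ?_ (mul_le_mul_right ht _))
  simp only [hF]
  rw [mul_add, lintegral_const_mul _ (by fun_prop), lintegral_const_mul _ (by fun_prop)]

theorem ofReal_mul_le_of_integral_inequality {c ω t₀ : ℝ} {U V : ℝ → ℝ≥0∞} {m : ℝ≥0∞}
    (h0 : 1 / 2 ≤ α) (h1 : α ≤ 1) (hq : 0 ≤ q) (hc : 0 < c) (ht₀ : 0 < t₀)
    (ht₀S : t₀ < S) (hV : Measurable V) (hfin : ∫⁻ t in Ioo t₀ S, V t < ∞)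
    (hlow : ∀ᵐ t ∂(volume.restrict (Ioo t₀ S)), ENNReal.ofReal c * m + ENNReal.ofReal α *
      ∫⁻ s in Ioo t₀ t, ENNReal.ofReal ((t - s) ^ (α - 1)) * (ENNReal.ofReal c * V s) ≤ U t)
    (hup : ∀ t ∈ Ioo t₀ S, ∀ d : ℝ, 0 < d →
      U t ≤ ENNReal.ofReal d * V t + ENNReal.ofReal (d ^ (-q) * (ω * t ^ (α * q)))) :
    ENNReal.ofReal (t₀ ^ (1 - α) * (log (S / t₀) / 2) ^ (q + 1)) * (ENNReal.ofReal c * m) ≤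
      ENNReal.ofReal ((c * 2 ^ (-q - 3)) ^ (-q) * ω) *
        ENNReal.ofReal (S ^ (1 - α) * log (S / t₀)) := by
  set J := ∫⁻ s in Ioo t₀ S, ENNReal.ofReal (c * 2 ^ (-q - 3) * log (S / s) ^ (q + 1)) * V s
  have hJ : J ≠ ∞ := by
    have hJle : J ≤ ENNReal.ofReal (c * 2 ^ (-q - 3) * log (S / t₀) ^ (q + 1)) *
        ∫⁻ s in Ioo t₀ S, V s := by
      rw [← lintegral_const_mul _ hV]
      refine setLIntegral_mono' measurableSet_Ioo fun s hs => ?_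
      have hs0 : 0 < s := ht₀.trans hs.1
      have hS : 0 < S := hs0.trans hs.2
      have hL : 0 ≤ log (S / s) := log_nonneg ((one_le_div hs0).2 hs.2.le)
      gcongr
      exact hs.1.le
    exact (hJle.trans_lt (ENNReal.mul_lt_top ENNReal.ofReal_lt_top hfin)).ne
  have hsum := (le_lintegral_testWeight_mul h0 h1 hq hc ht₀ hV hlow).trans
    (lintegral_testWeight_mul_le (α := α) (q := q) (a := c * 2 ^ (-q - 3)) (by positivity) ht₀
      hV hup)
  have hcancel : (∫⁻ t in Ioo t₀ S, testWeight α q S t) * (ENNReal.ofReal c * m) ≤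
      ENNReal.ofReal ((c * 2 ^ (-q - 3)) ^ (-q) * ω) *
        ∫⁻ t in Ioo t₀ S, ENNReal.ofReal (t ^ (-α)) := by
    rw [two_mul, ← add_assoc, add_comm J] at hsum
    exact le_self_add.trans ((ENNReal.add_le_add_iff_right hJ).1 hsum)
  calc
    _ ≤ (∫⁻ t in Ioo t₀ S, testWeight α q S t) * (ENNReal.ofReal c * m) := by
      gcongr
      exact le_lintegral_testWeight h1 hq ht₀ ht₀S
    _ ≤ _ := hcancel
    _ ≤ _ := by
      gcongr
      exact lintegral_rpow_neg_Ioo_le h1 ht₀ ht₀S.le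

theorem le_of_integral_inequality {c ω t₀ : ℝ} {U V : ℝ → ℝ≥0∞} {m : ℝ≥0∞}
    (h0 : 1 / 2 ≤ α) (h1 : α < 1) (hq : 0 ≤ q) (hc : 0 < c) (hω : 0 ≤ ω) (hS : 0 < S)
    (ht₀ : t₀ = S * exp (-(1 / (1 - α)))) (hV : Measurable V) (hfin : ∫⁻ t in Ioo t₀ S, V t < ∞)
    (hlow : ∀ᵐ t ∂(volume.restrict (Ioo t₀ S)), ENNReal.ofReal c * m + ENNReal.ofReal α *
      ∫⁻ s in Ioo t₀ t, ENNReal.ofReal ((t - s) ^ (α - 1)) * (ENNReal.ofReal c * V s) ≤ U t)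
    (hup : ∀ t ∈ Ioo t₀ S, ∀ d : ℝ, 0 < d →
      U t ≤ ENNReal.ofReal d * V t + ENNReal.ofReal (d ^ (-q) * (ω * t ^ (α * q)))) :
    m ≤ ENNReal.ofReal ((c * 2 ^ (-q - 3)) ^ (-q) * ω * exp 1 * 2 ^ (q + 1) / c * (1 - α) ^ q) := by
  have hα : 0 < 1 - α := by linarith
  have ht₀0 : 0 < t₀ := by
    rw [ht₀]
    positivity
  have ht₀S : t₀ < S := by
    rw [ht₀]
    exact mul_lt_of_lt_one_right hS (exp_lt_one_iff.2 (neg_neg_iff_pos.2 (by positivity)))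
  have hlog : log (S / t₀) = (1 - α)⁻¹ := by
    rw [ht₀, div_mul_cancel_left₀ hS.ne', log_inv, log_exp, neg_neg, one_div]
  have hpow : t₀ ^ (1 - α) = S ^ (1 - α) * (exp 1)⁻¹ := by
    rw [ht₀, mul_rpow hS.le (exp_pos _).le, ← exp_mul, neg_mul, one_div_mul_cancel hα.ne', exp_neg]
  have h := ofReal_mul_le_of_integral_inequality h0 h1.le hq hc ht₀0 ht₀S hV hfin hlow hup
  rw [hlog, hpow, ← mul_assoc, ← ENNReal.ofReal_mul (by positivity),
    ← ENNReal.ofReal_mul (by positivity), mul_comm, ← ENNReal.le_div_iff_mul_le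
      (.inl (ENNReal.ofReal_pos.2 (by positivity)).ne') (.inl ENNReal.ofReal_ne_top),
    ← ENNReal.ofReal_div_of_pos (by positivity)] at h
  refine h.trans_eq (congrArg ENNReal.ofReal ?_)
  rw [div_rpow (by positivity) zero_le_two, rpow_add_one (by positivity), inv_rpow hα.le]
  have := rpow_pos_of_pos hα q
  field_simp

end IntegralInequality

/-! ### A necessary condition for existence -/

section NecessaryCondition
variable {N : ℕ} {α p : ℝ}

theorem one_lt_fujitaExponent (hN : 1 ≤ N) : 1 < fujitaExponent N := by
  have : 0 < 2 / (N : ℝ) := by positivity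
  rw [fujitaExponent]
  linarith

theorem fujitaExponent_sub_one_mul (hN : 1 ≤ N) : (fujitaExponent N - 1) * ((N : ℝ) / 2) = 1 := by
  have : 0 < (N : ℝ) := by positivity
  rw [fujitaExponent]
  field_simp
  ring

theorem le_heatKernel {a b τ R : ℝ} (ha : 0 < a) (haτ : a ≤ τ) (hτb : τ ≤ b) {x : Space N}
    (hx : ‖x‖ ≤ R) :
    1 / (4 * π * b) ^ ((N : ℝ) / 2) * exp (-R ^ 2 / (4 * a)) ≤ heatKernel τ x := by
  have hτ : 0 < τ := ha.trans_le haτ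
  rw [heatKernel, neg_div, neg_div]
  gcongr

theorem exists_mul_measure_ball_le_subordinatedHeat {w : ℝ → ℝ≥0∞} (hw : Measurable w)
    (hpos : ∀ θ, 0 < θ → w θ ≠ 0) {a : ℝ} (ha : 0 < a) (b : ℝ) (z x : Space N) (R : ℝ) :
    ∃ k ≠ 0, ∀ τ ∈ Icc a b, ∀ μ : Measure (Space N),
      k * μ (Metric.ball z R) ≤ subordinatedHeat w τ μ x := by
  set e : ℝ → ℝ≥0∞ := fun θ => ENNReal.ofReal
    (1 / (4 * π * (b * θ)) ^ ((N : ℝ) / 2) * exp (-(‖x - z‖ + R) ^ 2 / (4 * (a * θ))))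
  have hwe : Measurable fun θ => w θ * e θ := by fun_prop
  rcases le_or_gt a b with hab | hab
  swap
  · exact ⟨1, one_ne_zero, fun τ hτ => absurd (hτ.1.trans hτ.2) hab.not_ge⟩
  have hb : 0 < b := ha.trans_le hab
  refine ⟨∫⁻ θ in Ioi 0, w θ * e θ, ((setLIntegral_pos_iff hwe).2 ?_).ne', fun τ hτ μ => ?_⟩
  · have hsub : Ioi 0 ⊆ Function.support fun θ => w θ * e θ := fun θ (hθ : 0 < θ) =>
      mul_ne_zero (hpos θ hθ) (ENNReal.ofReal_pos.2 (by positivity)).ne'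
    rw [Set.inter_eq_right.2 hsub, Real.volume_Ioi]
    exact ENNReal.zero_lt_top
  rw [subordinatedHeat, ← lintegral_mul_const _ hwe]
  refine setLIntegral_mono' measurableSet_Ioi fun θ (hθ : 0 < θ) => ?_
  rw [mul_assoc, ← setLIntegral_const]
  gcongr
  refine (setLIntegral_mono' Metric.isOpen_ball.measurableSet fun y hy => ?_).trans
    (setLIntegral_le_lintegral _ _)
  refine ENNReal.ofReal_le_ofReal (le_heatKernel (by positivity) ?_ ?_ ?_)
  · exact mul_le_mul_of_nonneg_right hτ.1 hθ.le
  · exact mul_le_mul_of_nonneg_right hτ.2 hθ.le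
  · rw [← sub_add_sub_cancel x z y]
    refine (norm_add_le _ _).trans ?_
    gcongr
    exact (mem_ball_iff_norm'.1 hy).le

theorem lintegral_ball_rpow_lt_top_of_mildRHS (h0 : 0 < α) (h1 : α < 1) {μ : Measure (Space N)}
    {v : ℝ → Space N → ℝ≥0∞} (hv : Measurable (Function.uncurry v)) {S t : ℝ} (hS : 0 < S)
    (hSt : S < t) {x : Space N} (h : mildRHS α p μ v t x < ∞) (z : Space N) (R : ℝ) :
    ∫⁻ s in Ioo 0 S, ∫⁻ y in Metric.ball z R, v s y ^ p < ∞ := by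
  have ht : 0 < t := hS.trans hSt
  obtain ⟨k, hk, hle⟩ := exists_mul_measure_ball_le_subordinatedHeat
    (measurable_ofReal_mul_subDensity α)
    (fun θ hθ => (ENNReal.ofReal_pos.2 (mul_pos hθ (subDensity_pos h0 h1 hθ))).ne')
    (rpow_pos_of_pos (sub_pos.2 hSt) α) (t ^ α) z x R
  have hvp : Measurable (Function.uncurry fun s y => v s y ^ p) := hv.pow_const p
  have hVm : Measurable fun s => ∫⁻ y in Metric.ball z R, v s y ^ p := hvp.lintegral_prod_right'
  have hpoint (s : ℝ) (hs : s ∈ Ioo 0 S) :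
      ENNReal.ofReal (t ^ (α - 1)) * (k * ∫⁻ y in Metric.ball z R, v s y ^ p) ≤
        ENNReal.ofReal ((t - s) ^ (α - 1)) *
          opS α (t - s) (volume.withDensity fun y => v s y ^ p) x := by
    have hts : 0 < t - s := by linarith [hs.2]
    refine mul_le_mul' (ENNReal.ofReal_le_ofReal ?_) ?_
    · exact rpow_le_rpow_of_nonpos hts (by linarith [hs.1]) (by linarith)
    · rw [← withDensity_apply _ Metric.isOpen_ball.measurableSet]
      refine hle _ ⟨?_, ?_⟩ _
      · exact rpow_le_rpow (by linarith) (by linarith [hs.2]) h0.le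
      · exact rpow_le_rpow hts.le (by linarith [hs.1]) h0.le
  have hduhamel : ENNReal.ofReal α * (ENNReal.ofReal (t ^ (α - 1)) * k *
      ∫⁻ s in Ioo 0 S, ∫⁻ y in Metric.ball z R, v s y ^ p) ≤ mildRHS α p μ v t x := by
    refine le_trans ?_ le_add_self
    rw [← lintegral_const_mul _ hVm]
    simp_rw [mul_assoc]
    exact mul_le_mul_right ((setLIntegral_mono' measurableSet_Ioo hpoint).trans
      (lintegral_mono_set (Ioo_subset_Ioo_right hSt.le))) _
  rw [← mul_assoc] at hduhamel
  refine ENNReal.lt_top_of_mul_ne_top_right (hduhamel.trans_lt h).ne ?_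
  exact mul_ne_zero (ENNReal.ofReal_pos.2 h0).ne'
    (mul_ne_zero (ENNReal.ofReal_pos.2 (rpow_pos_of_pos ht _)).ne' hk)

theorem lintegral_mildRHS (γ μ : Measure (Space N)) [SFinite γ] [SFinite μ]
    {v : ℝ → Space N → ℝ≥0∞} (hv : Measurable (Function.uncurry v)) (t : ℝ) :
    ∫⁻ x, mildRHS α p μ v t x ∂γ = (∫⁻ x, opP α t μ x ∂γ) + ENNReal.ofReal α *
      ∫⁻ s in Ioo 0 t, ENNReal.ofReal ((t - s) ^ (α - 1)) *
        ∫⁻ x, opS α (t - s) (volume.withDensity fun y => v s y ^ p) x ∂γ := by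
  have hP : Measurable (opP α t μ) :=
    measurable_subordinatedHeat (measurable_ofReal_subDensity α) μ measurable_const measurable_id
  have hvp : Measurable (Function.uncurry fun (w : Space N × ℝ) y => v w.2 y ^ p) :=
    (hv.comp (f := fun q : (Space N × ℝ) × Space N => (q.1.2, q.2)) (by fun_prop)).pow_const p
  have hS : Measurable fun w : Space N × ℝ =>
      opS α (t - w.2) (volume.withDensity fun y => v w.2 y ^ p) w.1 :=
    measurable_subordinatedHeat_withDensity (measurable_ofReal_mul_subDensity α) hvp
      (by fun_prop) measurable_fst
  have hB : Measurable (Function.uncurry fun (x : Space N) (s : ℝ) =>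
      ENNReal.ofReal ((t - s) ^ (α - 1)) *
        opS α (t - s) (volume.withDensity fun y => v s y ^ p) x) := by
    exact Measurable.mul (by fun_prop) hS
  have hBint := hB.lintegral_prod_right' (ν := volume.restrict (Ioo 0 t))
  simp only [Function.uncurry_apply_pair] at hBint
  simp only [mildRHS]
  rw [lintegral_add_left hP, lintegral_const_mul _ hBint, lintegral_lintegral_swap hB.aemeasurable]
  congr 2
  refine lintegral_congr fun s => lintegral_const_mul _ ?_
  exact hS.comp (f := fun x : Space N => (x, s)) (by fun_prop)

/-- The mass of `g(s)` in the ball of radius `s^(α/2)` about `a`, the natural length scale of the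
time-fractional heat equation at time `s`. -/
noncomputable def parabolicMass (α : ℝ) (a : Space N) (g : ℝ → Space N → ℝ≥0∞) (s : ℝ) : ℝ≥0∞ :=
  ∫⁻ y in Metric.ball a (s ^ (α / 2)), g s y

theorem measurable_parabolicMass (a : Space N) {g : ℝ → Space N → ℝ≥0∞}
    (hg : Measurable (Function.uncurry g)) : Measurable (parabolicMass α a g) := by
  have hind (s : ℝ) : parabolicMass α a g s =
      ∫⁻ y, {w : ℝ × Space N | dist w.2 a < w.1 ^ (α / 2)}.indicator (Function.uncurry g) (s, y) :=
    (lintegral_indicator Metric.isOpen_ball.measurableSet _).symm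
  rw [funext hind]
  exact (hg.indicator (measurableSet_lt (by fun_prop) (by fun_prop))).lintegral_prod_right'

theorem le_parabolicMass (h0 : 1 / 2 ≤ α) (h1 : α < 1) (μ : Measure (Space N)) [SFinite μ]
    (a : Space N) {v : ℝ → Space N → ℝ≥0∞} (hv : Measurable (Function.uncurry v)) {t₀ t : ℝ}
    (ht₀ : 0 < t₀) (ht₀t : t₀ < t)
    (hvt : ∀ᵐ x ∂(volume : Measure (Space N)), v t x = mildRHS α p μ v t x) :
    1 / 2 * ballMass N * μ (Metric.ball a (t₀ ^ (α / 2))) + ENNReal.ofReal α *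
      ∫⁻ s in Ioo t₀ t, ENNReal.ofReal ((t - s) ^ (α - 1)) *
        (1 / 2 * ballMass N * parabolicMass α a (fun s y => v s y ^ p) s) ≤
      parabolicMass α a v t := by
  have ht : 0 < t := ht₀.trans ht₀t
  have hradius : t ^ α = (t ^ (α / 2)) ^ 2 := by
    rw [← rpow_natCast, ← rpow_mul ht.le, Nat.cast_ofNat, div_mul_cancel₀ α two_ne_zero]
  rw [parabolicMass, lintegral_congr_ae (ae_restrict_of_ae hvt), lintegral_mildRHS _ _ hv]
  gcongr ?_ + _ * ?_
  · rw [mul_assoc]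
    refine le_trans ?_ (ballMass_mul_le_opP h0 h1 ht (by positivity) hradius.le μ a)
    gcongr
  · refine le_trans (setLIntegral_mono' measurableSet_Ioo fun s hs => ?_)
      (lintegral_mono_set (Ioo_subset_Ioo_left ht₀.le))
    have hs0 : 0 < s := ht₀.trans hs.1
    have hts : 0 < t - s := sub_pos.2 hs.2
    rw [mul_assoc (1 / 2), parabolicMass, ← withDensity_apply _ Metric.isOpen_ball.measurableSet]
    refine mul_le_mul_right (le_trans ?_
      (ballMass_mul_le_opS h0 h1 hts (r := t ^ (α / 2)) (by positivity) ?_ _ a)) _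
    · gcongr
      exact hs.2.le
    · rw [← hradius]
      exact rpow_le_rpow hts.le (by linarith) (by linarith)

theorem parabolicMass_le {q d t : ℝ} (hp : 1 < p) (hpq : (p - 1) * q = 1) (hd : 0 < d)
    (ht : 0 < t) (hq : q = (N : ℝ) / 2) (a : Space N) {v : ℝ → Space N → ℝ≥0∞}
    (hv : Measurable (v t)) :
    parabolicMass α a v t ≤ ENNReal.ofReal d * parabolicMass α a (fun s y => v s y ^ p) t +
      ENNReal.ofReal
        (d ^ (-q) * ((volume (Metric.ball (0 : Space N) 1)).toReal * t ^ (α * q))) := by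
  have hvol : ENNReal.ofReal
      (d ^ (-q) * ((volume (Metric.ball (0 : Space N) 1)).toReal * t ^ (α * q))) =
      ENNReal.ofReal (d ^ (-q)) * volume (Metric.ball a (t ^ (α / 2))) := by
    rw [volume_ball_eq a (by positivity), ENNReal.ofReal_mul (by positivity), mul_comm _ (t ^ _),
      ENNReal.ofReal_mul (by positivity), ENNReal.ofReal_toReal measure_ball_lt_top.ne,
      ← rpow_mul ht.le, hq, mul_div_left_comm, mul_comm (α / 2)]
  have hvp : Measurable fun y => ENNReal.ofReal d * v t y ^ p := by fun_prop
  rw [hvol, ← setLIntegral_const, parabolicMass, parabolicMass,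
    ← lintegral_const_mul _ (hv.pow_const p), ← lintegral_add_left hvp]
  exact lintegral_mono fun x => le_ofReal_mul_rpow_add hp hpq hd _

theorem IsSolution.lintegral_parabolicMass_lt_top (h0 : 0 < α) (h1 : α < 1)
    {μ : Measure (Space N)} {T t₀ S : ℝ} {v : ℝ → Space N → ℝ≥0∞}
    (hv : Measurable (Function.uncurry v)) (hsol : IsSolution α p μ T v) (ht₀ : 0 ≤ t₀)
    (hS : 0 < S) (hST : S < T) (a : Space N) :
    ∫⁻ s in Ioo t₀ S, parabolicMass α a (fun s y => v s y ^ p) s < ∞ := by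
  obtain ⟨t, ht, x, hx⟩ : ∃ t ∈ Ioo S T, ∃ x, mildRHS α p μ v t x < ∞ := by
    have : NeBot (ae (volume.restrict (Ioo S T))) := by
      rw [ae_neBot, ne_eq, Measure.restrict_eq_zero, Real.volume_Ioo, ENNReal.ofReal_eq_zero]
      linarith
    have hsub : Ioo S T ⊆ Ioc 0 T := fun s hs => ⟨hS.trans hs.1, hs.2.le⟩
    obtain ⟨t, ht, htS⟩ := ((ae_restrict_of_ae_restrict_of_subset hsub hsol.2).and
      (ae_restrict_mem measurableSet_Ioo)).exists
    obtain ⟨x, hfin, heq⟩ := ht.exists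
    exact ⟨t, htS, x, heq ▸ hfin⟩
  refine (le_trans (setLIntegral_mono' measurableSet_Ioo fun s hs => ?_)
    (lintegral_mono_set (Ioo_subset_Ioo_left ht₀))).trans_lt
    (lintegral_ball_rpow_lt_top_of_mildRHS h0 h1 hv hS ht.1 hx a (S ^ (α / 2)))
  refine lintegral_mono_set (Metric.ball_subset_ball ?_)
  exact rpow_le_rpow (ht₀.trans hs.1.le) hs.2.le (by positivity)

theorem exists_measure_ball_le_of_isSolution (hN : 1 ≤ N) :
    ∃ C : ℝ, 0 < C ∧ ∀ (α : ℝ), 1 / 2 ≤ α → α < 1 → ∀ (μ : Measure (Space N)) [SFinite μ] (T : ℝ),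
      0 < T → ∀ u, IsSolution α (fujitaExponent N) μ T u → ∀ a,
      μ (Metric.ball a ((T / 2 * exp (-(1 / (1 - α)))) ^ (α / 2))) ≤
        ENNReal.ofReal (C * (1 - α) ^ ((N : ℝ) / 2)) := by
  set p := fujitaExponent N
  set q := (N : ℝ) / 2 with hq
  set c := (1 / 2 * ballMass N).toReal
  have hp : 1 < p := one_lt_fujitaExponent hN
  have hhalf : 1 / 2 * ballMass N ≠ ∞ := ENNReal.mul_ne_top (by simp) (ballMass_ne_top N)
  have hcE : ENNReal.ofReal c = 1 / 2 * ballMass N := ENNReal.ofReal_toReal hhalf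
  have hc : 0 < c := ENNReal.toReal_pos (mul_ne_zero (by simp) (ballMass_pos N).ne') hhalf
  set ω := (volume (Metric.ball (0 : Space N) 1)).toReal
  have hω : 0 < ω := ENNReal.toReal_pos (Metric.measure_ball_pos _ _ one_pos).ne'
    measure_ball_lt_top.ne
  refine ⟨(c * 2 ^ (-q - 3)) ^ (-q) * ω * exp 1 * 2 ^ (q + 1) / c, by positivity, ?_⟩
  intro α h0 h1 μ _ T hT u hu a
  obtain ⟨v, hv, hsol⟩ := hu.exists_measurable (by linarith)
  set t₀ := T / 2 * exp (-(1 / (1 - α))) with ht₀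
  have ht₀0 : 0 < t₀ := by positivity
  refine le_of_integral_inequality (V := parabolicMass α a fun s y => v s y ^ p)
    (U := parabolicMass α a v) h0 h1 (by positivity) hc hω.le (half_pos hT) ht₀
    (measurable_parabolicMass a (hv.pow_const p)) ?_ ?_ ?_
  · exact hsol.lintegral_parabolicMass_lt_top (by linarith) h1 hv ht₀0.le (half_pos hT)
      (half_lt_self hT) a
  · have hsub : Ioo t₀ (T / 2) ⊆ Ioc 0 T := fun s hs => ⟨ht₀0.trans hs.1, by linarith [hs.2]⟩
    filter_upwards [ae_restrict_of_ae_restrict_of_subset hsub hsol.2,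
      ae_restrict_mem measurableSet_Ioo] with t ht htS
    rw [hcE]
    exact le_parabolicMass h0 h1 μ a hv ht₀0 htS.1 (ht.mono fun x hx => hx.2)
  · intro t ht d hd
    exact parabolicMass_le hp (fujitaExponent_sub_one_mul hN) hd (ht₀0.trans ht.1) hq a
      hv.of_uncurry_left

end NecessaryCondition

/-! ### Smoothing estimates with Gaussian weights -/

section Smoothing
variable {N : ℕ} {p l t τ : ℝ} {A : ℝ≥0∞}

/-- The measure `G(l, z - x) dx`: the `L^p` norms with respect to these measures, uniformly in `z`,
are those in which the solution is estimated. -/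
noncomputable def gaussWeight (l : ℝ) (z : Space N) : Measure (Space N) :=
  volume.withDensity fun x => ENNReal.ofReal (heatKernel l (z - x))

instance (l : ℝ) (z : Space N) : SFinite (gaussWeight l z) := by
  unfold gaussWeight
  infer_instance

theorem lintegral_gaussWeight (l : ℝ) (z : Space N) {g : Space N → ℝ≥0∞} (hg : Measurable g) :
    ∫⁻ x, g x ∂gaussWeight l z = heatSemigroup l (volume.withDensity g) z := by
  rw [heatSemigroup_withDensity _ hg, gaussWeight,
    lintegral_withDensity_eq_lintegral_mul _ (by fun_prop) hg]
  simp only [Pi.mul_apply, mul_comm]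

theorem gaussWeight_univ (hl : 0 < l) (z : Space N) : gaussWeight l z univ = 1 := by
  rw [gaussWeight, withDensity_apply _ MeasurableSet.univ, Measure.restrict_univ]
  simp_rw [heatKernel_sub_comm l z]
  exact lintegral_heatKernel hl z

theorem lintegral_heatSemigroup_gaussWeight (hl : 0 < l) (ht : 0 < t) (z : Space N)
    (μ : Measure (Space N)) [SFinite μ] :
    ∫⁻ x, heatSemigroup t μ x ∂gaussWeight l z = heatSemigroup (l + t) μ z := by
  rw [gaussWeight, lintegral_withDensity_eq_lintegral_mul _ (by fun_prop) (by fun_prop)]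
  calc
    _ = ∫⁻ x, ∫⁻ y, ENNReal.ofReal (heatKernel l (z - x)) *
          ENNReal.ofReal (heatKernel t (x - y)) ∂μ ∂volume :=
      lintegral_congr fun x => (lintegral_const_mul _ (by fun_prop)).symm
    _ = ∫⁻ y, ∫⁻ x, ENNReal.ofReal (heatKernel l (z - x)) *
          ENNReal.ofReal (heatKernel t (x - y)) ∂volume ∂μ :=
      lintegral_lintegral_swap (Measurable.aemeasurable (by fun_prop))
    _ = heatSemigroup (l + t) μ z :=
      lintegral_congr fun y => lintegral_heatKernel_mul_heatKernel hl ht z y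

theorem heatSemigroup_le_rpow_mul_heatSemigroup (ht : 0 < t) (htl : t ≤ l)
    (μ : Measure (Space N)) (x : Space N) :
    heatSemigroup t μ x ≤ ENNReal.ofReal ((l / t) ^ ((N : ℝ) / 2)) * heatSemigroup l μ x := by
  have hl : 0 < l := ht.trans_le htl
  rw [heatSemigroup, heatSemigroup, ← lintegral_const_mul _ (by fun_prop)]
  refine lintegral_mono fun y => ?_
  rw [← ENNReal.ofReal_mul (by positivity)]
  exact ENNReal.ofReal_le_ofReal (heatKernel_le_rpow_mul_heatKernel ht htl _)

theorem heatSemigroup_le_of_forall_le_of_le (hl : 0 < l) (hlt : l ≤ t) (μ : Measure (Space N))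
    [SFinite μ] (hA : ∀ z, heatSemigroup l μ z ≤ A) (x : Space N) : heatSemigroup t μ x ≤ A := by
  rcases hlt.eq_or_lt with rfl | hlt
  · exact hA x
  calc
    heatSemigroup t μ x = ∫⁻ y, heatSemigroup l μ y ∂gaussWeight (t - l) x := by
      rw [lintegral_heatSemigroup_gaussWeight (sub_pos.2 hlt) hl, sub_add_cancel]
    _ ≤ ∫⁻ _, A ∂gaussWeight (t - l) x := lintegral_mono hA
    _ = A := by rw [lintegral_const, gaussWeight_univ (sub_pos.2 hlt), mul_one]

theorem heatSemigroup_le_of_forall_le (hl : 0 < l) (ht : 0 < t) (μ : Measure (Space N))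
    [SFinite μ] (hA : ∀ z, heatSemigroup l μ z ≤ A) (x : Space N) :
    heatSemigroup t μ x ≤ A * ENNReal.ofReal (max 1 (l / t) ^ ((N : ℝ) / 2)) := by
  rcases le_total l t with h | h
  · rw [max_eq_left ((div_le_one ht).2 h), one_rpow, ENNReal.ofReal_one, mul_one]
    exact heatSemigroup_le_of_forall_le_of_le hl h μ hA x
  · rw [max_eq_right ((one_le_div ht).2 h), mul_comm]
    exact (heatSemigroup_le_rpow_mul_heatSemigroup ht h μ x).trans (mul_le_mul_right (hA x) _)

theorem lintegral_heatSemigroup_rpow_le (hp : 1 ≤ p) (hl : 0 < l) (ht : 0 < t)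
    (μ : Measure (Space N)) [SFinite μ] (hA : ∀ z, heatSemigroup l μ z ≤ A) (z : Space N) :
    ∫⁻ x, heatSemigroup t μ x ^ p ∂gaussWeight l z ≤
      A ^ p * ENNReal.ofReal (max 1 (l / t) ^ ((N : ℝ) / 2 * (p - 1))) := by
  have hp1 : 0 ≤ p - 1 := sub_nonneg.2 hp
  have rpow_eq (a : ℝ≥0∞) : a ^ p = a ^ (p - 1) * a := by
    conv_rhs => rw [← ENNReal.rpow_one a, ← ENNReal.rpow_mul, one_mul]
    rw [← ENNReal.rpow_add_of_nonneg _ _ hp1 zero_le_one, sub_add_cancel]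
  have hM : 0 < max 1 (l / t) := lt_max_of_lt_left one_pos
  set R : ℝ≥0∞ := ENNReal.ofReal (max 1 (l / t) ^ ((N : ℝ) / 2)) with hR
  calc
    _ = ∫⁻ x, heatSemigroup t μ x ^ (p - 1) * heatSemigroup t μ x ∂gaussWeight l z := by
      simp_rw [rpow_eq]
    _ ≤ ∫⁻ x, (A * R) ^ (p - 1) * heatSemigroup t μ x ∂gaussWeight l z := by
      gcongr with x
      exact heatSemigroup_le_of_forall_le hl ht μ hA x
    _ = (A * R) ^ (p - 1) * heatSemigroup (l + t) μ z := by
      rw [lintegral_const_mul _ (by fun_prop), lintegral_heatSemigroup_gaussWeight hl ht]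
    _ ≤ (A * R) ^ (p - 1) * A := by
      gcongr
      exact heatSemigroup_le_of_forall_le_of_le hl (by linarith) μ hA z
    _ = _ := by
      rw [ENNReal.mul_rpow_of_nonneg _ _ hp1, hR, ENNReal.ofReal_rpow_of_pos (by positivity),
        ← rpow_mul hM.le, rpow_eq A, mul_right_comm]

theorem max_one_div_mul_rpow_le {θ q : ℝ} (hτ : 0 < τ) (hτl : τ ≤ l) (hθ : 0 < θ) (hq : 0 ≤ q) :
    max 1 (l / (τ * θ)) ^ q ≤ (l / τ) ^ q * (1 + θ ^ (-q)) := by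
  have hlτ : 1 ≤ (l / τ) ^ q := one_le_rpow ((one_le_div hτ).2 hτl) hq
  have hθq : 0 < θ ^ (-q) := rpow_pos_of_pos hθ _
  rcases max_cases 1 (l / (τ * θ)) with ⟨h, _⟩ | ⟨h, _⟩
  · rw [h, one_rpow]
    nlinarith
  · rw [h, ← div_div, div_rpow (div_nonneg (hτ.le.trans hτl) hτ.le) hθ.le, div_eq_mul_inv,
      ← rpow_neg hθ.le]
    gcongr
    linarith

theorem lintegral_subordinatedHeat_rpow_le (hp : 1 ≤ p) (hτ : 0 < τ) (hτl : τ ≤ l)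
    (μ : Measure (Space N)) [SFinite μ] (hA : ∀ z, heatSemigroup l μ z ≤ A) {w : ℝ → ℝ≥0∞}
    (hw : Measurable w) {q : ℝ} (hq : q = (N : ℝ) / 2 * (1 - 1 / p)) (z : Space N) :
    ∫⁻ x, subordinatedHeat w τ μ x ^ p ∂gaussWeight l z ≤
      (A * ENNReal.ofReal ((l / τ) ^ q) *
        ∫⁻ θ in Ioi (0 : ℝ), w θ * ENNReal.ofReal (1 + θ ^ (-q))) ^ p := by
  have hp0 : 0 < p := one_pos.trans_le hp
  have hq0 : 0 ≤ q := hq ▸ mul_nonneg (by positivity) (sub_nonneg.2 ((div_le_one hp0).2 hp))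
  have hqp : (N : ℝ) / 2 * (p - 1) * (1 / p) = q := by
    rw [hq]
    field_simp
  set ν := (volume.restrict (Ioi (0 : ℝ))).withDensity w with hν
  have hmem : ∀ᵐ θ ∂ν, θ ∈ Ioi (0 : ℝ) :=
    (withDensity_absolutelyContinuous _ w).ae_le (ae_restrict_mem measurableSet_Ioi)
  have heq (x : Space N) : subordinatedHeat w τ μ x = ∫⁻ θ, heatSemigroup (τ * θ) μ x ∂ν :=
    (lintegral_withDensity_eq_lintegral_mul _ hw (by fun_prop)).symm
  have hnorm {θ : ℝ} (hθ : 0 < θ) :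
      (∫⁻ x, heatSemigroup (τ * θ) μ x ^ p ∂gaussWeight l z) ^ (1 / p) ≤
        A * ENNReal.ofReal ((l / τ) ^ q) * ENNReal.ofReal (1 + θ ^ (-q)) := by
    have hM : 0 < max 1 (l / (τ * θ)) := lt_max_of_lt_left one_pos
    have hle := lintegral_heatSemigroup_rpow_le hp (hτ.trans_le hτl) (mul_pos hτ hθ) μ hA z
    refine (ENNReal.rpow_le_rpow hle (by positivity)).trans ?_
    rw [ENNReal.mul_rpow_of_nonneg _ _ (by positivity), ← ENNReal.rpow_mul,
      mul_one_div_cancel hp0.ne', ENNReal.rpow_one, ENNReal.ofReal_rpow_of_pos (by positivity),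
      ← rpow_mul hM.le, hqp, mul_assoc,
      ← ENNReal.ofReal_mul (rpow_nonneg (div_nonneg (hτ.le.trans hτl) hτ.le) _)]
    gcongr
    exact max_one_div_mul_rpow_le hτ hτl hθ hq0
  calc
    _ = ∫⁻ x, (∫⁻ θ, heatSemigroup (τ * θ) μ x ∂ν) ^ p ∂gaussWeight l z := by simp_rw [heq]
    _ ≤ (∫⁻ θ, (∫⁻ x, heatSemigroup (τ * θ) μ x ^ p ∂gaussWeight l z) ^ (1 / p) ∂ν) ^ p :=
      lintegral_lintegral_rpow_le hp (by fun_prop)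
    _ ≤ (∫⁻ θ, A * ENNReal.ofReal ((l / τ) ^ q) * ENNReal.ofReal (1 + θ ^ (-q)) ∂ν) ^ p :=
      ENNReal.rpow_le_rpow (lintegral_mono_ae (hmem.mono fun _ hθ => hnorm hθ)) hp0.le
    _ = _ := by
      rw [lintegral_const_mul _ (by fun_prop), hν,
        lintegral_withDensity_eq_lintegral_mul _ hw (by fun_prop)]
      rfl

end Smoothing

section DensityWeights
variable {α s θ : ℝ}

theorem lintegral_subDensity_mul_one_add_rpow_le (h0 : 0 < α) (h1 : α < 1) (hs : -1 < s)
    (hs0 : s ≤ 0) :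
    ∫⁻ θ in Ioi (0 : ℝ), ENNReal.ofReal (subDensity α θ) * ENNReal.ofReal (1 + θ ^ s) ≤
      1 + ENNReal.ofReal (Gamma (1 + s) / π) * ∫⁻ u in Ioo 0 π, ENNReal.ofReal (sin u ^ s) := by
  calc
    _ = ∫⁻ θ in Ioi (0 : ℝ), ENNReal.ofReal (subDensity α θ) +
          ENNReal.ofReal (θ ^ s * subDensity α θ) := by
      refine setLIntegral_congr_fun measurableSet_Ioi fun θ (hθ : 0 < θ) => ?_
      rw [← ENNReal.ofReal_mul (subDensity_pos h0 h1 hθ).le,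
        ← ENNReal.ofReal_add (subDensity_pos h0 h1 hθ).le
          (mul_nonneg (by positivity) (subDensity_pos h0 h1 hθ).le)]
      ring_nf
    _ ≤ _ := by
      rw [lintegral_add_left (measurable_ofReal_subDensity α), lintegral_subDensity h0 h1]
      gcongr
      exact lintegral_rpow_mul_subDensity_le h0 h1 hs hs0

theorem exists_lintegral_subDensity_mul_one_add_rpow_le (hs : -1 < s) (hs0 : s ≤ 0) :
    ∃ C : ℝ, 0 < C ∧ ∀ α : ℝ, 0 < α → α < 1 →
      ∫⁻ θ in Ioi (0 : ℝ), ENNReal.ofReal (subDensity α θ) * ENNReal.ofReal (1 + θ ^ s) ≤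
        ENNReal.ofReal C := by
  set B : ℝ≥0∞ :=
    ENNReal.ofReal (Gamma (1 + s) / π) * ∫⁻ u in Ioo 0 π, ENNReal.ofReal (sin u ^ s)
  have hB : B ≠ ∞ :=
    (ENNReal.mul_lt_top ENNReal.ofReal_lt_top (lintegral_sin_rpow_lt_top hs hs0)).ne
  refine ⟨1 + B.toReal, by positivity, fun α h0 h1 => ?_⟩
  rw [ENNReal.ofReal_add zero_le_one ENNReal.toReal_nonneg, ENNReal.ofReal_one,
    ENNReal.ofReal_toReal hB]
  exact lintegral_subDensity_mul_one_add_rpow_le h0 h1 hs hs0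

theorem mul_one_add_rpow_le (hθ : 0 < θ) (hs : -1 ≤ s) (hs0 : s ≤ 0) :
    θ * (1 + θ ^ s) ≤ 1 + 2 * θ := by
  have hle : θ * θ ^ s ≤ 1 + θ := by
    rcases le_total θ 1 with h | h
    · have : θ ^ (1 + s) ≤ 1 := rpow_le_one hθ.le h (by linarith)
      rw [rpow_add hθ, rpow_one] at this
      linarith
    · nlinarith [rpow_le_one_of_one_le_of_nonpos h hs0]
  linarith

theorem lintegral_mul_subDensity_mul_one_add_rpow_le (h0 : 1 / 2 ≤ α) (h1 : α < 1) (hs : -1 ≤ s)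
    (hs0 : s ≤ 0) :
    ∫⁻ θ in Ioi (0 : ℝ), ENNReal.ofReal (θ * subDensity α θ) * ENNReal.ofReal (1 + θ ^ s) ≤ 5 := by
  have hα : 0 < α := by linarith
  calc
    _ ≤ ∫⁻ θ in Ioi (0 : ℝ), ENNReal.ofReal (subDensity α θ) +
          2 * ENNReal.ofReal (θ * subDensity α θ) := by
      refine setLIntegral_mono' measurableSet_Ioi fun θ (hθ : 0 < θ) => ?_
      have hd := (subDensity_pos hα h1 hθ).le
      rw [← ENNReal.ofReal_ofNat 2, ← ENNReal.ofReal_mul (by positivity),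
        ← ENNReal.ofReal_mul (by positivity), ← ENNReal.ofReal_add (by positivity) (by positivity)]
      refine ENNReal.ofReal_le_ofReal ?_
      calc
        θ * subDensity α θ * (1 + θ ^ s) = subDensity α θ * (θ * (1 + θ ^ s)) := by ring
        _ ≤ subDensity α θ * (1 + 2 * θ) := by
          gcongr
          exact mul_one_add_rpow_le hθ hs hs0
        _ = subDensity α θ + 2 * (θ * subDensity α θ) := by ring
    _ = 1 + 2 * ∫⁻ θ in Ioi (0 : ℝ), ENNReal.ofReal (θ * subDensity α θ) := by
      rw [lintegral_add_left (measurable_ofReal_subDensity α),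
        lintegral_const_mul _ (measurable_ofReal_mul_subDensity α), lintegral_subDensity hα h1]
    _ ≤ 1 + 2 * 2 := by
      gcongr
      exact lintegral_mul_subDensity_le h0 h1
    _ = 5 := by norm_num

end DensityWeights

section TimeIntegral
variable {a b t : ℝ}

theorem lintegral_rpow_Ioo (ht : 0 ≤ t) (ha : -1 < a) :
    ∫⁻ s in Ioo 0 t, ENNReal.ofReal (s ^ a) = ENNReal.ofReal (t ^ (a + 1) / (a + 1)) := by
  have hfi : IntegrableOn (fun s : ℝ => s ^ a) (Ioo 0 t) :=
    (intervalIntegrable_iff_integrableOn_Ioo_of_le ht).1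
      (intervalIntegral.intervalIntegrable_rpow' ha)
  rw [← ofReal_integral_eq_lintegral_ofReal hfi
    (ae_restrict_of_forall_mem measurableSet_Ioo fun s hs => rpow_nonneg hs.1.le a),
    ← integral_Ioc_eq_integral_Ioo, ← intervalIntegral.integral_of_le ht,
    integral_rpow (.inl ha), zero_rpow (by linarith), sub_zero]

theorem lintegral_sub_left_Ioo (f : ℝ → ℝ≥0∞) (t : ℝ) :
    ∫⁻ s in Ioo 0 t, f (t - s) = ∫⁻ s in Ioo 0 t, f s := by
  simp_rw [← lintegral_indicator measurableSet_Ioo]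
  rw [← lintegral_sub_left_eq_self _ t]
  refine lintegral_congr fun s => ?_
  simp only [indicator, mem_Ioo, sub_pos, sub_lt_self_iff, and_comm, sub_sub_cancel]

theorem sub_rpow_mul_rpow_le {s : ℝ} (ha : a ≤ 0) (hb : b ≤ 0) (hs : s ∈ Ioo 0 t) :
    (t - s) ^ a * s ^ b ≤ (t / 2) ^ a * s ^ b + (t / 2) ^ b * (t - s) ^ a := by
  have hs0 : 0 < s := hs.1
  have hts : 0 < t - s := sub_pos.2 hs.2
  have ht : 0 < t := hs0.trans hs.2
  rcases le_total s (t / 2) with h | h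
  · refine le_add_of_le_of_nonneg ?_ (by positivity)
    gcongr ?_ * _
    exact rpow_le_rpow_of_nonpos (by positivity) (by linarith) ha
  · refine le_add_of_nonneg_of_le (by positivity) ?_
    rw [mul_comm]
    gcongr ?_ * _
    exact rpow_le_rpow_of_nonpos (by positivity) h hb

theorem half_rpow_le (ht : 0 < t) (ha : -1 ≤ a) : (t / 2) ^ a ≤ 2 * t ^ a := by
  have htwo : (2 : ℝ) ^ (-a) ≤ 2 := by
    simpa using rpow_le_rpow_of_exponent_le one_le_two (neg_le.1 ha)
  rw [div_rpow ht.le zero_le_two, div_eq_mul_inv, ← rpow_neg zero_le_two, mul_comm]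
  gcongr

theorem lintegral_sub_rpow_mul_rpow_le (ht : 0 < t) (ha : -1 < a) (ha0 : a ≤ 0) (hb : -1 < b)
    (hb0 : b ≤ 0) :
    ∫⁻ s in Ioo 0 t, ENNReal.ofReal ((t - s) ^ a * s ^ b) ≤
      ENNReal.ofReal (2 * ((a + 1)⁻¹ + (b + 1)⁻¹) * t ^ (a + b + 1)) := by
  have ha1 : 0 < a + 1 := by linarith
  have hb1 : 0 < b + 1 := by linarith
  calc
    _ ≤ ∫⁻ s in Ioo 0 t, ENNReal.ofReal ((t / 2) ^ a) * ENNReal.ofReal (s ^ b) +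
          ENNReal.ofReal ((t / 2) ^ b) * ENNReal.ofReal ((t - s) ^ a) := by
      refine setLIntegral_mono' measurableSet_Ioo fun s hs => ?_
      have hs0 : 0 < s := hs.1
      have hts : 0 < t - s := sub_pos.2 hs.2
      rw [← ENNReal.ofReal_mul (by positivity), ← ENNReal.ofReal_mul (by positivity),
        ← ENNReal.ofReal_add (by positivity) (by positivity)]
      exact ENNReal.ofReal_le_ofReal (sub_rpow_mul_rpow_le ha0 hb0 hs)
    _ = ENNReal.ofReal ((t / 2) ^ a * (t ^ (b + 1) / (b + 1)) +
          (t / 2) ^ b * (t ^ (a + 1) / (a + 1))) := by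
      rw [lintegral_add_left (by fun_prop), lintegral_const_mul _ (by fun_prop),
        lintegral_const_mul _ (by fun_prop), lintegral_rpow_Ioo ht.le hb,
        lintegral_sub_left_Ioo (fun s => ENNReal.ofReal (s ^ a)), lintegral_rpow_Ioo ht.le ha,
        ← ENNReal.ofReal_mul (by positivity), ← ENNReal.ofReal_mul (by positivity),
        ← ENNReal.ofReal_add (by positivity) (by positivity)]
    _ ≤ ENNReal.ofReal (2 * t ^ a * (t ^ (b + 1) / (b + 1)) +
          2 * t ^ b * (t ^ (a + 1) / (a + 1))) := by
      gcongr
      · exact half_rpow_le ht ha.le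
      · exact half_rpow_le ht hb.le
    _ = _ := by
      rw [rpow_add ht b, rpow_add ht a, rpow_add ht (a + b), rpow_add ht a]
      ring_nf

end TimeIntegral

section Duhamel
variable {N : ℕ} {α p q l t : ℝ}

/-- The Duhamel integral `∫_0^t (t-s)^(α-1) S_α(t-s) g(s) ds` of a source term `g`. With
`g = u^p` it is, up to the factor `α`, the nonlinear part of `mildRHS α p μ u`. -/
noncomputable def duhamel (α : ℝ) (g : ℝ → Space N → ℝ≥0∞) (t : ℝ) (x : Space N) : ℝ≥0∞ :=
  ∫⁻ s in Ioo 0 t, ENNReal.ofReal ((t - s) ^ (α - 1)) *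
    opS α (t - s) (volume.withDensity (g s)) x

theorem mildRHS_eq_opP_add_duhamel (α p : ℝ) (μ : Measure (Space N)) (u : ℝ → Space N → ℝ≥0∞)
    (t : ℝ) (x : Space N) :
    mildRHS α p μ u t x =
      opP α t μ x + ENNReal.ofReal α * duhamel α (fun s y => u s y ^ p) t x :=
  rfl

theorem measurable_opS_withDensity_sub {g : ℝ → Space N → ℝ≥0∞}
    (hg : Measurable (Function.uncurry g)) (α t : ℝ) :
    Measurable (Function.uncurry fun s x => ENNReal.ofReal ((t - s) ^ (α - 1)) *
      opS α (t - s) (volume.withDensity (g s)) x) := by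
  have hg' : Measurable (Function.uncurry fun (a : ℝ × Space N) => g a.1) :=
    hg.comp (measurable_fst.prodMap measurable_id)
  have hS : Measurable fun a : ℝ × Space N =>
      opS α (t - a.1) (volume.withDensity (g a.1)) a.2 :=
    measurable_subordinatedHeat_withDensity (measurable_ofReal_mul_subDensity α) hg'
      (by fun_prop) (by fun_prop)
  exact Measurable.mul (by fun_prop) hS

theorem measurable_duhamel {g : ℝ → Space N → ℝ≥0∞} (hg : Measurable (Function.uncurry g))
    (α t : ℝ) : Measurable (duhamel α g t) :=
  ((measurable_opS_withDensity_sub hg α t).comp measurable_swap).lintegral_prod_right'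

theorem lintegral_mul_opS_rpow_le (h0 : 1 / 2 ≤ α) (h1 : α < 1) (hp : 1 ≤ p) (ht : 0 < t)
    (htl : t ^ α ≤ l) (hq : q = (N : ℝ) / 2 * (1 - 1 / p)) (hq1 : q ≤ 1) {A : ℝ≥0∞}
    (μ : Measure (Space N)) [SFinite μ] (hA : ∀ z, heatSemigroup l μ z ≤ A) (c : ℝ≥0∞)
    (z : Space N) :
    (∫⁻ x, (c * opS α t μ x) ^ p ∂gaussWeight l z) ^ (1 / p) ≤
      c * (A * ENNReal.ofReal ((l / t ^ α) ^ q) * 5) := by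
  have hp0 : 0 < p := one_pos.trans_le hp
  have hq0 : 0 ≤ q := hq ▸ mul_nonneg (by positivity) (sub_nonneg.2 ((div_le_one hp0).2 hp))
  have hm : Measurable (opS α t μ) :=
    measurable_subordinatedHeat (measurable_ofReal_mul_subDensity α) μ measurable_const
      measurable_id
  have hS : ∫⁻ x, opS α t μ x ^ p ∂gaussWeight l z ≤
      (A * ENNReal.ofReal ((l / t ^ α) ^ q) * 5) ^ p := by
    refine (lintegral_subordinatedHeat_rpow_le hp (rpow_pos_of_pos ht α) htl μ hA
      (measurable_ofReal_mul_subDensity α) hq z).trans ?_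
    gcongr
    exact lintegral_mul_subDensity_mul_one_add_rpow_le h0 h1 (by linarith) (by linarith)
  rw [one_div, ENNReal.rpow_inv_le_iff hp0]
  simp_rw [ENNReal.mul_rpow_of_nonneg c _ hp0.le]
  rw [lintegral_const_mul _ (hm.pow_const p)]
  gcongr

theorem lintegral_sub_rpow_mul_rpow_neg_le {η : ℝ} (h0 : 1 / 2 ≤ α) (h1 : α < 1) (ht : 0 < t)
    (hη : 0 < η) (hη1 : η ≤ 1) :
    ∫⁻ s in Ioo 0 t, ENNReal.ofReal ((t - s) ^ (α * η - 1) * s ^ (-α)) ≤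
      ENNReal.ofReal ((2 + 4 / η) / (1 - α) * t ^ (-(α * (1 - η)))) := by
  have hα : 0 < α := by linarith
  have hα1 : 0 < 1 - α := sub_pos.2 h1
  have hαη : 0 < α * η := mul_pos hα hη
  have hαη1 : α * η ≤ 1 := mul_le_one₀ h1.le hη.le hη1
  refine (lintegral_sub_rpow_mul_rpow_le ht (by linarith) (by linarith) (by linarith)
    (by linarith)).trans (ENNReal.ofReal_le_ofReal ?_)
  rw [show α * η - 1 + -α + 1 = -(α * (1 - η)) by ring, sub_add_cancel, neg_add_eq_sub]
  gcongr
  have hinv : (α * η)⁻¹ ≤ 2 / η / (1 - α) :=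
    calc
      (α * η)⁻¹ ≤ (1 / 2 * η)⁻¹ := by gcongr
      _ = 2 / η := by field_simp
      _ ≤ 2 / η / (1 - α) := le_div_self (by positivity) hα1 (by linarith)
  calc
    2 * ((α * η)⁻¹ + (1 - α)⁻¹) ≤ 2 * (2 / η / (1 - α) + (1 - α)⁻¹) := by gcongr
    _ = (2 + 4 / η) / (1 - α) := by ring

theorem lintegral_sub_rpow_mul_opS_rpow_le {s M : ℝ} (h0 : 1 / 2 ≤ α) (h1 : α < 1) (hp : 1 ≤ p)
    (htl : t ^ α ≤ l) (hq : q = (N : ℝ) / 2 * (1 - 1 / p)) (hq1 : q ≤ 1) (hs : s ∈ Ioo 0 t)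
    (hM : 0 ≤ M) (μ : Measure (Space N)) [SFinite μ]
    (hμ : ∀ z, heatSemigroup l μ z ≤ ENNReal.ofReal (M * s ^ (-α))) (z : Space N) :
    (∫⁻ x, (ENNReal.ofReal ((t - s) ^ (α - 1)) * opS α (t - s) μ x) ^ p ∂gaussWeight l z) ^
        (1 / p) ≤
      ENNReal.ofReal (5 * M * l ^ q) *
        ENNReal.ofReal ((t - s) ^ (α * (1 - q) - 1) * s ^ (-α)) := by
  have hs0 : 0 < s := hs.1
  have hts : 0 < t - s := sub_pos.2 hs.2
  have hle : (t - s) ^ α ≤ l :=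
    (rpow_le_rpow hts.le (by linarith) (by linarith)).trans htl
  have hl : 0 < l := (rpow_pos_of_pos hts α).trans_le hle
  have hpow : (t - s) ^ (α * (1 - q) - 1) = (t - s) ^ (α - 1) / ((t - s) ^ α) ^ q := by
    rw [← rpow_mul hts.le, ← rpow_sub hts]
    ring_nf
  refine (lintegral_mul_opS_rpow_le h0 h1 hp hts hle hq hq1 _ hμ _ z).trans_eq ?_
  rw [← ENNReal.ofReal_ofNat 5, ← ENNReal.ofReal_mul (by positivity),
    ← ENNReal.ofReal_mul (by positivity), ← ENNReal.ofReal_mul (by positivity),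
    ← ENNReal.ofReal_mul (by positivity), hpow, div_rpow hl.le (by positivity)]
  congr 1
  field_simp

theorem lintegral_duhamel_rpow_le (h0 : 1 / 2 ≤ α) (h1 : α < 1) (hp : 1 ≤ p) (ht : 0 < t)
    (htl : t ^ α ≤ l) (hq : q = (N : ℝ) / 2 * (1 - 1 / p)) (hq1 : q < 1)
    {g : ℝ → Space N → ℝ≥0∞} (hg : Measurable (Function.uncurry g)) {M : ℝ} (hM : 0 ≤ M)
    (hgM : ∀ s ∈ Ioo 0 t, ∀ z,
      heatSemigroup l (volume.withDensity (g s)) z ≤ ENNReal.ofReal (M * s ^ (-α)))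
    (z : Space N) :
    ∫⁻ x, duhamel α g t x ^ p ∂gaussWeight l z ≤
      ENNReal.ofReal (5 * (2 + 4 / (1 - q)) * M / (1 - α) * (l / t ^ α) ^ q) ^ p := by
  have hp0 : 0 < p := one_pos.trans_le hp
  have hq0 : 0 ≤ q := hq ▸ mul_nonneg (by positivity) (sub_nonneg.2 ((div_le_one hp0).2 hp))
  have hl : 0 < l := (rpow_pos_of_pos ht α).trans_le htl
  calc
    _ ≤ (∫⁻ s in Ioo 0 t, (∫⁻ x, (ENNReal.ofReal ((t - s) ^ (α - 1)) *
          opS α (t - s) (volume.withDensity (g s)) x) ^ p ∂gaussWeight l z) ^ (1 / p)) ^ p :=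
      lintegral_lintegral_rpow_le hp (measurable_opS_withDensity_sub hg α t)
    _ ≤ (∫⁻ s in Ioo 0 t, ENNReal.ofReal (5 * M * l ^ q) *
          ENNReal.ofReal ((t - s) ^ (α * (1 - q) - 1) * s ^ (-α))) ^ p :=
      ENNReal.rpow_le_rpow (setLIntegral_mono' measurableSet_Ioo fun s hs =>
        lintegral_sub_rpow_mul_opS_rpow_le h0 h1 hp htl hq hq1.le hs hM _ (hgM s hs) z) hp0.le
    _ ≤ (ENNReal.ofReal (5 * M * l ^ q) *
          ENNReal.ofReal ((2 + 4 / (1 - q)) / (1 - α) * t ^ (-(α * (1 - (1 - q)))))) ^ p := by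
      rw [lintegral_const_mul _ (by fun_prop)]
      gcongr
      exact lintegral_sub_rpow_mul_rpow_neg_le h0 h1 ht (sub_pos.2 hq1) (by linarith)
    _ = _ := by
      rw [← ENNReal.ofReal_mul (by positivity), sub_sub_cancel, rpow_neg ht.le, rpow_mul ht.le,
        div_rpow hl.le (by positivity)]
      congr 2
      ring

theorem lintegral_opP_rpow_le (hp : 1 ≤ p) (ht : 0 < t) (htl : t ^ α ≤ l)
    (hq : q = (N : ℝ) / 2 * (1 - 1 / p)) {A C : ℝ} (hA0 : 0 ≤ A)
    (μ : Measure (Space N)) [SFinite μ] (hA : ∀ z, heatSemigroup l μ z ≤ ENNReal.ofReal A)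
    (hC : ∫⁻ θ in Ioi (0 : ℝ), ENNReal.ofReal (subDensity α θ) * ENNReal.ofReal (1 + θ ^ (-q)) ≤
      ENNReal.ofReal C) (z : Space N) :
    ∫⁻ x, opP α t μ x ^ p ∂gaussWeight l z ≤ ENNReal.ofReal (A * C * (l / t ^ α) ^ q) ^ p := by
  have hl : 0 < l := (rpow_pos_of_pos ht α).trans_le htl
  refine (lintegral_subordinatedHeat_rpow_le hp (rpow_pos_of_pos ht α) htl μ hA
    (measurable_ofReal_subDensity α) hq z).trans ?_
  gcongr
  calc
    _ ≤ ENNReal.ofReal A * ENNReal.ofReal ((l / t ^ α) ^ q) * ENNReal.ofReal C := by gcongr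
    _ = _ := by
      rw [mul_right_comm A, ENNReal.ofReal_mul (by positivity), ENNReal.ofReal_mul hA0]

theorem lintegral_mildRHS_rpow_le (h0 : 1 / 2 ≤ α) (h1 : α < 1) (hp : 1 < p)
    (hpN : (p - 1) * ((N : ℝ) / 2) = 1) (ht : 0 < t) (htl : t ^ α ≤ l) {K A C : ℝ} (hK0 : 0 ≤ K)
    (hA0 : 0 ≤ A) (hC0 : 0 ≤ C) (μ : Measure (Space N)) [SFinite μ]
    (hA : ∀ z, heatSemigroup l μ z ≤ ENNReal.ofReal A)
    (hC : ∫⁻ θ in Ioi (0 : ℝ), ENNReal.ofReal (subDensity α θ) *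
      ENNReal.ofReal (1 + θ ^ (-(1 / p))) ≤ ENNReal.ofReal C)
    (hK : A * C + 5 * (2 + 4 / (1 - 1 / p)) * (K ^ p * l) / (1 - α) ≤ K)
    {u : ℝ → Space N → ℝ≥0∞} (hu : Measurable (Function.uncurry u))
    (hub : ∀ s ∈ Ioo 0 t, ∀ z,
      ∫⁻ x, u s x ^ p ∂gaussWeight l z ≤ ENNReal.ofReal (K ^ p * l * s ^ (-α)))
    (z : Space N) :
    ∫⁻ x, mildRHS α p μ u t x ^ p ∂gaussWeight l z ≤ ENNReal.ofReal (K ^ p * l * t ^ (-α)) := by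
  have hp0 : 0 < p := one_pos.trans hp
  have hl : 0 < l := (rpow_pos_of_pos ht α).trans_le htl
  have hp1 : 1 / p < 1 := (div_lt_one hp0).2 hp
  have hq : 1 / p = (N : ℝ) / 2 * (1 - 1 / p) := by
    field_simp
    linarith
  have hup : Measurable (Function.uncurry fun s y => u s y ^ p) := hu.pow_const p
  set Q := (l / t ^ α) ^ (1 / p) with hQ
  have hP := lintegral_opP_rpow_le hp.le ht htl hq hA0 μ hA hC z
  have hD := lintegral_duhamel_rpow_le h0 h1 hp.le ht htl hq hp1 hup (M := K ^ p * l)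
    (by positivity) (fun s hs z => (lintegral_gaussWeight l z hup.of_uncurry_left).ge.trans
      (hub s hs z)) z
  calc
    _ ≤ ∫⁻ x, (opP α t μ x + duhamel α (fun s y => u s y ^ p) t x) ^ p ∂gaussWeight l z := by
      gcongr with x
      rw [mildRHS_eq_opP_add_duhamel]
      gcongr
      exact mul_le_of_le_one_left zero_le (ENNReal.ofReal_le_one.2 h1.le)
    _ ≤ _ := lintegral_add_rpow_le hp.le
      (measurable_subordinatedHeat (measurable_ofReal_subDensity α) μ measurable_const
        measurable_id).aemeasurable (measurable_duhamel hup α t).aemeasurable hP hD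
    _ ≤ ENNReal.ofReal (K * Q) ^ p := by
      have : 0 < 1 - α := sub_pos.2 h1
      have : 0 < 1 - 1 / p := sub_pos.2 hp1
      rw [← ENNReal.ofReal_add (by positivity) (by positivity), ← add_mul]
      gcongr
    _ = _ := by
      rw [ENNReal.ofReal_rpow_of_nonneg (by positivity) hp0.le, mul_rpow hK0 (by positivity), hQ,
        ← rpow_mul (by positivity), one_div_mul_cancel hp0.ne', rpow_one, rpow_neg ht.le,
        mul_assoc, div_eq_mul_inv]

end Duhamel

section MonotoneLimits
variable {N : ℕ} {α p : ℝ}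

theorem iSup_rpow {ι : Sort*} (hp : 0 < p) (f : ι → ℝ≥0∞) : (⨆ i, f i) ^ p = ⨆ i, f i ^ p :=
  (ENNReal.orderIsoRpow p hp).map_iSup f

theorem heatSemigroup_iSup (t : ℝ) {g : ℕ → Space N → ℝ≥0∞} (hg : ∀ n, Measurable (g n))
    (hmono : Monotone g) (x : Space N) :
    heatSemigroup t (volume.withDensity fun y => ⨆ n, g n y) x =
      ⨆ n, heatSemigroup t (volume.withDensity (g n)) x := by
  rw [heatSemigroup_withDensity _ (.iSup hg)]
  simp_rw [heatSemigroup_withDensity _ (hg _), ENNReal.iSup_mul]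
  exact lintegral_iSup (fun n => (hg n).mul (by fun_prop))
    fun m n hmn y => mul_le_mul_left (hmono hmn y) _

theorem subordinatedHeat_iSup {w : ℝ → ℝ≥0∞} (hw : Measurable w) (τ : ℝ)
    {g : ℕ → Space N → ℝ≥0∞} (hg : ∀ n, Measurable (g n)) (hmono : Monotone g) (x : Space N) :
    subordinatedHeat w τ (volume.withDensity fun y => ⨆ n, g n y) x =
      ⨆ n, subordinatedHeat w τ (volume.withDensity (g n)) x := by
  unfold subordinatedHeat
  simp_rw [heatSemigroup_iSup _ hg hmono, ENNReal.mul_iSup]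
  exact lintegral_iSup (fun n => hw.mul (by fun_prop)) fun m n hmn θ =>
    mul_le_mul_right (lintegral_mono' (withDensity_mono (.of_forall (hmono hmn))) le_rfl) _

theorem duhamel_iSup {g : ℕ → ℝ → Space N → ℝ≥0∞}
    (hg : ∀ n, Measurable (Function.uncurry (g n))) (hmono : Monotone g) (t : ℝ) (x : Space N) :
    duhamel α (fun s y => ⨆ n, g n s y) t x = ⨆ n, duhamel α (g n) t x := by
  have hS (s : ℝ) : opS α (t - s) (volume.withDensity fun y => ⨆ n, g n s y) x =
      ⨆ n, opS α (t - s) (volume.withDensity (g n s)) x :=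
    subordinatedHeat_iSup (measurable_ofReal_mul_subDensity α) _
      (fun n => (hg n).of_uncurry_left) (fun m n hmn => hmono hmn s) x
  unfold duhamel
  simp_rw [hS, ENNReal.mul_iSup]
  exact lintegral_iSup (fun n => (measurable_opS_withDensity_sub (hg n) α t).of_uncurry_right)
    fun m n hmn s => mul_le_mul_right
      (subordinatedHeat_mono (withDensity_mono (.of_forall (hmono hmn s))) _ _ x) _

theorem mildRHS_iSup (hp : 0 < p) (μ : Measure (Space N)) {u : ℕ → ℝ → Space N → ℝ≥0∞}
    (hu : ∀ n, Measurable (Function.uncurry (u n))) (hmono : Monotone u) (t : ℝ) (x : Space N) :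
    mildRHS α p μ (fun s y => ⨆ n, u n s y) t x = ⨆ n, mildRHS α p μ (u n) t x := by
  have hmono' : Monotone fun n s y => u n s y ^ p :=
    fun m n hmn s y => ENNReal.rpow_le_rpow (hmono hmn s y) hp.le
  simp_rw [mildRHS_eq_opP_add_duhamel, iSup_rpow hp,
    duhamel_iSup (fun n => (hu n).pow_const p) hmono', ENNReal.mul_iSup, ENNReal.add_iSup]

theorem ae_iSup_lt_top_of_lintegral_rpow_le {X : Type*} [MeasurableSpace X] {γ : Measure X}
    (hp : 0 < p) {f : ℕ → X → ℝ≥0∞} (hf : ∀ n, Measurable (f n)) (hmono : Monotone f)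
    {B : ℝ≥0∞} (hB : B ≠ ∞) (h : ∀ n, ∫⁻ x, f n x ^ p ∂γ ≤ B) : ∀ᵐ x ∂γ, ⨆ n, f n x < ∞ := by
  have hle : ∫⁻ x, (⨆ n, f n x) ^ p ∂γ ≤ B := by
    simp_rw [iSup_rpow hp]
    rw [lintegral_iSup (fun n => (hf n).pow_const p)
      fun m n hmn x => ENNReal.rpow_le_rpow (hmono hmn x) hp.le]
    exact iSup_le h
  filter_upwards [ae_lt_top ((Measurable.iSup hf).pow_const p) (ne_top_of_le_ne_top hB hle)]
    with x hx
  exact (ENNReal.rpow_lt_top_iff_of_pos hp).1 hx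

end MonotoneLimits

/-! ### Picard iteration -/

section Picard
variable {N : ℕ} {α p l T : ℝ}

/-- The Picard iterates of the mild formulation, starting from `0`; they increase to the minimal
solution. -/
noncomputable def picard (α p : ℝ) (μ : Measure (Space N)) : ℕ → ℝ → Space N → ℝ≥0∞
  | 0 => fun _ _ => 0
  | n + 1 => mildRHS α p μ (picard α p μ n)

theorem measurable_picard (μ : Measure (Space N)) [SFinite μ] (n : ℕ) :
    Measurable (Function.uncurry (picard α p μ n)) := by
  induction n with
  | zero => exact measurable_const
  | succ n ih => exact measurable_mildRHS μ ih

theorem monotone_picard (hp : 0 ≤ p) (μ : Measure (Space N)) : Monotone (picard α p μ) := by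
  refine monotone_nat_of_le_succ fun n => ?_
  induction n with
  | zero => exact fun _ _ => zero_le
  | succ n ih =>
    exact fun t x => mildRHS_mono hp μ (.of_forall fun s => .of_forall fun y => ih s y) le_rfl x

theorem picard_le_of_isSolution (hp : 0 ≤ p) (μ : Measure (Space N))
    {v : ℝ → Space N → ℝ≥0∞} (hv : IsSolution α p μ T v) (n : ℕ) :
    ∀ᵐ t ∂volume.restrict (Ioc 0 T), ∀ᵐ x ∂(volume : Measure (Space N)),
      picard α p μ n t x ≤ v t x := by
  induction n with
  | zero => exact .of_forall fun _ => .of_forall fun _ => zero_le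
  | succ n ih =>
    filter_upwards [hv.2, ae_restrict_mem measurableSet_Ioc] with t ht htT
    filter_upwards [ht] with x hx
    exact (mildRHS_mono hp μ ih htT.2 x).trans_eq hx.2.symm

theorem mildRHS_iSup_picard (hp : 0 < p) (μ : Measure (Space N)) [SFinite μ] (t : ℝ)
    (x : Space N) :
    mildRHS α p μ (fun s y => ⨆ n, picard α p μ n s y) t x = ⨆ n, picard α p μ n t x := by
  rw [mildRHS_iSup hp μ (measurable_picard μ) (monotone_picard hp.le μ)]
  exact (show Monotone fun n => picard α p μ n t x from
    fun m n hmn => monotone_picard hp.le μ hmn t x).iSup_nat_add 1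

theorem volume_absolutelyContinuous_gaussWeight (hl : 0 < l) (z : Space N) :
    (volume : Measure (Space N)) ≪ gaussWeight l z := by
  refine withDensity_absolutelyContinuous' (Measurable.aemeasurable (by fun_prop))
    (.of_forall fun x => ?_)
  rw [ne_eq, ENNReal.ofReal_eq_zero, not_le, heatKernel]
  positivity

theorem exists_isMinimalSolution_of_lintegral_picard_le (hp : 0 < p) (μ : Measure (Space N))
    [SFinite μ] (hl : 0 < l) (z : Space N) {B : ℝ → ℝ≥0∞} (hB : ∀ t, B t ≠ ∞)
    (h : ∀ n, ∀ t ∈ Ioc 0 T, ∫⁻ x, picard α p μ n t x ^ p ∂gaussWeight l z ≤ B t) :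
    ∃ u, IsMinimalSolution α p μ T u := by
  refine ⟨fun t x => ⨆ n, picard α p μ n t x, ⟨?_, ?_⟩, fun v hv => ?_⟩
  · exact (Measurable.iSup fun n => measurable_picard μ n).aemeasurable
  · filter_upwards [ae_restrict_mem measurableSet_Ioc] with t ht
    have hfin := ae_iSup_lt_top_of_lintegral_rpow_le hp
      (fun n => (measurable_picard (α := α) (p := p) μ n).of_uncurry_left (x := t))
      (fun m n hmn => monotone_picard hp.le μ hmn t) (hB t) fun n => h n t ht
    filter_upwards [(volume_absolutelyContinuous_gaussWeight hl z).ae_le hfin] with x hx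
    exact ⟨hx, (mildRHS_iSup_picard hp μ t x).symm⟩
  · filter_upwards [ae_all_iff.2 (picard_le_of_isSolution hp.le μ hv)] with t ht
    filter_upwards [ae_all_iff.2 ht] with x hx
    exact iSup_le hx

theorem lintegral_picard_rpow_le (h0 : 1 / 2 ≤ α) (h1 : α < 1) (hp : 1 < p)
    (hpN : (p - 1) * ((N : ℝ) / 2) = 1) {K A C : ℝ} (hK0 : 0 ≤ K) (hA0 : 0 ≤ A) (hC0 : 0 ≤ C)
    (μ : Measure (Space N)) [SFinite μ]
    (hA : ∀ z, heatSemigroup (T ^ α) μ z ≤ ENNReal.ofReal A)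
    (hC : ∫⁻ θ in Ioi (0 : ℝ), ENNReal.ofReal (subDensity α θ) *
      ENNReal.ofReal (1 + θ ^ (-(1 / p))) ≤ ENNReal.ofReal C)
    (hK : A * C + 5 * (2 + 4 / (1 - 1 / p)) * (K ^ p * T ^ α) / (1 - α) ≤ K)
    (n : ℕ) {t : ℝ} (ht : t ∈ Ioc 0 T) (z : Space N) :
    ∫⁻ x, picard α p μ n t x ^ p ∂gaussWeight (T ^ α) z ≤
      ENNReal.ofReal (K ^ p * T ^ α * t ^ (-α)) := by
  induction n generalizing t z with
  | zero => simp [picard, ENNReal.zero_rpow_of_pos (one_pos.trans hp)]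
  | succ n ih =>
    exact lintegral_mildRHS_rpow_le h0 h1 hp hpN ht.1 (rpow_le_rpow ht.1.le ht.2 (by linarith)) hK0
      hA0 hC0 μ hA hC hK (measurable_picard μ n)
      (fun s hs z => ih ⟨hs.1, hs.2.le.trans ht.2⟩ z) z

theorem mul_add_mul_rpow_div_le {A C D r l δ : ℝ} (hA : 0 < A) (hC : 0 < C) (hδ : 0 < δ)
    (h : 2 * D * (2 * C) ^ r * A ^ r * l ≤ δ) :
    A * C + D * ((2 * A * C) ^ (1 + r) * l) / δ ≤ 2 * A * C := by
  have hpow : (2 * A * C) ^ (1 + r) = 2 * A * C * ((2 * C) ^ r * A ^ r) := by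
    rw [rpow_add (by positivity), rpow_one, ← mul_rpow (by positivity) hA.le]
    ring_nf
  have hhalf : D * ((2 * A * C) ^ (1 + r) * l) / δ ≤ A * C := by
    rw [div_le_iff₀ hδ, hpow]
    calc
      _ = A * C * (2 * D * (2 * C) ^ r * A ^ r * l) := by ring
      _ ≤ A * C * δ := by gcongr
  linarith

theorem exists_forall_isMinimalSolution (hN : 1 ≤ N) :
    ∃ B : ℝ, 0 < B ∧ ∀ α : ℝ, 1 / 2 ≤ α → α < 1 → ∀ (μ : Measure (Space N)) [SFinite μ]
      (T A : ℝ), 0 < T → 0 < A → (∀ z, heatSemigroup (T ^ α) μ z ≤ ENNReal.ofReal A) →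
      B * A ^ (2 / (N : ℝ)) * T ^ α ≤ 1 - α →
      ∃ u, IsMinimalSolution α (fujitaExponent N) μ T u := by
  set p := fujitaExponent N
  have hp1 : 1 < p := one_lt_fujitaExponent hN
  have hp0 : 0 < p := one_pos.trans hp1
  have hpi : 1 / p < 1 := (div_lt_one hp0).2 hp1
  have : 0 < 1 - 1 / p := sub_pos.2 hpi
  obtain ⟨C, hC0, hC⟩ := exists_lintegral_subDensity_mul_one_add_rpow_le (s := -(1 / p))
    (neg_lt_neg hpi) (neg_nonpos.2 (by positivity))
  refine ⟨2 * (5 * (2 + 4 / (1 - 1 / p))) * (2 * C) ^ (2 / (N : ℝ)), by positivity, ?_⟩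
  intro α h0 h1 μ _ T A hT hA0 hA hB
  have hK := mul_add_mul_rpow_div_le hA0 hC0 (sub_pos.2 h1) hB
  exact exists_isMinimalSolution_of_lintegral_picard_le hp0 μ (rpow_pos_of_pos hT α) 0
    (fun _ => ENNReal.ofReal_ne_top) fun n t ht => lintegral_picard_rpow_le h0 h1 hp1
      (fujitaExponent_sub_one_mul hN) (by positivity) hA0.le hC0.le μ hA (hC α (by linarith) h1) hK
      n ht 0

end Picard

section DataBounds
variable {N : ℕ} {ε l σ : ℝ}

instance (φ : Space N → ℝ) : SFinite (toMeasure φ) := by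
  unfold toMeasure
  infer_instance

theorem heatKernel_le_rpow (hl : 0 < l) (x : Space N) :
    heatKernel l x ≤ l ^ (-((N : ℝ) / 2)) := by
  have hexp : exp (-‖x‖ ^ 2 / (4 * l)) ≤ 1 := by
    rw [exp_le_one_iff, neg_div, neg_nonpos]
    positivity
  rw [heatKernel, rpow_neg hl.le, ← one_div]
  refine (mul_le_of_le_one_right (by positivity) hexp).trans ?_
  gcongr
  nlinarith [pi_gt_three]

theorem heatSemigroup_withDensity_le (hl : 0 < l) {g : Space N → ℝ≥0∞} (hg : Measurable g)
    {s : Set (Space N)} (hs : MeasurableSet s) {M : ℝ≥0∞} (hM : ∀ y ∈ sᶜ, g y ≤ M)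
    (z : Space N) :
    heatSemigroup l (volume.withDensity g) z ≤
      volume.withDensity g s * ENNReal.ofReal (l ^ (-((N : ℝ) / 2))) + M := by
  rw [heatSemigroup_withDensity _ hg, ← lintegral_add_compl _ hs]
  gcongr
  · calc
      _ ≤ ∫⁻ y in s, g y * ENNReal.ofReal (l ^ (-((N : ℝ) / 2))) := by
        gcongr
        exact heatKernel_le_rpow hl _
      _ = _ := by rw [lintegral_mul_const _ hg, withDensity_apply _ hs]
  · calc
      _ ≤ ∫⁻ y in sᶜ, M * ENNReal.ofReal (heatKernel l (z - y)) :=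
        setLIntegral_mono' hs.compl fun y hy => mul_le_mul_left (hM y hy) _
      _ ≤ ∫⁻ y, M * ENNReal.ofReal (heatKernel l (z - y)) := setLIntegral_le_lintegral _ _
      _ = M := by
        rw [lintegral_const_mul _ (by fun_prop)]
        simp_rw [heatKernel_sub_comm l z]
        rw [lintegral_heatKernel hl, mul_one]

theorem exists_heatSemigroup_toMeasure_fData_le (hN : 1 ≤ N) (hε : ε < (N : ℝ) / 2) :
    ∃ C : ℝ, 0 < C ∧ ∀ κ : ℝ, 0 ≤ κ → ∀ l : ℝ, 0 < l → √l ≤ 1 / exp 1 → ∀ z,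
      heatSemigroup l (toMeasure fun x => κ * fData N ε x) z ≤
        ENNReal.ofReal (C * κ * (-log √l) ^ (-((N : ℝ) / 2 - ε)) * l ^ (-((N : ℝ) / 2))) := by
  obtain ⟨C₁, hC₁, hball⟩ := exists_toMeasure_fData_ball_eq hN hε
  obtain ⟨C₂, hC₂, hcompl⟩ := exists_fData_le hN hε
  refine ⟨C₁ + C₂, by positivity, fun κ hκ l hl hle z => ?_⟩
  have hσ : 0 < √l := sqrt_pos.2 hl
  have hL : 0 < -log √l := one_pos.trans_le (one_le_neg_log hσ hle)
  have hpow : √l ^ (-(N : ℝ)) = l ^ (-((N : ℝ) / 2)) := by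
    rw [sqrt_eq_rpow, ← rpow_mul hl.le]
    ring_nf
  set L := (-log √l) ^ (-((N : ℝ) / 2 - ε)) with hLdef
  have hout : ∀ y ∈ (Metric.ball (0 : Space N) √l)ᶜ,
      ENNReal.ofReal (κ * fData N ε y) ≤
        ENNReal.ofReal (C₂ * κ * L * l ^ (-((N : ℝ) / 2))) := by
    intro y hy
    refine ENNReal.ofReal_le_ofReal ?_
    calc
      κ * fData N ε y ≤ κ * (C₂ * (l ^ (-((N : ℝ) / 2)) * L)) := by
        gcongr
        exact hpow ▸ hcompl √l hσ hle y (by simpa using hy)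
      _ = _ := by ring
  refine (heatSemigroup_withDensity_le hl ((measurable_fData N ε).const_mul κ).ennreal_ofReal
    measurableSet_ball hout z).trans_eq ?_
  rw [← toMeasure, hball κ hκ √l hσ hle, ← hLdef,
    ← ENNReal.ofReal_mul (by positivity), ← ENNReal.ofReal_add (by positivity) (by positivity)]
  ring_nf

end DataBounds

/-! ### The life span -/

section LifeSpan
variable {N : ℕ} {ε κ α : ℝ}

/-- The quantity `κ^(2/(N-2ε)) (1-α)^(-N/(N-2ε))`, to which `-log T_α[κ f_ε]` is comparable. -/
noncomputable def rate (N : ℕ) (ε κ α : ℝ) : ℝ :=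
  κ ^ (2 / ((N : ℝ) - 2 * ε)) * (1 - α) ^ (-((N : ℝ) / ((N : ℝ) - 2 * ε)))

theorem rate_pos (hκ : 0 < κ) (h1 : α < 1) : 0 < rate N ε κ α := by
  have : 0 < 1 - α := sub_pos.2 h1
  unfold rate
  positivity

theorem mul_rate_rpow (hε : ε < (N : ℝ) / 2) (hκ : 0 < κ) (h1 : α < 1) :
    κ * rate N ε κ α ^ (-((N : ℝ) / 2 - ε)) = (1 - α) ^ ((N : ℝ) / 2) := by
  have hα : 0 < 1 - α := sub_pos.2 h1
  have hb : (N : ℝ) - 2 * ε ≠ 0 := by linarith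
  have hκ1 : 2 / ((N : ℝ) - 2 * ε) * -((N : ℝ) / 2 - ε) = -1 := by
    field_simp
  have hα1 : -((N : ℝ) / ((N : ℝ) - 2 * ε)) * -((N : ℝ) / 2 - ε) = (N : ℝ) / 2 := by
    field_simp
  rw [rate, mul_rpow (by positivity) (by positivity), ← rpow_mul hκ.le, ← rpow_mul hα.le, hκ1,
    hα1, rpow_neg_one, mul_inv_cancel_left₀ hκ.ne']

theorem tendsto_one_sub_rpow_neg {a : ℝ} (ha : 0 < a) :
    Tendsto (fun α : ℝ => (1 - α) ^ (-a)) (𝓝[<] 1) atTop := by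
  have hsub : Tendsto (fun α : ℝ => 1 - α) (𝓝[<] 1) (𝓝[>] 0) := by
    refine tendsto_nhdsWithin_iff.2 ⟨?_, ?_⟩
    · exact ((continuous_const.sub continuous_id).tendsto' 1 0 (sub_self 1)).mono_left
        nhdsWithin_le_nhds
    · filter_upwards [self_mem_nhdsWithin] with α hα using sub_pos.2 (mem_Iio.1 hα)
  refine ((tendsto_rpow_atTop ha).comp (tendsto_inv_nhdsGT_zero.comp hsub)).congr' ?_
  filter_upwards [self_mem_nhdsWithin] with α hα
  have hα' : 0 ≤ 1 - α := sub_nonneg.2 (mem_Iio.1 hα).le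
  simp only [Function.comp_apply, inv_rpow hα', rpow_neg hα']

theorem tendsto_rate (hN : 1 ≤ N) (hε : ε < (N : ℝ) / 2) (hκ : 0 < κ) :
    Tendsto (rate N ε κ) (𝓝[<] 1) atTop := by
  have hN0 : (0 : ℝ) < N := by exact_mod_cast hN
  have hb : 0 < (N : ℝ) - 2 * ε := by linarith
  exact (tendsto_one_sub_rpow_neg (div_pos hN0 hb)).const_mul_atTop (rpow_pos_of_pos hκ _)

theorem eventually_one_div_le_mul_rate (hε0 : 0 < ε) (hε : ε < (N : ℝ) / 2) (hκ : 0 < κ) {c : ℝ}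
    (hc : 0 < c) : ∀ᶠ α in 𝓝[<] 1, 1 / (1 - α) ≤ c * rate N ε κ α := by
  have hb : 0 < (N : ℝ) - 2 * ε := by linarith
  have hlim := ((tendsto_one_sub_rpow_neg (a := 2 * ε / ((N : ℝ) - 2 * ε))
    (by positivity)).const_mul_atTop
      (by positivity : 0 < c * κ ^ (2 / ((N : ℝ) - 2 * ε)))).eventually_ge_atTop 1
  filter_upwards [hlim, self_mem_nhdsWithin] with α hα h1
  have hα1 : 0 < 1 - α := sub_pos.2 h1
  have hexp : -((N : ℝ) / ((N : ℝ) - 2 * ε)) = -(2 * ε / ((N : ℝ) - 2 * ε)) - 1 := by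
    field_simp
    ring
  rw [rate, hexp, rpow_sub_one hα1.ne', mul_div_assoc', mul_div_assoc', ← mul_assoc]
  gcongr

theorem mul_rpow_neg_le_iff (hε : ε < (N : ℝ) / 2) (hκ : 0 < κ) (h1 : α < 1) {m L : ℝ}
    (hm : 0 < m) (hL : 0 < L) :
    m * κ * L ^ (-((N : ℝ) / 2 - ε)) ≤ (1 - α) ^ ((N : ℝ) / 2) ↔
      m ^ ((N : ℝ) / 2 - ε)⁻¹ * rate N ε κ α ≤ L := by
  have hrate : 0 < rate N ε κ α := rate_pos hκ h1
  rw [← mul_rate_rpow hε hκ h1]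
  have hb : 0 < (N : ℝ) / 2 - ε := by linarith
  set b := (N : ℝ) / 2 - ε
  rw [← rpow_le_rpow_iff_of_neg hL (by positivity) (neg_neg_of_pos hb),
    mul_rpow (by positivity) hrate.le, ← rpow_mul hm.le, mul_neg, inv_mul_cancel₀ hb.ne',
    rpow_neg_one, le_inv_mul_iff₀ hm, mul_comm m κ, mul_assoc, mul_le_mul_iff_right₀ hκ]

theorem neg_log_half_mul_exp_rpow_bounds {T : ℝ} (h0 : 3 / 4 ≤ α) (h1 : α < 1) (hT : 0 < T)
    (hT1 : T ≤ 1) :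
    -log ((T / 2 * exp (-(1 / (1 - α)))) ^ (α / 2)) ∈ Icc 1 (-log T + 1 / (1 - α)) := by
  have hlogσ : -log ((T / 2 * exp (-(1 / (1 - α)))) ^ (α / 2)) =
      α / 2 * (-log T + log 2 + 1 / (1 - α)) := by
    rw [log_rpow (by positivity), log_mul (by positivity) (by positivity),
      log_div hT.ne' two_ne_zero, log_exp]
    ring
  have hlogT : log T ≤ 0 := log_nonpos hT.le hT1
  have hlog2 : 0 < log 2 := log_pos one_lt_two
  have hlog2' : log 2 ≤ 1 := by linarith [log_le_sub_one_of_pos (two_pos : (0 : ℝ) < 2)]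
  have hα4 : 4 ≤ 1 / (1 - α) := by
    rw [le_div_iff₀ (sub_pos.2 h1)]
    linarith
  rw [hlogσ]
  constructor <;> nlinarith

theorem exists_mul_rate_le_of_isSolution (hN : 1 ≤ N) (hε : ε < (N : ℝ) / 2) :
    ∃ c : ℝ, 0 < c ∧ ∀ κ α T : ℝ, 0 < κ → 3 / 4 ≤ α → α < 1 → 0 < T → T ≤ 1 → ∀ u,
      IsSolution α (fujitaExponent N) (toMeasure fun x => κ * fData N ε x) T u →
      c * rate N ε κ α ≤ -log T + 1 / (1 - α) := by
  obtain ⟨C₁, hC₁, hsol⟩ := exists_measure_ball_le_of_isSolution hN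
  obtain ⟨C₂, hC₂, hball⟩ := exists_toMeasure_fData_ball_eq hN hε
  refine ⟨(C₂ / C₁) ^ ((N : ℝ) / 2 - ε)⁻¹, by positivity, fun κ α T hκ h0 h1 hT hT1 u hu => ?_⟩
  set σ := (T / 2 * exp (-(1 / (1 - α)))) ^ (α / 2)
  have hσ0 : 0 < σ := by positivity
  obtain ⟨hL, hLT⟩ : -log σ ∈ Icc 1 (-log T + 1 / (1 - α)) :=
    neg_log_half_mul_exp_rpow_bounds h0 h1 hT hT1
  have hσ1 : σ ≤ 1 / exp 1 := by
    rw [one_div, ← exp_neg, ← log_le_iff_le_exp hσ0]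
    linarith
  have hmass : C₂ * κ * (-log σ) ^ (-((N : ℝ) / 2 - ε)) ≤ C₁ * (1 - α) ^ ((N : ℝ) / 2) := by
    refine (ENNReal.ofReal_le_ofReal_iff ?_).1 ?_
    · have : 0 < 1 - α := sub_pos.2 h1
      positivity
    · exact (hball κ hκ.le σ hσ0 hσ1).ge.trans (hsol α (by linarith) h1 _ T hT u hu 0)
  refine ((mul_rpow_neg_le_iff hε hκ h1 (by positivity) (by linarith)).1 ?_).trans hLT
  rwa [div_mul_eq_mul_div, div_mul_eq_mul_div, div_le_iff₀' hC₁]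

theorem exists_lifeSpan_le (hN : 1 ≤ N) (hε0 : 0 < ε) (hε : ε < (N : ℝ) / 2) :
    ∃ c : ℝ, 0 < c ∧ ∀ κ : ℝ, 0 < κ → ∀ᶠ α in 𝓝[<] 1,
      lifeSpan α (fujitaExponent N) (toMeasure fun x => κ * fData N ε x) ≤
        ENNReal.ofReal (exp (-(c * rate N ε κ α))) := by
  obtain ⟨c, hc, hsol⟩ := exists_mul_rate_le_of_isSolution hN hε
  refine ⟨c / 3, by positivity, fun κ hκ => ?_⟩
  filter_upwards [eventually_one_div_le_mul_rate hε0 hε hκ (by positivity : 0 < c / 3),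
    Ioo_mem_nhdsLT (by norm_num : (3 / 4 : ℝ) < 1)] with α hrate hα
  have hpos : 0 < rate N ε κ α := rate_pos hκ hα.2
  refine sSup_le ?_
  rintro _ ⟨T, ⟨-, u, hu⟩, rfl⟩
  refine ENNReal.ofReal_le_ofReal (le_of_not_gt fun hlt => ?_)
  have hle := hsol κ α _ hκ hα.1.le hα.2 (exp_pos _) (exp_le_one_iff.2 (by nlinarith)) u
    (hu.1.mono hlt.le)
  rw [log_exp] at hle
  nlinarith

theorem mul_mul_rpow_rpow_mul_le {B m l δ : ℝ} (hN : 1 ≤ N) (hB : 0 < B) (hm : 0 ≤ m)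
    (hl : 0 < l) (hδ : 0 ≤ δ) (h : B ^ ((N : ℝ) / 2) * m ≤ δ ^ ((N : ℝ) / 2)) :
    B * (m * l ^ (-((N : ℝ) / 2))) ^ (2 / (N : ℝ)) * l ≤ δ := by
  have : (0 : ℝ) < N := by exact_mod_cast hN
  have hexp : (N : ℝ) / 2 * (2 / N) = 1 := by field_simp
  have hroot := rpow_le_rpow (by positivity) h (by positivity : 0 ≤ 2 / (N : ℝ))
  rw [mul_rpow (by positivity) hm, ← rpow_mul hB.le, ← rpow_mul hδ, hexp, rpow_one,
    rpow_one] at hroot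
  rwa [mul_rpow hm (by positivity), ← rpow_mul hl.le, neg_mul, hexp, rpow_neg_one, mul_assoc,
    inv_mul_cancel_right₀ hl.ne']

theorem exists_le_lifeSpan (hN : 1 ≤ N) (hε : ε < (N : ℝ) / 2) :
    ∃ C₀ : ℝ, 0 < C₀ ∧ ∀ C : ℝ, C₀ ≤ C → ∀ κ : ℝ, 0 < κ → ∀ᶠ α in 𝓝[<] 1,
      ENNReal.ofReal (exp (-(C * rate N ε κ α))) ≤
        lifeSpan α (fujitaExponent N) (toMeasure fun x => κ * fData N ε x) := by
  obtain ⟨B, hB, hexists⟩ := exists_forall_isMinimalSolution hN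
  obtain ⟨D, hD, hdata⟩ := exists_heatSemigroup_toMeasure_fData_le hN hε
  set m := B ^ ((N : ℝ) / 2) * D with hm
  have hm0 : 0 < m := by positivity
  refine ⟨4 * m ^ ((N : ℝ) / 2 - ε)⁻¹, by positivity, fun C hC κ hκ => ?_⟩
  have hC0 : 0 < C := lt_of_lt_of_le (by positivity) hC
  filter_upwards [(tendsto_rate hN hε hκ).eventually_ge_atTop (4 / C),
    Ioo_mem_nhdsLT (by norm_num : (1 / 2 : ℝ) < 1)] with α hlarge hα
  have hrate : 0 < rate N ε κ α := rate_pos hκ hα.2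
  rw [div_le_iff₀' hC0] at hlarge
  set T := exp (-(C * rate N ε κ α)) with hT
  have hT0 : 0 < T := exp_pos _
  have hl : 0 < T ^ α := rpow_pos_of_pos hT0 α
  have hL : C / 4 * rate N ε κ α ≤ -log √(T ^ α) := by
    rw [log_sqrt hl.le, log_rpow hT0, hT, log_exp]
    nlinarith [hα.1]
  have hL0 : 0 < -log √(T ^ α) := lt_of_lt_of_le (by positivity) hL
  have hle : √(T ^ α) ≤ 1 / exp 1 := by
    rw [one_div, ← exp_neg, ← log_le_iff_le_exp (sqrt_pos.2 hl)]
    linarith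
  have hsmall : m * κ * (-log √(T ^ α)) ^ (-((N : ℝ) / 2 - ε)) ≤ (1 - α) ^ ((N : ℝ) / 2) := by
    refine (mul_rpow_neg_le_iff hε hκ hα.2 hm0 hL0).2 (le_trans ?_ hL)
    gcongr
    linarith
  rw [hm, mul_assoc, mul_assoc, ← mul_assoc D] at hsmall
  exact le_sSup ⟨T, ⟨hT0, hexists α hα.1.le hα.2 _ T _ hT0 (by positivity)
    (hdata κ hκ.le _ hl hle)
    (mul_mul_rpow_rpow_mul_le hN hB (by positivity) hl (sub_nonneg.2 hα.2.le) hsmall)⟩, rfl⟩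

theorem tendsto_lifeSpan_fData (hN : 1 ≤ N) (hε0 : 0 < ε) (hε : ε < (N : ℝ) / 2) (hκ : 0 < κ) :
    Tendsto (fun α : ℝ => lifeSpan α (fujitaExponent N) (toMeasure fun x => κ * fData N ε x))
      (𝓝[<] 1) (𝓝 0) := by
  obtain ⟨c, hc, hle⟩ := exists_lifeSpan_le hN hε0 hε
  refine tendsto_of_tendsto_of_tendsto_of_le_of_le' tendsto_const_nhds ?_
    (.of_forall fun _ => zero_le) (hle κ hκ)
  have hexp : Tendsto (fun α => exp (-(c * rate N ε κ α))) (𝓝[<] 1) (𝓝 0) :=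
    tendsto_exp_neg_atTop_nhds_zero.comp ((tendsto_rate hN hε hκ).const_mul_atTop hc)
  simpa using ENNReal.tendsto_ofReal hexp

end LifeSpan

end TimeFracHeat

theorem theorem4p2 (N : ℕ) (hN : 1 ≤ N) (ε : ℝ) (hε0 : 0 < ε) (hε : ε < (N : ℝ) / 2) :
    (∃ c C : ℝ, 0 < c ∧ c < C ∧
      ∀ κ : ℝ, 0 < κ → ∃ α₀ : ℝ, 0 < α₀ ∧ α₀ < 1 ∧ ∀ α : ℝ, α₀ < α → α < 1 →
        ((-(C * (κ ^ (2 / ((N : ℝ) - 2 * ε)) *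
            (1 - α) ^ (-((N : ℝ) / ((N : ℝ) - 2 * ε))))) : ℝ) : EReal) ≤
          ENNReal.log (TimeFracHeat.lifeSpan α (TimeFracHeat.fujitaExponent N)
            (TimeFracHeat.toMeasure fun x => κ * TimeFracHeat.fData N ε x)) ∧
        ENNReal.log (TimeFracHeat.lifeSpan α (TimeFracHeat.fujitaExponent N)
            (TimeFracHeat.toMeasure fun x => κ * TimeFracHeat.fData N ε x)) ≤
          ((-(c * (κ ^ (2 / ((N : ℝ) - 2 * ε)) *
            (1 - α) ^ (-((N : ℝ) / ((N : ℝ) - 2 * ε))))) : ℝ) : EReal)) ∧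
    ∀ κ : ℝ, 0 < κ →
      Tendsto (fun α : ℝ => TimeFracHeat.lifeSpan α (TimeFracHeat.fujitaExponent N)
        (TimeFracHeat.toMeasure fun x => κ * TimeFracHeat.fData N ε x)) (𝓝[<] 1) (𝓝 0) := by
  obtain ⟨c, hc, hupper⟩ := TimeFracHeat.exists_lifeSpan_le hN hε0 hε
  obtain ⟨C₀, -, hlower⟩ := TimeFracHeat.exists_le_lifeSpan hN hε
  refine ⟨⟨c, max C₀ (2 * c), hc, lt_max_of_lt_right (by linarith), fun κ hκ => ?_⟩,
    fun κ hκ => TimeFracHeat.tendsto_lifeSpan_fData hN hε0 hε hκ⟩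
  obtain ⟨α₀, ⟨h0, h1⟩, hα₀⟩ := (mem_nhdsLT_iff_exists_mem_Ico_Ioo_subset one_half_lt_one).1
    ((hlower _ (le_max_left _ _) κ hκ).and (hupper κ hκ))
  refine ⟨α₀, by linarith, h1, fun α hα hα1 => ?_⟩
  obtain ⟨hl, hu⟩ := hα₀ ⟨hα, hα1⟩
  constructor
  · simpa [TimeFracHeat.rate, ENNReal.log_ofReal_of_pos (exp_pos _)] using ENNReal.log_monotone hl
  · simpa [TimeFracHeat.rate, ENNReal.log_ofReal_of_pos (exp_pos _)] using ENNReal.log_monotone hu
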